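/- Let $X$ be a compact Riemann surface (connected, with its complex structure and the corresponding orientation). Conventions. A triangulation $T$ of $X$ is a homeomorphism $T:P\to X$, where the polyhedron $P$ is obtained from finitely many copies (the faces) of the oriented Euclidean equilateral triangle of side length $1$ by gluing their sides in pairs by orientation-reversing isometries of the sides; two sides of the same face may be glued. *The structure $\mathcal C_1$.* The conformal atlas of $P$ consists of (a) the charts with no vertex in their domain that are, in each face, locally orientation-preserving isometries into $\mathbb C$; (b) for each vertex $v$, at which $k$ triangle corners meet (cone angle $k\pi/3$), the charts defined near $v$ that, on each of the $k$ sectors of angle $\pi/3$ at $v$, are given by $z\mapsto z^{\alpha}$ followed by a rotation, with $\alpha=2\pi/(k\pi/3)=6/k$. Its transport to $X$ by $T$ is the structure $\mathcal C_1$ of the equilateral triangulation $T$. *The structure $\mathcal C_2$.* The medians divide each face of $P$ into six right triangles, each having one vertex of $P$ (black), one midpoint of an edge (white) and the centre of the face ($*$); call such a triangle positive (negative) if (white, black, $*$) is its counterclockwise (clockwise) order. A topological Belyi function of $T$ is a map $\beta\circ T^{-1}:X\to\hat{\mathbb C}$, where $\beta:P\to\hat{\mathbb C}$ is continuous, sends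 the white points to $0$, the black ones to $1$ and the $*$-points to $\infty$, and maps every closed positive (negative) right triangle homeomorphically onto the closed upper (lower) half-plane together with $\infty$, boundary onto $\mathbb R\cup\{\infty\}$. The structure $\mathcal C_2$ is the pull-back by $\beta\circ T^{-1}$ of the structure of $\hat{\mathbb C}$: away from the ramification points its charts are local restrictions of $\beta\circ T^{-1}$ composed with charts of $\hat{\mathbb C}$, and $\beta\circ T^{-1}$ is holomorphic everywhere. Theorem. The following are equivalent. 1. There are a triangulation $T$ of $X$ and a topological Belyi function of $T$ such that the conformal structure of $X$ is the associated structure $\mathcal C_2$. 2. There is an equilateral triangulation $T$ of $X$ such that the conformal structure of $X$ is the associated structure $\mathcal C_1$. More precisely: * if the conformal structure of $X$ is $\mathcal C_2$ for a topological Belyi function of a triangulation $T$, then it is $\mathcal C_1$ for an equilateral triangulation $T'$ with the same underlying cells (faces, edges and vertices in $X$) as $T$; * if the conformal structure of $X$ is $\mathcal C_1$ for an equilateral triangulation $T$, then it is $\mathcal C_2$ for a topological Belyi function $\beta\circ T^{-1}$ of $T$ such that $\beta$ maps the interior of each Euclidean right triangle of the barycentric subdivision conformally onto the open upper or lower half-plane.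 -/

import Mathlib

open scoped Manifold ContDiff Topology

noncomputable section

/-! ### The Riemann sphere `ℂ ∪ {∞}` with its two standard charts `z` and `1 / z` -/

namespace RiemannSphere

/-- The map `z ↦ 1 / z` of the Riemann sphere, exchanging `0` and `∞`. -/
def inversion : OnePoint ℂ → OnePoint ℂ
  | OnePoint.infty => ((0 : ℂ) : OnePoint ℂ)
  | OnePoint.some z => if z = 0 then OnePoint.infty else ((z⁻¹ : ℂ) : OnePoint ℂ)

theorem inversion_infty : inversion OnePoint.infty = ((0 : ℂ) : OnePoint ℂ) := rfl

theorem inversion_coe (z : ℂ) :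
    inversion (z : OnePoint ℂ) = if z = 0 then OnePoint.infty else ((z⁻¹ : ℂ) : OnePoint ℂ) := rfl

theorem inversion_inversion (p : OnePoint ℂ) : inversion (inversion p) = p := by
  induction p using OnePoint.rec with
  | infty => simp [inversion_infty, inversion_coe]
  | coe z =>
    by_cases hz : z = 0
    · simp [inversion_coe, hz, inversion_infty]
    · simp [inversion_coe, hz]

theorem continuous_inversion : Continuous inversion := by
  rw [continuous_iff_continuousAt]
  intro p
  induction p using OnePoint.rec with
  | infty =>
    rw [OnePoint.continuousAt_infty', inversion_infty]
    have h1 : Filter.Tendsto (fun z : ℂ => ((z⁻¹ : ℂ) : OnePoint ℂ))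
        (Filter.coclosedCompact ℂ) (𝓝 ((0 : ℂ) : OnePoint ℂ)) := by
      refine (OnePoint.continuous_coe.tendsto (0 : ℂ)).comp ?_
      rw [Filter.coclosedCompact_eq_cocompact, ← Metric.cobounded_eq_cocompact]
      exact Filter.tendsto_inv₀_cobounded
    refine h1.congr' ?_
    rw [Filter.coclosedCompact_eq_cocompact]
    have : ({0} : Set ℂ)ᶜ ∈ Filter.cocompact ℂ := isCompact_singleton.compl_mem_cocompact
    filter_upwards [this] with z hz
    have hz' : z ≠ 0 := hz
    simp [inversion_coe, hz']
  | coe z =>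
    rw [OnePoint.continuousAt_coe]
    by_cases hz : z = 0
    · subst hz
      rw [continuousAt_iff_punctured_nhds]
      have h1 : Filter.Tendsto (fun z : ℂ => ((z⁻¹ : ℂ) : OnePoint ℂ)) (𝓝[≠] 0)
          (𝓝 (OnePoint.infty : OnePoint ℂ)) := by
        refine OnePoint.tendsto_coe_infty.comp ?_
        rw [Filter.coclosedCompact_eq_cocompact, ← Metric.cobounded_eq_cocompact]
        exact Filter.tendsto_inv₀_nhdsNE_zero
      have h2 : (inversion ∘ ((↑) : ℂ → OnePoint ℂ)) 0 = OnePoint.infty := by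
        simp [inversion_coe]
      rw [h2]
      refine h1.congr' ?_
      filter_upwards [self_mem_nhdsWithin] with w hw
      have hw' : w ≠ 0 := hw
      simp [inversion_coe, hw']
    · have h1 : ContinuousAt (fun w : ℂ => ((w⁻¹ : ℂ) : OnePoint ℂ)) z :=
        OnePoint.continuous_coe.continuousAt.comp (continuousAt_inv₀ hz)
      refine h1.congr ?_
      filter_upwards [isOpen_ne.mem_nhds hz] with w hw
      have hw' : w ≠ 0 := hw
      simp [inversion_coe, hw']

/-- Inversion as a homeomorphism of the sphere. -/
def inversionHomeo : OnePoint ℂ ≃ₜ OnePoint ℂ where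
  toFun := inversion
  invFun := inversion
  left_inv := inversion_inversion
  right_inv := inversion_inversion
  continuous_toFun := continuous_inversion
  continuous_invFun := continuous_inversion

/-- The chart `z` on `ℂ`. -/
def chartZero : OpenPartialHomeomorph (OnePoint ℂ) ℂ :=
  (OnePoint.isOpenEmbedding_coe.toOpenPartialHomeomorph ((↑) : ℂ → OnePoint ℂ)).symm

/-- The chart `1 / z` on `(ℂ ∖ {0}) ∪ {∞}`. -/
def chartInfty : OpenPartialHomeomorph (OnePoint ℂ) ℂ :=
  inversionHomeo.toOpenPartialHomeomorph.trans chartZero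

open Classical in
instance : ChartedSpace ℂ (OnePoint ℂ) where
  atlas := {chartZero, chartInfty}
  chartAt p := if p = OnePoint.infty then chartInfty else chartZero
  mem_chart_source p := by
    induction p using OnePoint.rec with
    | infty => simp [chartInfty, chartZero, inversionHomeo, inversion_infty]
    | coe z => simp [chartZero]
  chart_mem_atlas p := by
    by_cases h : p = OnePoint.infty <;> simp [h]

theorem chartZero_symm_apply (z : ℂ) : chartZero.symm z = (z : OnePoint ℂ) := rfl

theorem chartZero_coe (z : ℂ) : chartZero (z : OnePoint ℂ) = z :=
  OnePoint.isOpenEmbedding_coe.toOpenPartialHomeomorph_left_inv _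

theorem chartInfty_symm_apply (z : ℂ) : chartInfty.symm z = inversion z := rfl

theorem chartInfty_apply (p : OnePoint ℂ) : chartInfty p = chartZero (inversion p) := rfl

theorem chartZero_source : chartZero.source = Set.range ((↑) : ℂ → OnePoint ℂ) := by
  simp [chartZero]

theorem chartInfty_source : chartInfty.source = inversion ⁻¹' Set.range ((↑) : ℂ → OnePoint ℂ) := by
  simp [chartInfty, chartZero, inversionHomeo]

theorem ne_zero_of_inversion_mem {z : ℂ}
    (h : inversion (z : OnePoint ℂ) ∈ Set.range ((↑) : ℂ → OnePoint ℂ)) : z ≠ 0 := by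
  rintro rfl
  simp [inversion_coe] at h

theorem contDiffOn_inv_of_subset {s : Set ℂ} (hs : ∀ z ∈ s, z ≠ 0) :
    ContDiffOn ℂ ω (fun z : ℂ => z⁻¹) s :=
  fun z hz => (contDiffAt_inv ℂ (hs z hz)).contDiffWithinAt

instance : IsManifold 𝓘(ℂ) ω (OnePoint ℂ) := by
  refine isManifold_of_contDiffOn _ _ _ ?_
  have key : ∀ z : ℂ, z ≠ 0 → chartZero (inversion (z : OnePoint ℂ)) = z⁻¹ := by
    intro z hz
    rw [inversion_coe, if_neg hz, chartZero_coe]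
  rintro e e' (rfl | rfl) (rfl | rfl)
  · refine contDiffOn_id.congr ?_
    intro z _
    simp [chartZero_symm_apply, chartZero_coe]
  · have h0 : ∀ z ∈ 𝓘(ℂ).symm ⁻¹' (chartZero.symm.trans chartInfty).source ∩ Set.range 𝓘(ℂ),
        z ≠ 0 := by
      rintro z ⟨hz, -⟩
      simp only [OpenPartialHomeomorph.trans_source, chartInfty_source] at hz
      exact ne_zero_of_inversion_mem hz.2
    refine (contDiffOn_inv_of_subset h0).congr fun z hz => ?_
    exact key z (h0 z hz)
  · have h0 : ∀ z ∈ 𝓘(ℂ).symm ⁻¹' (chartInfty.symm.trans chartZero).source ∩ Set.range 𝓘(ℂ),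
        z ≠ 0 := by
      rintro z ⟨hz, -⟩
      simp only [OpenPartialHomeomorph.trans_source, chartZero_source] at hz
      exact ne_zero_of_inversion_mem hz.2
    refine (contDiffOn_inv_of_subset h0).congr fun z hz => ?_
    exact key z (h0 z hz)
  · refine contDiffOn_id.congr ?_
    intro z _
    simp [chartInfty_symm_apply, chartInfty_apply, inversion_inversion, chartZero_coe]

/-- The closed upper half-plane together with `∞`. -/
def upperHemisphere : Set (OnePoint ℂ) :=
  insert OnePoint.infty ((↑) '' {z : ℂ | 0 ≤ z.im})

/-- The closed lower half-plane together with `∞`. -/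
def lowerHemisphere : Set (OnePoint ℂ) :=
  insert OnePoint.infty ((↑) '' {z : ℂ | z.im ≤ 0})

/-- The real line together with `∞`. -/
def equator : Set (OnePoint ℂ) :=
  insert OnePoint.infty ((↑) '' {z : ℂ | z.im = 0})

end RiemannSphere

/-! ### The equilateral triangle of side length `1` and its barycentric subdivision -/

namespace Equilateral

/-- The vertices `0`, `1`, `exp (iπ/3)`, in counterclockwise order. -/
def corner : Fin 3 → ℂ := ![0, 1, Complex.exp (Real.pi / 3 * Complex.I)]

/-- The closed triangle, as a subset of the Euclidean plane. -/
def triangle : Set ℂ := convexHull ℝ (Set.range corner)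

theorem corner_mem (i : Fin 3) : corner i ∈ triangle :=
  subset_convexHull ℝ _ (Set.mem_range_self i)

/-- The point at distance `s` from `corner i` on side `i`, which runs from `corner i` to
`corner (i + 1)` (indices modulo `3`). -/
def sidePoint (i : Fin 3) (s : ℝ) : ℂ := AffineMap.lineMap (corner i) (corner (i + 1)) s

/-- The midpoint of side `i`. -/
def mid (i : Fin 3) : ℂ := midpoint ℝ (corner i) (corner (i + 1))

theorem mid_mem (i : Fin 3) : mid i ∈ triangle :=
  (convex_convexHull ℝ _).segment_subset (corner_mem i) (corner_mem (i + 1))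
    (midpoint_mem_segment _ _)

/-- The common point of the medians. -/
def center : ℂ := (corner 0 + corner 1 + corner 2) / 3

theorem center_mem : center ∈ triangle := by
  have h : mid 0 ∈ triangle := mid_mem 0
  have h2 : AffineMap.lineMap (mid 0) (corner 2) (1 / 3 : ℝ) ∈ triangle :=
    (convex_convexHull ℝ _).lineMap_mem h (corner_mem 2) ⟨by norm_num, by norm_num⟩
  convert h2 using 1
  simp only [center, mid, midpoint_eq_smul_add, AffineMap.lineMap_apply, vsub_eq_sub, vadd_eq_add,
    Complex.real_smul]
  push_cast
  simp only [invOf_eq_inv]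
  push_cast
  ring

/-- The right triangle of the barycentric subdivision whose vertices `mid i` (white),
`corner (i + 1)` (black), `center` (star) are in counterclockwise order. -/
def plusTriangle (i : Fin 3) : Set ℂ := convexHull ℝ {mid i, corner (i + 1), center}

/-- The right triangle of the barycentric subdivision whose vertices `mid i` (white),
`corner i` (black), `center` (star) are in clockwise order. -/
def minusTriangle (i : Fin 3) : Set ℂ := convexHull ℝ {mid i, corner i, center}

/-- The Euclidean coordinate in which `corner i` is `0`, and in which the triangle is the part near
`0` of the sector `0 ≤ arg ≤ π/3`. -/
def sectorCoord (i : Fin 3) (z : ℂ) : ℂ := (z - corner i) / (corner (i + 1) - corner i)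

end Equilateral

open Equilateral

/-! ### Closed oriented polyhedra made of equilateral triangles -/

/-- Combinatorial data for gluing finitely many triangles along their sides in pairs. The pair
`(f, i)` stands for side `i` of the face `f`. Two sides of the same face may be glued. -/
structure TriangleGluing where
  Face : Type
  finite_face : Finite Face
  glue : Face × Fin 3 → Face × Fin 3
  glue_glue : ∀ e, glue (glue e) = e
  glue_ne : ∀ e, glue e ≠ e

namespace TriangleGluing

variable (G : TriangleGluing)

/-- The identifications: glued sides are identified by the isometry which reverses their boundary
orientations (so that the orientations of the faces fit together). -/
def Ident (p q : Σ _ : G.Face, triangle) : Prop :=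
  ∃ (i : Fin 3) (s : ℝ), s ∈ Set.Icc (0 : ℝ) 1 ∧ (p.2 : ℂ) = sidePoint i s ∧
    q.1 = (G.glue (p.1, i)).1 ∧ (q.2 : ℂ) = sidePoint (G.glue (p.1, i)).2 (1 - s)

/-- The oriented Euclidean polyhedron: the quotient of the disjoint union of the triangles by the
equivalence relation generated by the identifications, with the quotient topology. -/
def Polyhedron : Type := Quot G.Ident

instance : TopologicalSpace G.Polyhedron := inferInstanceAs (TopologicalSpace (Quot G.Ident))

/-- The point of the polyhedron given by the point `z` of the face `f`. -/
def pt (f : G.Face) (z : triangle) : G.Polyhedron := Quot.mk G.Ident ⟨f, z⟩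

/-- The vertex of the polyhedron given by a corner of a face. -/
def vertex (c : G.Face × Fin 3) : G.Polyhedron := G.pt c.1 ⟨corner c.2, corner_mem c.2⟩

/-- The number of face corners at the point `v`; the cone angle at a vertex `v` is `π/3` times
this. -/
def numCorners (v : G.Polyhedron) : ℕ := Nat.card {c : G.Face × Fin 3 // G.vertex c = v}

variable {G}

/-- Charts away from the vertices: in each face they are locally orientation-preserving
isometries to the Euclidean plane. -/
def IsFlatChart (e : OpenPartialHomeomorph G.Polyhedron ℂ) : Prop :=
  (∀ c, G.vertex c ∉ e.source) ∧
  ∀ (f : G.Face) (z : triangle), G.pt f z ∈ e.source →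
    ∃ a b : ℂ, ‖a‖ = 1 ∧ ∀ᶠ w : triangle in 𝓝 z, e (G.pt f w) = a * w + b

/-- Charts flattening the cone at the vertex `v`: a small neighbourhood of `v` is a union of
Euclidean sectors of angle `π/3`, and on each of them the chart is `z ↦ z ^ α` followed by a
rotation, with `α = 2π / (numCorners v * π/3)`. -/
def IsVertexChart (v : G.Polyhedron) (e : OpenPartialHomeomorph G.Polyhedron ℂ) : Prop :=
  v ∈ e.source ∧
  (∀ p ∈ e.source, ∃ c : G.Face × Fin 3, G.vertex c = v ∧
    ∃ z : triangle, dist (z : ℂ) (corner c.2) < 1 / 2 ∧ p = G.pt c.1 z) ∧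
  ∀ c : G.Face × Fin 3, G.vertex c = v → ∃ ρ : ℂ, ‖ρ‖ = 1 ∧
    ∀ z : triangle, dist (z : ℂ) (corner c.2) < 1 / 2 → G.pt c.1 z ∈ e.source →
      e (G.pt c.1 z) = ρ * sectorCoord c.2 z ^ ((6 : ℂ) / (G.numCorners v : ℂ))

variable (G) in
/-- The conformal atlas of the Euclidean polyhedron. -/
def conformalAtlas : Set (OpenPartialHomeomorph G.Polyhedron ℂ) :=
  {e | IsFlatChart e ∨ ∃ c, IsVertexChart (G.vertex c) e}

/-- `β` is a (topological) Belyi function of the triangulation: on the barycentric subdivision, with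
the vertices of the triangulation black, the midpoints of the edges white and the centres of
the faces starred, `β` maps the positive (negative) right triangles homeomorphically onto the closed
upper (lower) hemisphere, boundary to equator, white vertices to `0`, black ones to `1`, stars to
`∞`. -/
structure IsBelyiMap (β : G.Polyhedron → OnePoint ℂ) : Prop where
  continuous : Continuous β
  white : ∀ f i, β (G.pt f ⟨mid i, mid_mem i⟩) = ((0 : ℂ) : OnePoint ℂ)
  black : ∀ f i, β (G.pt f ⟨corner i, corner_mem i⟩) = ((1 : ℂ) : OnePoint ℂ)
  star : ∀ f, β (G.pt f ⟨center, center_mem⟩) = OnePoint.infty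
  plus : ∀ f i, Set.BijOn (fun z : triangle => β (G.pt f z))
    (Subtype.val ⁻¹' plusTriangle i) RiemannSphere.upperHemisphere
  plus_boundary : ∀ f i, Set.BijOn (fun z : triangle => β (G.pt f z))
    (Subtype.val ⁻¹' frontier (plusTriangle i)) RiemannSphere.equator
  minus : ∀ f i, Set.BijOn (fun z : triangle => β (G.pt f z))
    (Subtype.val ⁻¹' minusTriangle i) RiemannSphere.lowerHemisphere
  minus_boundary : ∀ f i, Set.BijOn (fun z : triangle => β (G.pt f z))
    (Subtype.val ⁻¹' frontier (minusTriangle i)) RiemannSphere.equator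

/-- `β` maps the interior of every Euclidean right triangle of the barycentric subdivision
conformally onto the open upper or lower half-plane. -/
def IsConformalOnRightTriangles (β : G.Polyhedron → OnePoint ℂ) : Prop :=
  ∀ f i,
    (∃ F : ℂ → ℂ, DifferentiableOn ℂ F (interior (plusTriangle i)) ∧
      Set.BijOn F (interior (plusTriangle i)) {w | 0 < w.im} ∧
      ∀ z : triangle, (z : ℂ) ∈ interior (plusTriangle i) → β (G.pt f z) = (F z : OnePoint ℂ)) ∧
    (∃ F : ℂ → ℂ, DifferentiableOn ℂ F (interior (minusTriangle i)) ∧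
      Set.BijOn F (interior (minusTriangle i)) {w | w.im < 0} ∧
      ∀ z : triangle, (z : ℂ) ∈ interior (minusTriangle i) → β (G.pt f z) = (F z : OnePoint ℂ))

end TriangleGluing

/-! ### Triangulations of a surface and the conformal structures they define -/

/-- A triangulation of `X`: a homeomorphism from a polyhedron glued from triangles. It transports the
Euclidean structure of the polyhedron to `X`, so it is also an equilateral triangulation of `X`. -/
abbrev Triangulation (G : TriangleGluing) (X : Type*) [TopologicalSpace X] := G.Polyhedron ≃ₜ X

namespace Triangulation

variable {G : TriangleGluing} {X : Type*} [TopologicalSpace X]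

/-- Two triangulations with the same closed faces, edges and vertices in `X` (but possibly
different Euclidean structures on them). -/
def SameCells (T T' : Triangulation G X) : Prop :=
  (∀ f : G.Face, T '' Set.range (G.pt f) = T' '' Set.range (G.pt f)) ∧
  (∀ (f : G.Face) (i : Fin 3),
    T '' (G.pt f '' {z | ∃ s ∈ Set.Icc (0 : ℝ) 1, (z : ℂ) = sidePoint i s}) =
      T' '' (G.pt f '' {z | ∃ s ∈ Set.Icc (0 : ℝ) 1, (z : ℂ) = sidePoint i s})) ∧
  ∀ c, T (G.vertex c) = T' (G.vertex c)

variable [ChartedSpace ℂ X]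

/-- The conformal structure of `X` is the structure `𝒞₁` of the equilateral triangulation: the
conformal atlas of the polyhedron, transported to `X`, is an atlas of `X` made of holomorphic
charts. -/
def IsC1 (T : Triangulation G X) : Prop :=
  (∀ x : X, ∃ e ∈ G.conformalAtlas, T.symm x ∈ e.source) ∧
  ∀ e ∈ G.conformalAtlas,
    T.symm.transOpenPartialHomeomorph e ∈ IsManifold.maximalAtlas 𝓘(ℂ) ω X

end Triangulation

/-- The conformal structure of `X` is the structure `𝒞₂`, the pull-back of the structure of the
Riemann sphere by `β`: the charts of the sphere, composed with the restrictions of `β` to open sets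
which it maps homeomorphically onto open sets, are holomorphic charts of `X` (these cover the
complement of the ramification points), and `β` is holomorphic everywhere. -/
def IsC2 {X : Type*} [TopologicalSpace X] [ChartedSpace ℂ X] (β : X → OnePoint ℂ) : Prop :=
  (∀ g : OpenPartialHomeomorph X (OnePoint ℂ), Set.EqOn g β g.source →
    ∀ φ ∈ atlas ℂ (OnePoint ℂ), g.trans φ ∈ IsManifold.maximalAtlas 𝓘(ℂ) ω X) ∧
  MDifferentiable 𝓘(ℂ) 𝓘(ℂ) β

end

/-! Both structures are governed by one explicit Belyi function. The Schwarz–Christoffel integral of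
`(1 - u³) ^ (-2/3)` maps the closed unit disc homeomorphically, and the open disc conformally, onto
an equilateral triangle, carrying the cube roots of unity to the corners and commuting with the
symmetries. Its inverse followed by `u ↦ (1 + u³)² / (4u³)` is conformal on each of the six right
triangles, with values in a half-plane (`triBelyi`). Rotational and reflectional symmetry, together
with real values on the sides, make the functions on the faces agree along glued sides, so they
define `belyi` on every polyhedron. The pivot of the proof is: the structure of `X` is `𝒞₁` for `T`
if and only if `belyi ∘ T⁻¹` is holomorphic.

Suppose the structure is `𝒞₁`. In a Euclidean coordinate `belyi` is holomorphic inside the faces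
except at the centres. Across an edge it is continuous and holomorphic on both sides of a line,
hence holomorphic by Painlevé's theorem. The finitely many centres and vertices are removable, since
`belyi` is continuous into the sphere (`mdifferentiable_belyi_of_isC1`). A holomorphic map to the
sphere satisfies `IsC2`, because a holomorphic homeomorphism onto an open plane set is a chart.

Conversely, let `belyi ∘ T⁻¹` be holomorphic. The edges and medians form the preimage of the
equator, locally the real locus of a nonconstant holomorphic function. A continuous function that is
holomorphic off this locus is holomorphic (`mdifferentiableAt_of_not_mem_equator`). Inside a right
triangle `belyi` is locally invertible in the Euclidean coordinate, so that coordinate is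
holomorphic on `X`; this makes every flat or conical chart holomorphic. Conical charts exist at each
vertex because the sixth power of the sector coordinate is single-valued and holomorphic there. It
is thus an `n`-th power of a local coordinate, and counting solutions shows that `n` is the number
of sectors.

Finally, an arbitrary topological Belyi function `β` differs from `belyi` by a homeomorphism `η` of
the polyhedron preserving all cells, with `β ∘ η = belyi` (`exists_homeomorph_of_isBelyiMap`). It is
the inverse of `β` after `belyi` on each right triangle. The pieces fit because a Belyi function
must send each side of a right triangle to the arc of the equator bounded by the images of its ends
and avoiding the third marked point. Replacing `T` by `T ∘ η` turns `β ∘ T⁻¹` into the function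
`belyi` of the new triangulation, to which the criterion applies. -/

section PlaneAnalysis

/-! ### Painlevé's theorem and local inverses of holomorphic functions -/

open Complex Set Filter Metric

/-- **Painlevé's theorem** for the real line. -/
theorem differentiableOn_of_continuousOn_of_im_ne_zero {U : Set ℂ} (hU : IsOpen U) {f : ℂ → ℂ}
    (hc : ContinuousOn f U) (hd : ∀ z ∈ U, z.im ≠ 0 → DifferentiableAt ℂ f z) :
    DifferentiableOn ℂ f U := by
  -- Morera: it suffices that the integral over the boundary of every rectangle in `U` vanishes.
  refine (isConservativeOn_and_continuousOn_iff_isDifferentiableOn hU).1 ⟨fun z w hzw => ?_, hc⟩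
  rw [← add_eq_zero_iff_eq_neg, wedgeIntegral_add_wedgeIntegral_eq]
  -- Cauchy's theorem for a rectangle whose interior misses the real axis: only continuity is needed
  -- on the boundary.
  have key : ∀ z w : ℂ, Rectangle z w ⊆ U → (0 : ℝ) ∉ Ioo (min z.im w.im) (max z.im w.im) →
      (∫ x : ℝ in z.re..w.re, f (x + z.im * I)) - (∫ x : ℝ in z.re..w.re, f (x + w.im * I)) +
      I • (∫ y : ℝ in z.im..w.im, f (w.re + y * I)) -
      I • (∫ y : ℝ in z.im..w.im, f (z.re + y * I)) = 0 := by
    intro z w hzw h0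
    refine integral_boundary_rect_eq_zero_of_continuousOn_of_differentiableOn f z w (hc.mono hzw) ?_
    intro x hx
    refine (hd x (hzw ⟨?_, ?_⟩) ?_).differentiableWithinAt
    · exact Ioo_subset_Icc_self hx.1
    · exact Ioo_subset_Icc_self hx.2
    · intro h
      exact h0 (h ▸ hx.2)
  -- A rectangle crossing the real axis is cut along it: the two integrals over the cut cancel and
  -- the vertical sides add up.
  by_cases h0 : (0 : ℝ) ∈ Ioo (min z.im w.im) (max z.im w.im)
  · have h0' : (0 : ℝ) ∈ uIcc z.im w.im := Ioo_subset_Icc_self h0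
    have h1 := key z (w.re : ℂ) (by
      intro x hx
      simp only [Rectangle, ofReal_re, ofReal_im] at hx
      exact hzw ⟨hx.1, uIcc_subset_uIcc_left h0' hx.2⟩) (by
        intro h
        simp only [ofReal_im, mem_Ioo] at h
        rcases le_total z.im 0 with h2 | h2 <;> simp [h2] at h)
    have h2 := key (z.re : ℂ) w (by
      intro x hx
      simp only [Rectangle, ofReal_re, ofReal_im] at hx
      exact hzw ⟨hx.1, uIcc_subset_uIcc_right h0' hx.2⟩) (by
        intro h
        simp only [ofReal_im, mem_Ioo] at h
        rcases le_total w.im 0 with h2 | h2 <;> simp [h2] at h)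
    simp only [ofReal_re, ofReal_im] at h1 h2
    have hcv : ∀ a ∈ uIcc z.re w.re, ContinuousOn (fun y : ℝ => f (a + y * I)) (uIcc z.im w.im) := by
      intro a ha
      refine hc.comp (by fun_prop) ?_
      intro y hy
      refine hzw ⟨?_, ?_⟩
      · simpa using ha
      · simpa using hy
    have i1 : ∀ a ∈ uIcc z.re w.re, (∫ y : ℝ in z.im..w.im, f (a + y * I)) =
        (∫ y : ℝ in z.im..0, f (a + y * I)) + ∫ y : ℝ in (0 : ℝ)..w.im, f (a + y * I) := by
      intro a ha
      rw [intervalIntegral.integral_add_adjacent_intervals]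
      · exact ((hcv a ha).mono (uIcc_subset_uIcc_left h0')).intervalIntegrable
      · exact ((hcv a ha).mono (uIcc_subset_uIcc_right h0')).intervalIntegrable
    rw [i1 w.re right_mem_uIcc, i1 z.re left_mem_uIcc]
    simp only [smul_eq_mul] at *
    linear_combination h1 + h2
  · exact key z w hzw h0

/-- The zeros of the analytic function `F'` are isolated unless `F'` vanishes near `z`, in which
case `F` is locally constant. -/
theorem AnalyticAt.eventually_deriv_ne_zero {F : ℂ → ℂ} {z : ℂ} (hF : AnalyticAt ℂ F z)
    (hn : ¬ ∀ᶠ w in 𝓝 z, F w = F z) : ∀ᶠ w in 𝓝[≠] z, deriv F w ≠ 0 := by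
  rcases hF.deriv.eventually_eq_zero_or_eventually_ne_zero with h | h
  · refine absurd ?_ hn
    obtain ⟨r, hr, hr'⟩ := Metric.eventually_nhds_iff_ball.1 (h.and hF.eventually_analyticAt)
    filter_upwards [ball_mem_nhds z hr] with w hw
    exact (convex_ball z r).is_const_of_fderivWithin_eq_zero (𝕜 := ℂ) (f := F)
      (fun x hx => (hr' x hx).2.differentiableAt.differentiableWithinAt)
      (fun x hx => by
        rw [fderivWithin_of_isOpen isOpen_ball hx]
        ext; simpa using (hr' x hx).1) hw (mem_ball_self hr)
  · exact h

/-- The inverse of a holomorphic homeomorphism between open sets is holomorphic. -/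
theorem OpenPartialHomeomorph.differentiableOn_symm (e : OpenPartialHomeomorph ℂ ℂ)
    (he : DifferentiableOn ℂ e e.source) : DifferentiableOn ℂ e.symm e.target := by
  have han : ∀ z ∈ e.source, AnalyticAt ℂ e z := fun z hz =>
    he.analyticAt (e.open_source.mem_nhds hz)
  intro w hw
  have hz := e.map_target hw
  set z := e.symm w with hzw
  have hn : ¬ ∀ᶠ x in 𝓝 z, e x = e z := by
    intro h
    have h1 : ∀ᶠ x in 𝓝 z, x = z := by
      filter_upwards [h, e.open_source.mem_nhds hz] with x hx hx'
      exact e.injOn hx' hz hx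
    have h2 : ({z} : Set ℂ) ∈ 𝓝 z := h1
    exact (NormedField.nhdsNE_neBot z).ne (by
      rw [nhdsWithin, ← empty_mem_iff_bot]
      refine ⟨_, h2, {z}ᶜ, mem_principal_self _, by simp⟩)
  -- Injectivity prevents `e` from being locally constant, so a critical point is isolated. The
  -- inverse is then holomorphic in a punctured neighbourhood and continuous, and the singularity is
  -- removable.
  refine (analyticAt_of_differentiable_on_punctured_nhds_of_continuousAt ?_
    (e.continuousAt_symm hw)).differentiableAt.differentiableWithinAt
  have h1 := (han z hz).eventually_deriv_ne_zero hn
  have h2 : Tendsto e.symm (𝓝[≠] w) (𝓝[≠] z) := by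
    refine tendsto_nhdsWithin_iff.2 ⟨(e.continuousAt_symm hw).tendsto.mono_left
      nhdsWithin_le_nhds, ?_⟩
    filter_upwards [self_mem_nhdsWithin, nhdsWithin_le_nhds (e.open_target.mem_nhds hw)]
      with x hx hx' h
    exact hx (e.symm.injOn hx' hw h)
  filter_upwards [h2.eventually h1, nhdsWithin_le_nhds (e.open_target.mem_nhds hw)] with x hx hx'
  exact (e.hasDerivAt_symm hx' hx (han _ (e.map_target hx')).differentiableAt.hasDerivAt
    ).differentiableAt

/-- A holomorphic function with nonzero derivative is a local homeomorphism. -/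
theorem AnalyticAt.exists_openPartialHomeomorph {F : ℂ → ℂ} {z : ℂ} (hF : AnalyticAt ℂ F z)
    (h : deriv F z ≠ 0) : ∃ e : OpenPartialHomeomorph ℂ ℂ, z ∈ e.source ∧ (∀ w, e w = F w) ∧
      DifferentiableOn ℂ F e.source := by
  have hs' := hF.hasStrictDerivAt.hasStrictFDerivAt_equiv h
  let e := hs'.toOpenPartialHomeomorph F
  have hz : z ∈ e.source := hs'.mem_toOpenPartialHomeomorph_source
  obtain ⟨U, hU, hUo, hzU⟩ := _root_.mem_nhds_iff.1 hF.eventually_analyticAt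
  refine ⟨e.restrOpen U hUo, ⟨hz, hzU⟩, fun w => rfl, fun w hw => ?_⟩
  exact (hU hw.2).differentiableAt.differentiableWithinAt

theorem AnalyticAt.exists_local_inverse {F : ℂ → ℂ} {z : ℂ} (hF : AnalyticAt ℂ F z)
    (h : deriv F z ≠ 0) :
    ∃ G : ℂ → ℂ, G (F z) = z ∧ AnalyticAt ℂ G (F z) ∧ (∀ᶠ w in 𝓝 z, G (F w) = w) ∧
      ∀ᶠ w in 𝓝 (F z), F (G w) = w := by
  obtain ⟨e, hz, he, hd⟩ := hF.exists_openPartialHomeomorph h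
  have hl : ∀ w ∈ e.source, e.symm (F w) = w := fun w hw => by rw [← he]; exact e.left_inv hw
  have ht : e.target ∈ 𝓝 (F z) := by
    rw [← he]; exact e.open_target.mem_nhds (e.map_source hz)
  refine ⟨e.symm, hl z hz, ?_, ?_, ?_⟩
  · exact (e.differentiableOn_symm (hd.congr fun w _ => he w)).analyticAt ht
  · filter_upwards [e.open_source.mem_nhds hz] using hl
  · filter_upwards [ht] with w hw
    rw [← he]; exact e.right_inv hw

/-- A continuous function which is holomorphic off the real locus of a nonconstant holomorphic
function is holomorphic. -/
theorem differentiableAt_of_differentiableAt_of_im_ne_zero {F u : ℂ → ℂ} {z : ℂ}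
    (hF : AnalyticAt ℂ F z) (hn : ¬ ∀ᶠ w in 𝓝 z, F w = F z)
    (hu : ∀ᶠ w in 𝓝 z, ContinuousAt u w)
    (hd : ∀ᶠ w in 𝓝 z, (F w).im ≠ 0 → DifferentiableAt ℂ u w) : DifferentiableAt ℂ u z := by
  -- Critical points of `F` are isolated and hence removable. Elsewhere `F` is a local coordinate
  -- that turns its real locus into the real axis, where Painlevé's theorem applies.
  refine (analyticAt_of_differentiable_on_punctured_nhds_of_continuousAt ?_
    hu.self_of_nhds).differentiableAt
  filter_upwards [hF.eventually_deriv_ne_zero hn, hF.eventually_analyticAt.filter_mono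
    nhdsWithin_le_nhds, hu.eventually_nhds.filter_mono nhdsWithin_le_nhds,
    hd.eventually_nhds.filter_mono nhdsWithin_le_nhds] with w h1 h2 h3 h4
  obtain ⟨G, hG0, hG, hGl, hGr⟩ := h2.exists_local_inverse h1
  have hGt : Tendsto G (𝓝 (F w)) (𝓝 w) := by
    simpa [ContinuousAt, hG0] using hG.continuousAt
  have hev := (((hGt.eventually (h3.and h4)).and hG.eventually_analyticAt).and hGr)
  obtain ⟨r, hr, hr'⟩ := Metric.eventually_nhds_iff_ball.1 hev
  have hdo : DifferentiableOn ℂ (u ∘ G) (ball (F w) r) := by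
    refine differentiableOn_of_continuousOn_of_im_ne_zero isOpen_ball ?_ ?_
    · intro x hx
      obtain ⟨⟨⟨a, b⟩, c⟩, d⟩ := hr' x hx
      exact (ContinuousAt.comp a c.continuousAt).continuousWithinAt
    · intro x hx hi
      obtain ⟨⟨⟨a, b⟩, c⟩, d⟩ := hr' x hx
      exact DifferentiableAt.comp x (b (by rwa [d])) c.differentiableAt
  have h5 : DifferentiableAt ℂ (u ∘ G) (F w) := hdo.differentiableAt (ball_mem_nhds _ hr)
  refine (h5.comp w h2.differentiableAt).congr_of_eventuallyEq ?_
  filter_upwards [hGl] with x hx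
  simp [hx]

end PlaneAnalysis

/-- Closed subsets of `K` have compact, hence closed, images in the Hausdorff space `B`, and these
images are the preimages under `g`. -/
theorem IsCompact.continuousOn_leftInverse {A B : Type*} [TopologicalSpace A] [TopologicalSpace B]
    [T2Space B] {K : Set A} (hK : IsCompact K) {f : A → B} (hf : ContinuousOn f K) {g : B → A}
    (hg : Set.LeftInvOn g f K) : ContinuousOn g (f '' K) := by
  rw [continuousOn_iff_isClosed]
  intro t ht
  refine ⟨f '' (K ∩ t), ((hK.inter_right ht).image_of_continuousOn
    (hf.mono Set.inter_subset_left)).isClosed, ?_⟩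
  ext y
  constructor
  · rintro ⟨hy, x, hx, rfl⟩
    rw [Set.mem_preimage, hg hx] at hy
    exact ⟨⟨x, ⟨hx, hy⟩, rfl⟩, ⟨x, hx, rfl⟩⟩
  · rintro ⟨⟨x, ⟨hx, hxt⟩, rfl⟩, h⟩
    exact ⟨by rwa [Set.mem_preimage, hg hx], h⟩

/-! ### The Schwarz–Christoffel integral on the closed unit disc -/

namespace SchwarzChristoffel

open Complex Set Filter Metric

noncomputable section

/-- The primitive cube root of unity `exp (2πi/3)`. -/
def omega : ℂ := ⟨-1 / 2, √3 / 2⟩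

@[simp] theorem omega_re : omega.re = -1 / 2 := rfl
@[simp] theorem omega_im : omega.im = √3 / 2 := rfl

theorem sqrt_three_mul_self : √3 * √3 = 3 := Real.mul_self_sqrt (by norm_num)

theorem sqrt_three_pos : 0 < √3 := by positivity

theorem omega_sq : omega ^ 2 = -1 - omega := by
  have := sqrt_three_mul_self
  apply Complex.ext <;> simp [sq] <;> linarith

theorem omega_cube : omega ^ 3 = 1 := by
  linear_combination (omega - 1) * omega_sq

theorem omega_ne_zero : omega ≠ 0 := fun h => by simpa [h] using omega_cube

theorem norm_omega : ‖omega‖ = 1 := by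
  have h : ‖omega‖ ^ 3 = 1 := by rw [← norm_pow, omega_cube, norm_one]
  exact (pow_eq_one_iff_of_nonneg (norm_nonneg _) (by norm_num)).1 h

theorem omega_eq_exp : omega = exp ((2 * Real.pi / 3 : ℝ) * I) := by
  have h1 : (2 * Real.pi / 3 : ℝ) = Real.pi - Real.pi / 3 := by ring
  apply Complex.ext
  · rw [exp_ofReal_mul_I_re, h1, Real.cos_pi_sub, Real.cos_pi_div_three]; norm_num
  · rw [exp_ofReal_mul_I_im, h1, Real.sin_pi_sub, Real.sin_pi_div_three]; rfl

/-- The integrand `(1 - u³) ^ (-2/3)` of the Schwarz–Christoffel formula. -/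
def density (u : ℂ) : ℂ := (1 - u ^ 3) ^ ((-2 / 3 : ℝ) : ℂ)

/-- Keeps `1 - u³` in the closed right half-plane, so that on the closed disc the principal branch
in `density` is singular only at the cube roots of unity. -/
theorem re_one_sub_cube_nonneg {u : ℂ} (hu : ‖u‖ ≤ 1) : 0 ≤ (1 - u ^ 3).re := by
  have h1 : ‖u ^ 3‖ ≤ 1 := by rw [norm_pow]; exact pow_le_one₀ (norm_nonneg _) hu
  have := (re_le_norm (u ^ 3)).trans h1
  simp only [sub_re, one_re]; linarith

theorem re_one_sub_cube_pos {u : ℂ} (hu : ‖u‖ ≤ 1) (h : u ^ 3 ≠ 1) : 0 < (1 - u ^ 3).re := by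
  have h1 : ‖u ^ 3‖ ≤ 1 := by rw [norm_pow]; exact pow_le_one₀ (norm_nonneg _) hu
  refine lt_of_le_of_ne (re_one_sub_cube_nonneg hu) fun h0 => h ?_
  have h2 : (u ^ 3).re = 1 := by simp only [sub_re, one_re] at h0; linarith
  have h3 := Complex.sq_norm_sub_sq_re (u ^ 3)
  have h4 : (u ^ 3).im = 0 := by
    rw [h2] at h3
    nlinarith [norm_nonneg (u ^ 3), sq_nonneg (u ^ 3).im]
  exact Complex.ext h2 h4

theorem cube_ne_one_of_norm_lt {u : ℂ} (hu : ‖u‖ < 1) : u ^ 3 ≠ 1 := fun h => by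
  have : ‖u‖ ^ 3 = 1 := by rw [← norm_pow, h, norm_one]
  have h2 := (pow_eq_one_iff_of_nonneg (norm_nonneg u) (by norm_num)).1 this
  linarith

/-- An argument below `π/2` in absolute value is multiplied by `-2/3` and stays below `π/2`.
Positivity of the real part of the derivative is what later gives injectivity. -/
theorem re_cpow_pos {x : ℂ} (hx : 0 < x.re) : 0 < (x ^ ((-2 / 3 : ℝ) : ℂ)).re := by
  rw [cpow_ofReal_re]
  have h0 : x ≠ 0 := fun h => by simp [h] at hx
  have h1 := abs_lt.1 (abs_arg_lt_pi_div_two_iff.2 (Or.inl hx))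
  refine mul_pos (Real.rpow_pos_of_pos (norm_pos_iff.2 h0) _) (Real.cos_pos_of_mem_Ioo ⟨?_, ?_⟩)
  · linarith [Real.pi_pos]
  · linarith [Real.pi_pos]

theorem density_re_pos {u : ℂ} (hu : ‖u‖ < 1) : 0 < (density u).re :=
  re_cpow_pos (re_one_sub_cube_pos hu.le (cube_ne_one_of_norm_lt hu))

theorem density_ne_zero {u : ℂ} (hu : ‖u‖ < 1) : density u ≠ 0 := fun h => by
  have := density_re_pos hu
  simp [h] at this

theorem differentiableAt_density {u : ℂ} (h : 1 - u ^ 3 ∈ slitPlane) :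
    DifferentiableAt ℂ density u := by
  unfold density
  exact DifferentiableAt.cpow (by fun_prop) (by fun_prop) h

theorem one_sub_cube_mem_slitPlane {u : ℂ} (hu : ‖u‖ ≤ 1) (h : u ^ 3 ≠ 1) :
    1 - u ^ 3 ∈ slitPlane := Or.inl (re_one_sub_cube_pos hu h)

theorem measurable_density : Measurable density := by
  unfold density
  exact Measurable.pow_const (by fun_prop) _

/-- The primitive of `density` on the closed unit disc vanishing at `0`. -/
def primitive (u : ℂ) : ℂ := u * ∫ s in (0 : ℝ)..1, density (s * u)

/-- A majorant independent of `u` and integrable on `[0, 1]` because `-2/3 > -1`; it controls the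
integral even at the cube roots of unity. -/
theorem norm_density_le {u : ℂ} (hu : ‖u‖ ≤ 1) {s : ℝ} (hs : s ∈ Ico (0 : ℝ) 1) :
    ‖density (s * u)‖ ≤ (1 - s) ^ (-2 / 3 : ℝ) := by
  unfold density
  rw [norm_cpow_real]
  have h1 : 1 - s ≤ ‖1 - ((s : ℂ) * u) ^ 3‖ := by
    have h2 : ‖((s : ℂ) * u) ^ 3‖ ≤ s := by
      rw [norm_pow, norm_mul, norm_real, Real.norm_of_nonneg hs.1]
      have h3 : s * ‖u‖ ≤ s := mul_le_of_le_one_right hs.1 hu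
      calc (s * ‖u‖) ^ 3 ≤ s ^ 3 := pow_le_pow_left₀ (mul_nonneg hs.1 (norm_nonneg _)) h3 3
        _ ≤ s := pow_le_of_le_one hs.1 hs.2.le (by norm_num)
    have := norm_sub_norm_le (1 : ℂ) (((s : ℂ) * u) ^ 3)
    rw [norm_one] at this
    linarith
  exact Real.rpow_le_rpow_of_nonpos (by linarith [hs.2]) h1 (by norm_num)

/-- Dominated convergence. Only the null set `s = 1` is discarded; for `s < 1` the point `s * u`
lies in the open disc, where `density` is continuous. -/
theorem continuousOn_primitive : ContinuousOn primitive (closedBall 0 1) := by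
  refine continuousOn_id.mul fun u hu => ?_
  refine intervalIntegral.continuousWithinAt_of_dominated_interval
    (bound := fun s => (1 - s) ^ (-2 / 3 : ℝ)) ?_ ?_ ?_ ?_
  · refine Eventually.of_forall fun u => ?_
    exact (measurable_density.comp (by fun_prop)).aestronglyMeasurable
  · filter_upwards [self_mem_nhdsWithin] with v hv
    have : ∀ᵐ s : ℝ, s ≠ 1 := by simp [MeasureTheory.ae_iff]
    filter_upwards [this] with s hs hs'
    rw [uIoc_of_le zero_le_one] at hs'
    exact norm_density_le (by simpa using hv) ⟨hs'.1.le, lt_of_le_of_ne hs'.2 hs⟩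
  · have := (intervalIntegral.intervalIntegrable_rpow' (a := 0) (b := 1)
      (r := (-2 / 3 : ℝ)) (by norm_num)).comp_sub_left 1
    simpa using this.symm
  · have : ∀ᵐ s : ℝ, s ≠ 1 := by simp [MeasureTheory.ae_iff]
    filter_upwards [this] with s hs hs'
    rw [uIoc_of_le zero_le_one] at hs'
    have hlt : ‖(s : ℂ) * u‖ < 1 := by
      rw [norm_mul, norm_real, Real.norm_of_nonneg hs'.1.le]
      have h1 : ‖u‖ ≤ 1 := by simpa using hu
      have h2 : s < 1 := lt_of_le_of_ne hs'.2 hs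
      nlinarith [norm_nonneg u, hs'.1]
    have h1 := (differentiableAt_density (one_sub_cube_mem_slitPlane hlt.le
      (cube_ne_one_of_norm_lt hlt))).continuousAt
    have h2 : ContinuousAt (fun v : ℂ => density (s * v)) u :=
      ContinuousAt.comp (f := fun v : ℂ => (s : ℂ) * v) h1 (by fun_prop)
    exact h2.continuousWithinAt

/-- On the open disc `density` has a holomorphic primitive vanishing at `0`; the fundamental theorem
along the radius identifies it with the radial integral. -/
theorem hasDerivAt_primitive {u : ℂ} (hu : ‖u‖ < 1) : HasDerivAt primitive (density u) u := by
  have hd : DifferentiableOn ℂ density (ball 0 1) := fun v hv => by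
    have hv' : ‖v‖ < 1 := by simpa using hv
    exact (differentiableAt_density (one_sub_cube_mem_slitPlane hv'.le
      (cube_ne_one_of_norm_lt hv'))).differentiableWithinAt
  obtain ⟨H, hH0, hH⟩ := hd.isExactOn_ball.with_val_at 0 0
  have key : ∀ v ∈ ball (0 : ℂ) 1, primitive v = H v := by
    intro v hv
    have hv' : ‖v‖ < 1 := by simpa using hv
    have hm : ∀ s ∈ uIcc (0 : ℝ) 1, (s : ℂ) * v ∈ ball (0 : ℂ) 1 := by
      intro s hs
      rw [uIcc_of_le zero_le_one] at hs
      rw [mem_ball_zero_iff, norm_mul, norm_real, Real.norm_of_nonneg hs.1]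
      nlinarith [norm_nonneg v, hs.1, hs.2]
    have h1 : ∀ s ∈ uIcc (0 : ℝ) 1,
        HasDerivAt (fun s : ℝ => H (s * v)) (v * density (s * v)) s := by
      intro s hs
      have h2 : HasDerivAt (fun s : ℝ => (s : ℂ) * v) v s := by
        simpa using (hasDerivAt_id s).ofReal_comp.mul_const v
      have h3 := HasDerivAt.comp_of_eq (h₂ := H) (h := fun s : ℂ => s * v) (x := (s : ℂ))
        (h₂' := density (s * v)) (h' := v) (hH _ (hm s hs)) (by simpa using (hasDerivAt_id (s : ℂ)).mul_const v) rfl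
      rw [mul_comm]
      exact h3.comp_ofReal
    have h4 := intervalIntegral.integral_eq_sub_of_hasDerivAt h1 (by
      refine ContinuousOn.intervalIntegrable ?_
      refine continuousOn_const.mul ?_
      exact hd.continuousOn.comp (by fun_prop) hm)
    rw [intervalIntegral.integral_const_mul] at h4
    unfold primitive
    simpa [hH0] using h4
  have hu' : u ∈ ball (0 : ℂ) 1 := by simpa using hu
  refine (hH u hu').congr_of_eventuallyEq ?_
  filter_upwards [isOpen_ball.mem_nhds hu'] using key

/-- Near a boundary point other than a cube root of unity `density` is holomorphic on a full disc
and has a primitive `H` there. The difference with `primitive` is constant on the convex overlap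
with the open unit disc, and by continuity also up to the circle. -/
theorem hasDerivWithinAt_primitive {u : ℂ} (hu : ‖u‖ ≤ 1) (hu1 : u ^ 3 ≠ 1) :
    HasDerivWithinAt primitive (density u) (closedBall 0 1) u := by
  have ho : IsOpen {v : ℂ | 1 - v ^ 3 ∈ slitPlane} := isOpen_slitPlane.preimage (by fun_prop)
  obtain ⟨r, hr, hr'⟩ := Metric.isOpen_iff.1 ho u (one_sub_cube_mem_slitPlane hu hu1)
  obtain ⟨H, hH⟩ := DifferentiableOn.isExactOn_ball (f := density) (c := u) (r := r)
    fun v hv => (differentiableAt_density (hr' hv)).differentiableWithinAt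
  have huc : u ∈ closure (ball (0 : ℂ) 1) := by
    rw [closure_ball _ one_ne_zero]; simpa using hu
  obtain ⟨v, hv, hv1⟩ := mem_closure_iff.1 huc _ isOpen_ball (mem_ball_self hr)
  have hopen : IsOpen (ball u r ∩ ball (0 : ℂ) 1) := isOpen_ball.inter isOpen_ball
  have hd : ∀ x ∈ ball u r ∩ ball (0 : ℂ) 1, HasDerivAt (fun x => primitive x - H x) 0 x := by
    intro x hx
    have := (hasDerivAt_primitive (by simpa using hx.2)).sub (hH x hx.1)
    rwa [sub_self] at this
  have hc : ∀ x ∈ ball u r ∩ ball (0 : ℂ) 1, primitive x = H x + (primitive v - H v) := by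
    intro x hx
    have := ((convex_ball u r).inter (convex_ball 0 1)).is_const_of_fderivWithin_eq_zero (𝕜 := ℂ)
      (f := fun x => primitive x - H x)
      (fun x hx => (hd x hx).differentiableAt.differentiableWithinAt)
      (fun x hx => by
        rw [fderivWithin_of_isOpen hopen hx]
        ext; simp [(hd x hx).deriv]) hx ⟨hv, hv1⟩
    linear_combination this
  have hc' : EqOn primitive (fun x => H x + (primitive v - H v)) (ball u r ∩ closedBall 0 1) := by
    refine EqOn.of_subset_closure (s := ball u r ∩ ball 0 1) hc
      (continuousOn_primitive.mono inter_subset_right) ?_ ?_ ?_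
    · exact ContinuousOn.add (fun x hx => (hH x hx.1).continuousAt.continuousWithinAt)
        continuousOn_const
    · exact inter_subset_inter_right _ ball_subset_closedBall
    · rw [← closure_ball (0 : ℂ) one_ne_zero]
      exact isOpen_ball.inter_closure
  have h1 : HasDerivWithinAt (fun x => H x + (primitive v - H v)) (density u) (closedBall 0 1) u :=
    ((hH u (mem_ball_self hr)).add_const _).hasDerivWithinAt
  refine h1.congr_of_eventuallyEq ?_ (hc' ⟨mem_ball_self hr, by simpa using hu⟩)
  filter_upwards [inter_mem_nhdsWithin _ (ball_mem_nhds u hr)] with x hx using hc' ⟨hx.2, hx.1⟩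

/-- The Noshiro–Warschawski argument. The open segment from `a` to `b` lies in the open disc by
strict convexity, and along it the real part of `primitive * conj (b - a)` has derivative `re
density * |b - a|²`, which is positive. -/
theorem primitive_sub_re_pos {a b : ℂ} (ha : ‖a‖ ≤ 1) (hb : ‖b‖ ≤ 1) (hab : a ≠ b) :
    0 < ((primitive b - primitive a) * (starRingEnd ℂ) (b - a)).re := by
  have hmem : ∀ t ∈ Icc (0 : ℝ) 1, a + t * (b - a) ∈ closedBall (0 : ℂ) 1 := by
    intro t ht
    have := (convex_closedBall (0 : ℂ) 1).add_smul_sub_mem (x := a) (y := b) (by simpa using ha)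
      (by simpa using hb) ht
    simpa using this
  have hmem' : ∀ t ∈ Ioo (0 : ℝ) 1, ‖a + t * (b - a)‖ < 1 := by
    intro t ht
    have := (strictConvex_closedBall ℝ (0 : ℂ) 1).add_smul_sub_mem (x := a) (y := b)
      (by simpa using ha) (by simpa using hb) hab ht.1 ht.2
    rw [interior_closedBall _ one_ne_zero] at this
    simpa using this
  let φ : ℝ → ℝ := fun t => (primitive (a + t * (b - a)) * (starRingEnd ℂ) (b - a)).re
  have hmono : StrictMonoOn φ (Icc 0 1) := by
    refine strictMonoOn_of_deriv_pos (convex_Icc 0 1) ?_ ?_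
    · refine Complex.continuous_re.comp_continuousOn ?_
      refine ContinuousOn.mul ?_ continuousOn_const
      exact continuousOn_primitive.comp (by fun_prop) hmem
    · intro t ht
      rw [interior_Icc] at ht
      have h0 := hmem' t ht
      have h1 : HasDerivAt (fun t : ℂ => a + t * (b - a)) (b - a) (t : ℂ) := by
        simpa using ((hasDerivAt_id (t : ℂ)).mul_const (b - a)).const_add a
      have h2 := ((hasDerivAt_primitive h0).comp (t : ℂ) h1).mul_const ((starRingEnd ℂ) (b - a))
      have h3 := h2.real_of_complex
      rw [show deriv φ t = _ from h3.deriv, mul_assoc, mul_conj, re_mul_ofReal]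
      refine mul_pos (density_re_pos h0) ?_
      exact normSq_pos.2 (sub_ne_zero.2 hab.symm)
  have := hmono (left_mem_Icc.2 zero_le_one) (right_mem_Icc.2 zero_le_one) one_pos
  simp only [φ] at this
  simp only [sub_mul, sub_re]
  simpa using this

theorem primitive_zero : primitive 0 = 0 := by simp [primitive]

theorem primitive_omega_mul (u : ℂ) : primitive (omega * u) = omega * primitive u := by
  unfold primitive
  have : ∀ s : ℝ, density (s * (omega * u)) = density (s * u) := by
    intro s
    unfold density
    congr 2
    linear_combination (s * u) ^ 3 * omega_cube
  simp only [this]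
  ring

theorem primitive_conj {u : ℂ} (hu : ‖u‖ ≤ 1) :
    primitive ((starRingEnd ℂ) u) = (starRingEnd ℂ) (primitive u) := by
  unfold primitive
  rw [map_mul]
  congr 1
  rw [intervalIntegral.integral_of_le zero_le_one, intervalIntegral.integral_of_le zero_le_one,
    ← integral_conj]
  refine MeasureTheory.setIntegral_congr_fun measurableSet_Ioc fun s hs => ?_
  have h1 : ‖(s : ℂ) * u‖ ≤ 1 := by
    rw [norm_mul, norm_real, Real.norm_of_nonneg hs.1.le]
    nlinarith [norm_nonneg u, hs.1, hs.2]
  have h2 : (1 - ((s : ℂ) * u) ^ 3).arg ≠ Real.pi := by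
    have := abs_arg_le_pi_div_two_iff.2 (re_one_sub_cube_nonneg h1)
    have := (abs_le.1 this).2
    intro h
    linarith [Real.pi_pos]
  unfold density
  rw [show (1 - ((s : ℂ) * (starRingEnd ℂ) u) ^ 3) = (starRingEnd ℂ) (1 - ((s : ℂ) * u) ^ 3) by simp]
  rw [conj_cpow _ _ h2, conj_ofReal]

theorem primitive_one_im : (primitive 1).im = 0 := by
  have := primitive_conj (u := 1) (by simp)
  rw [map_one] at this
  exact conj_eq_iff_im.1 this.symm

theorem primitive_one_re_pos : 0 < (primitive 1).re := by
  simpa [primitive_zero] using primitive_sub_re_pos (a := 0) (b := 1) (by simp) (by simp) (by simp)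

theorem primitive_one_eq : primitive 1 = ((primitive 1).re : ℂ) :=
  Complex.ext rfl (by simp [primitive_one_im])

end

end SchwarzChristoffel

/-! ### The disc map: symmetries and boundary values -/

namespace SchwarzChristoffel

open Complex Set Filter Metric

noncomputable section

/-- The barycentric coordinates with respect to the triangle with vertices `1`, `ω`, `ω²`. -/
def tau : Fin 3 → ℂ → ℝ :=
  ![fun y => (1 + 2 * y.re) / 3, fun y => (1 - y.re + √3 * y.im) / 3,
    fun y => (1 - y.re - √3 * y.im) / 3]

theorem tau_zero (y : ℂ) : tau 0 y = (1 + 2 * y.re) / 3 := rfl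
theorem tau_one (y : ℂ) : tau 1 y = (1 - y.re + √3 * y.im) / 3 := rfl
theorem tau_two (y : ℂ) : tau 2 y = (1 - y.re - √3 * y.im) / 3 := rfl

theorem tau_omega_mul (j : Fin 3) (y : ℂ) : tau (j + 1) (omega * y) = tau j y := by
  have := sqrt_three_mul_self
  fin_cases j <;> simp [tau] <;> first
    | linear_combination y.re / 2 * this
    | linear_combination -y.re / 2 * this
    | nlinarith

theorem continuous_tau (j : Fin 3) : Continuous (tau j) := by
  fin_cases j <;> simp only [tau] <;> simp <;> fun_prop

theorem tau_add_smul (j : Fin 3) (y : ℂ) (s : ℝ) :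
    tau j (y + s * omega ^ (j : ℕ)) = tau j y + 2 * s / 3 := by
  have := sqrt_three_mul_self
  fin_cases j <;> simp [tau, omega_sq] <;> first
    | linear_combination s / 6 * this
    | nlinarith

theorem tau_combo (j : Fin 3) (x y : ℂ) {a b : ℝ} (h : a + b = 1) :
    tau j (a * x + b * y) = a * tau j x + b * tau j y := by
  obtain rfl : a = 1 - b := by linarith
  fin_cases j <;> simp [tau] <;> ring

/-- The equilateral triangle with vertices `1`, `ω`, `ω²`. -/
def unitTriangle : Set ℂ := {y | ∀ j, 0 ≤ tau j y}

/-- The interior of the equilateral triangle with vertices `1`, `ω`, `ω²`. -/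
def openUnitTriangle : Set ℂ := {y | ∀ j, 0 < tau j y}

theorem isOpen_openUnitTriangle : IsOpen openUnitTriangle := by
  simp only [openUnitTriangle, ofPred_forall]
  exact isOpen_iInter_of_finite fun j => isOpen_lt continuous_const (continuous_tau j)

theorem convex_openUnitTriangle : Convex ℝ openUnitTriangle := by
  intro x hx y hy a b ha hb hab j
  rw [real_smul, real_smul, tau_combo j x y hab]
  have h1 := hx j
  have h2 := hy j
  rcases ha.eq_or_lt with rfl | ha
  · have : b = 1 := by linarith
    simpa [this] using h2
  · positivity

theorem omega_mul_mem_unitTriangle {y : ℂ} (hy : y ∈ unitTriangle) : omega * y ∈ unitTriangle := by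
  intro j
  have := tau_omega_mul (j - 1) y
  rw [sub_add_cancel] at this
  rw [this]; exact hy _

/-- A nonnegative real function with an affine restriction of nonzero slope to some line through an
interior point is positive there. -/
theorem pos_of_eventually_nonneg {l : ℂ → ℝ} {y d : ℂ} {k : ℝ} (hk : 0 < k)
    (hl : ∀ s : ℝ, l (y - s * d) = l y - k * s) (h : ∀ᶠ y' in 𝓝 y, 0 ≤ l y') : 0 < l y := by
  have hc : Tendsto (fun s : ℝ => y - s * d) (𝓝[>] 0) (𝓝 y) := by
    have : ContinuousAt (fun s : ℝ => y - s * d) 0 := by fun_prop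
    simpa using (this.tendsto.mono_left nhdsWithin_le_nhds)
  obtain ⟨s, hs, hs0⟩ := ((hc.eventually h).and self_mem_nhdsWithin).exists
  rw [hl] at hs
  have : 0 < k * s := mul_pos hk hs0
  linarith

/-- At a point of an open set inside the triangle a small move in the direction `-omega ^ j` lowers
the `j`-th coordinate, which must remain nonnegative. -/
theorem interior_unitTriangle_subset {U : Set ℂ} (hU : IsOpen U) (h : U ⊆ unitTriangle) :
    U ⊆ openUnitTriangle := by
  intro y hy j
  refine pos_of_eventually_nonneg (d := omega ^ (j : ℕ)) (k := 2 / 3) (by norm_num) ?_ ?_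
  · intro s
    have := tau_add_smul j y (-s)
    push_cast at this
    rw [sub_eq_add_neg, ← neg_mul, this]
    ring
  · filter_upwards [hU.mem_nhds hy] with y' hy' using h hy' j

/-- The conformal map from the unit disc to the triangle with vertices `1`, `ω`, `ω²`. -/
def discMap (u : ℂ) : ℂ := primitive u / (primitive 1).re

theorem primitive_one_re_ne : ((primitive 1).re : ℂ) ≠ 0 :=
  ofReal_ne_zero.2 primitive_one_re_pos.ne'

theorem discMap_zero : discMap 0 = 0 := by simp [discMap, primitive_zero]

theorem discMap_one : discMap 1 = 1 := by
  rw [discMap, ← primitive_one_eq, div_self]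
  rw [primitive_one_eq]; exact primitive_one_re_ne

theorem discMap_omega_mul (u : ℂ) : discMap (omega * u) = omega * discMap u := by
  rw [discMap, discMap, primitive_omega_mul, mul_div_assoc]

theorem discMap_omega : discMap omega = omega := by
  simpa [discMap_one] using discMap_omega_mul 1

theorem discMap_conj {u : ℂ} (hu : ‖u‖ ≤ 1) :
    discMap ((starRingEnd ℂ) u) = (starRingEnd ℂ) (discMap u) := by
  rw [discMap, discMap, primitive_conj hu, map_div₀, conj_ofReal]

theorem continuousOn_discMap : ContinuousOn discMap (closedBall 0 1) :=
  continuousOn_primitive.div_const _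

theorem hasDerivAt_discMap {u : ℂ} (hu : ‖u‖ < 1) :
    HasDerivAt discMap (density u / (primitive 1).re) u :=
  (hasDerivAt_primitive hu).div_const _

theorem discMap_sub_re_pos {a b : ℂ} (ha : ‖a‖ ≤ 1) (hb : ‖b‖ ≤ 1) (hab : a ≠ b) :
    0 < ((discMap b - discMap a) * (starRingEnd ℂ) (b - a)).re := by
  rw [discMap, discMap, ← sub_div, div_mul_eq_mul_div, div_ofReal_re]
  exact div_pos (primitive_sub_re_pos ha hb hab) primitive_one_re_pos

theorem injOn_discMap : InjOn discMap (closedBall 0 1) := by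
  intro a ha b hb hab
  by_contra h
  have := discMap_sub_re_pos (by simpa using ha) (by simpa using hb) h
  simp [hab] at this

/-- The case `a = conj u`, `b = u` of `discMap_sub_re_pos`: both differences are then purely
imaginary. -/
theorem im_discMap_mul_im_pos {u : ℂ} (hu : ‖u‖ ≤ 1) (h : u.im ≠ 0) :
    0 < (discMap u).im * u.im := by
  have h1 : (starRingEnd ℂ) u ≠ u := fun h' => h (conj_eq_iff_im.1 h')
  have := discMap_sub_re_pos (a := (starRingEnd ℂ) u) (by simpa using hu) hu h1
  rw [discMap_conj hu] at this
  simp at this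
  linarith

theorem im_discMap_eq_zero {u : ℂ} (hu : ‖u‖ ≤ 1) (h : u.im = 0) : (discMap u).im = 0 := by
  have := discMap_conj hu
  rw [conj_eq_iff_im.2 h] at this
  exact conj_eq_iff_im.1 this.symm

theorem im_discMap_nonneg_iff {u : ℂ} (hu : ‖u‖ ≤ 1) : 0 ≤ (discMap u).im ↔ 0 ≤ u.im := by
  by_cases h : u.im = 0
  · simp [h, im_discMap_eq_zero hu h]
  · have := im_discMap_mul_im_pos hu h
    constructor <;> intro h2 <;> nlinarith

theorem tau_one_sub_tau_two (y : ℂ) : tau 1 y - tau 2 y = 2 / √3 * y.im := by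
  have h := sqrt_three_mul_self
  have h1 := sqrt_three_pos
  rw [tau_one, tau_two]
  field_simp
  linear_combination 2 * y.im * h

theorem tau_one_le_tau_two {y : ℂ} : tau 2 y ≤ tau 1 y ↔ 0 ≤ y.im := by
  rw [← sub_nonneg, tau_one_sub_tau_two]
  exact mul_nonneg_iff_of_pos_left (by positivity)

/-- The disc map preserves the three symmetry axes and their sides. -/
theorem tau_discMap_le_iff {u : ℂ} (hu : ‖u‖ ≤ 1) (a b : Fin 3) :
    tau a (discMap u) ≤ tau b (discMap u) ↔ tau a u ≤ tau b u := by
  -- Coordinates `1` and `2` are compared by the sign of the imaginary part; rotation by `omega`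
  -- reduces the other pairs to this one.
  have h12 : ∀ u : ℂ, ‖u‖ ≤ 1 → (tau 2 (discMap u) ≤ tau 1 (discMap u) ↔ tau 2 u ≤ tau 1 u) := by
    intro u hu
    rw [tau_one_le_tau_two, tau_one_le_tau_two, im_discMap_nonneg_iff hu]
  have h21 : ∀ u : ℂ, ‖u‖ ≤ 1 → (tau 1 (discMap u) ≤ tau 2 (discMap u) ↔ tau 1 u ≤ tau 2 u) := by
    intro u hu
    have := h12 ((starRingEnd ℂ) u) (by simpa using hu)
    rw [discMap_conj hu] at this
    simpa [tau, sub_eq_add_neg] using this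
  have rot : ∀ a b : Fin 3, (∀ u : ℂ, ‖u‖ ≤ 1 → (tau (a + 1) (discMap u) ≤ tau (b + 1) (discMap u) ↔
      tau (a + 1) u ≤ tau (b + 1) u)) → ∀ u : ℂ, ‖u‖ ≤ 1 → (tau a (discMap u) ≤ tau b (discMap u) ↔
      tau a u ≤ tau b u) := by
    intro a b h u hu
    have := h (omega * u) (by simpa [norm_omega] using hu)
    rwa [discMap_omega_mul, tau_omega_mul, tau_omega_mul, tau_omega_mul, tau_omega_mul] at this
  have h01 := rot 0 1 h21
  have h10 := rot 1 0 h12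
  have h20 := rot 2 0 h01
  have h02 := rot 0 2 h10
  fin_cases a <;> fin_cases b
  · simp
  · exact h01 u hu
  · exact h02 u hu
  · exact h10 u hu
  · simp
  · exact h21 u hu
  · exact h20 u hu
  · exact h12 u hu
  · simp

/-- Since `1 - exp (3iθ) = 2 sin (3θ/2) exp (i(3θ/2 - π/2))`, the argument of `density` on this arc
is `π/3 - θ`. The factor `exp (iθ)` of the velocity cancels `-θ`, so the image curve has the
constant direction `I * exp (iπ/3)`, which is that of `omega - 1`. -/
theorem density_exp {θ : ℝ} (h0 : 0 < θ) (h1 : θ < 2 * Real.pi / 3) :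
    ∃ k : ℝ, 0 < k ∧ I * exp (θ * I) * density (exp (θ * I)) = k * (omega - 1) := by
  set r : ℝ := 2 * Real.sin (3 * θ / 2) with hr
  have hrpos : 0 < r := mul_pos two_pos (Real.sin_pos_of_pos_of_lt_pi (by linarith) (by linarith))
  have hx : 1 - exp (θ * I) ^ 3 = exp (Real.log r + (3 * θ / 2 - Real.pi / 2 : ℝ) * I) := by
    rw [exp_add, ← ofReal_exp, Real.exp_log hrpos, hr]
    push_cast
    rw [Complex.sin, ← exp_nat_mul]
    have e1 : exp (-(3 * θ / 2) * I) * exp (3 * θ / 2 * I) = 1 := by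
      rw [← exp_add]; simp
    have e2 : exp ((3 : ℕ) * (θ * I)) = exp (3 * θ / 2 * I) * exp (3 * θ / 2 * I) := by
      rw [← exp_add]; congr 1; push_cast; ring
    have e3 : exp ((3 * θ / 2 - Real.pi / 2) * I) = exp (3 * θ / 2 * I) * (-I) := by
      rw [sub_mul, Complex.exp_sub, Complex.exp_pi_div_two_mul_I, div_I]; ring
    rw [e2, e3]
    linear_combination (-1 : ℂ) * e1 + (exp (-(3 * θ / 2) * I) * exp (3 * θ / 2 * I) -
      exp (3 * θ / 2 * I) * exp (3 * θ / 2 * I)) * I_sq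
  have hlog : log (1 - exp (θ * I) ^ 3) = Real.log r + (3 * θ / 2 - Real.pi / 2 : ℝ) * I := by
    rw [hx, log_exp]
    · simp; linarith [Real.pi_pos]
    · simp; linarith [Real.pi_pos]
  have hne : 1 - exp (θ * I) ^ 3 ≠ 0 := by rw [hx]; exact exp_ne_zero _
  refine ⟨Real.exp (-2 / 3 * Real.log r) / √3, by positivity, ?_⟩
  have hom : omega - 1 = √3 * (I * exp ((Real.pi / 3 : ℝ) * I)) := by
    have := sqrt_three_mul_self
    apply Complex.ext
    · simp [exp_ofReal_mul_I_im, -ofReal_div]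
      linarith
    · simp [exp_ofReal_mul_I_re, -ofReal_div]
      linarith
  rw [density, cpow_def_of_ne_zero hne, hlog, hom]
  push_cast
  have h3 : (√3 : ℂ) ≠ 0 := ofReal_ne_zero.2 sqrt_three_pos.ne'
  have h4 : exp (θ * I) * exp ((Real.log r + (3 * θ / 2 - Real.pi / 2) * I) * (-2 / 3)) =
      exp (-2 / 3 * Real.log r) * exp (Real.pi / 3 * I) := by
    rw [← exp_add, ← exp_add]
    congr 1
    ring
  field_simp at h4 ⊢
  linear_combination h4

theorem exp_mem_closedBall (θ : ℝ) : exp (θ * I) ∈ closedBall (0 : ℂ) 1 := by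
  simp [norm_exp_ofReal_mul_I]

theorem exp_cube_ne_one {θ : ℝ} (h0 : 0 < θ) (h1 : θ < 2 * Real.pi / 3) : exp (θ * I) ^ 3 ≠ 1 := by
  intro h
  rw [← exp_nat_mul, exp_eq_one_iff] at h
  obtain ⟨n, hn⟩ := h
  have h2 := congrArg Complex.im hn
  simp at h2
  have h3 : 3 * θ = n * (2 * Real.pi) := h2
  have h4 : (0 : ℝ) < n := by
    by_contra hc
    nlinarith [Real.pi_pos]
  have h5 : (n : ℝ) < 1 := by
    by_contra hc
    nlinarith [Real.pi_pos]
  have h6 : 0 < n := by exact_mod_cast h4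
  have h7 : n < 1 := by exact_mod_cast h5
  omega

/-- The disc map sends the arc from `1` to `ω` to the segment from `1` to `ω`. -/
theorem discMap_exp {θ : ℝ} (hθ : θ ∈ Icc 0 (2 * Real.pi / 3)) :
    ∃ m ∈ Icc (0 : ℝ) 1, discMap (exp (θ * I)) = 1 + m * (omega - 1) := by
  have hπ : 0 ≤ 2 * Real.pi / 3 := by positivity
  have hd : ∀ t ∈ Ioo 0 (2 * Real.pi / 3), ∃ k : ℝ, 0 < k ∧
      HasDerivAt (fun t : ℝ => discMap (exp (t * I))) (k * (omega - 1)) t := by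
    intro t ht
    obtain ⟨k, hk, hk'⟩ := density_exp ht.1 ht.2
    refine ⟨k / (primitive 1).re, div_pos hk primitive_one_re_pos, ?_⟩
    have h1 := (hasDerivWithinAt_primitive (norm_exp_ofReal_mul_I t).le
      (exp_cube_ne_one ht.1 ht.2)).div_const ((primitive 1).re : ℂ)
    have h2 : HasDerivAt (fun t : ℝ => exp (t * I)) (I * exp (t * I)) t := by
      have := ((hasDerivAt_id t).ofReal_comp.mul_const I).cexp
      simpa [mul_comm] using this
    -- At boundary points the derivative exists only relative to the closed disc; this is enough
    -- since the whole curve stays in it.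
    have h3 := (h1.hasFDerivWithinAt.restrictScalars ℝ).comp_hasDerivAt t h2
      (Eventually.of_forall exp_mem_closedBall)
    refine h3.congr_deriv ?_
    simp only [ContinuousLinearMap.coe_restrictScalars', ContinuousLinearMap.toSpanSingleton_apply,
      smul_eq_mul]
    push_cast
    linear_combination ((primitive 1).re : ℂ)⁻¹ * hk'
  have hcont : ContinuousOn (fun t : ℝ => discMap (exp (t * I))) (Icc 0 (2 * Real.pi / 3)) :=
    continuousOn_discMap.comp (by fun_prop) fun t _ => exp_mem_closedBall t
  set q : ℂ := (starRingEnd ℂ) (omega - 1) with hq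
  have hqq : (omega - 1) * q = 3 := by
    have := sqrt_three_mul_self
    apply Complex.ext <;> simp [hq] <;> nlinarith
  -- As `(omega - 1) * q = 3`, this is `(discMap (exp (t * I)) - 1) / (omega - 1)`. Its derivative
  -- is real and positive on the open interval, so it increases along the real line from `0` to `1`.
  let w : ℝ → ℂ := fun t => (discMap (exp (t * I)) - 1) * q / 3
  have hw : ∀ t ∈ Ioo 0 (2 * Real.pi / 3), ∃ k : ℝ, 0 < k ∧ HasDerivAt w k t := by
    intro t ht
    obtain ⟨k, hk, hk'⟩ := hd t ht
    refine ⟨k, hk, (((hk'.sub_const 1).mul_const q).div_const 3).congr_deriv ?_⟩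
    linear_combination (k / 3 : ℂ) * hqq
  have hwc : ContinuousOn w (Icc 0 (2 * Real.pi / 3)) :=
    ((hcont.sub continuousOn_const).mul continuousOn_const).div_const 3
  have hw0 : w 0 = 0 := by simp [w, discMap_one]
  have hw1 : w (2 * Real.pi / 3) = 1 := by
    simp only [w]
    rw [← omega_eq_exp, discMap_omega, hqq]; norm_num
  have him : ∀ t ∈ Icc 0 (2 * Real.pi / 3), (w t).im = 0 := by
    intro t ht
    by_contra hne
    have ht0 : 0 < t := lt_of_le_of_ne ht.1 fun h => hne (by rw [← h, hw0]; rfl)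
    obtain ⟨c, hc, hc'⟩ := exists_deriv_eq_slope (fun t => (w t).im) ht0
      ((continuous_im.comp_continuousOn hwc).mono (Icc_subset_Icc_right ht.2)) (by
        intro x hx
        obtain ⟨k, -, hk⟩ := hw x ⟨hx.1, hx.2.trans_le ht.2⟩
        exact (imCLM.hasFDerivAt.comp_hasDerivAt x hk).differentiableAt.differentiableWithinAt)
    obtain ⟨k, -, hk⟩ := hw c ⟨hc.1, hc.2.trans_le ht.2⟩
    have h5 := (imCLM.hasFDerivAt.comp_hasDerivAt c hk).deriv
    have h6 : deriv (fun t => (w t).im) c = 0 := by simpa [Function.comp_def] using h5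
    rw [h6, hw0, zero_im, sub_zero, sub_zero] at hc'
    exact hne ((div_eq_zero_iff.1 hc'.symm).resolve_right ht0.ne')
  have hmono : MonotoneOn (fun t => (w t).re) (Icc 0 (2 * Real.pi / 3)) := by
    refine monotoneOn_of_deriv_nonneg (convex_Icc _ _) (continuous_re.comp_continuousOn hwc) ?_ ?_
    · intro t ht
      rw [interior_Icc] at ht
      obtain ⟨k, -, hk⟩ := hw t ht
      exact (reCLM.hasFDerivAt.comp_hasDerivAt t hk).differentiableAt.differentiableWithinAt
    · intro t ht
      rw [interior_Icc] at ht
      obtain ⟨k, hk0, hk⟩ := hw t ht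
      have h5 := (reCLM.hasFDerivAt.comp_hasDerivAt t hk).deriv
      have h6 : deriv (fun t => (w t).re) t = k := by simpa [Function.comp_def] using h5
      rw [h6]; exact hk0.le
  refine ⟨(w θ).re, ⟨?_, ?_⟩, ?_⟩
  · have := hmono (left_mem_Icc.2 hπ) hθ hθ.1
    simpa [hw0] using this
  · have := hmono hθ (right_mem_Icc.2 hπ) hθ.2
    simpa [hw1] using this
  · have h1 : ((w θ).re : ℂ) = w θ := Complex.ext rfl (by simp [him θ hθ])
    rw [h1]
    simp only [w]
    linear_combination (-(discMap (exp (θ * I)) - 1) / 3) * hqq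

end

end SchwarzChristoffel

/-! ### The disc map is onto the triangle; its inverse -/

namespace SchwarzChristoffel

open Complex Set Filter Metric

noncomputable section

theorem exists_eq_omega_pow_mul_exp {u : ℂ} (hu : ‖u‖ = 1) :
    ∃ k : ℕ, ∃ θ ∈ Icc (0 : ℝ) (2 * Real.pi / 3), u = omega ^ k * exp (θ * I) := by
  have h0 : u = exp (arg u * I) := by
    have := norm_mul_exp_arg_mul_I u
    rw [hu] at this
    simpa using this.symm
  have h1 := neg_pi_lt_arg u
  have h2 := arg_le_pi u
  have hπ := Real.pi_pos
  have hom : omega = exp (2 * Real.pi / 3 * I) := by rw [omega_eq_exp]; push_cast; rfl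
  rcases le_or_gt 0 (arg u) with h3 | h3
  · rcases le_or_gt (arg u) (2 * Real.pi / 3) with h4 | h4
    · exact ⟨0, arg u, ⟨h3, h4⟩, by simpa using h0⟩
    · refine ⟨1, arg u - 2 * Real.pi / 3, ⟨by linarith, by linarith⟩, ?_⟩
      rw [pow_one, hom, ← exp_add]
      nth_rw 1 [h0]
      congr 1; push_cast; ring
  · rcases le_or_gt (-(2 * Real.pi / 3)) (arg u) with h4 | h4
    · refine ⟨2, arg u + 2 * Real.pi / 3, ⟨by linarith, by linarith⟩, ?_⟩
      rw [hom, ← exp_nat_mul, ← exp_add]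
      nth_rw 1 [h0]
      rw [← exp_periodic]
      congr 1; push_cast; ring
    · refine ⟨1, arg u + 4 * Real.pi / 3, ⟨by linarith, by linarith⟩, ?_⟩
      rw [pow_one, hom, ← exp_add]
      nth_rw 1 [h0]
      rw [← exp_periodic]
      congr 1; push_cast; ring

theorem discMap_omega_pow_mul (k : ℕ) (u : ℂ) :
    discMap (omega ^ k * u) = omega ^ k * discMap u := by
  induction k with
  | zero => simp
  | succ k ih => rw [pow_succ', mul_assoc, discMap_omega_mul, ih, mul_assoc]

theorem omega_pow_mul_mem {y : ℂ} (hy : y ∈ unitTriangle) (h0 : ∃ j, tau j y = 0) (k : ℕ) :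
    omega ^ k * y ∈ unitTriangle ∧ ∃ j, tau j (omega ^ k * y) = 0 := by
  induction k with
  | zero => simpa using ⟨hy, h0⟩
  | succ k ih =>
    obtain ⟨h1, j, hj⟩ := ih
    rw [pow_succ', mul_assoc]
    exact ⟨omega_mul_mem_unitTriangle h1, j + 1, by rw [tau_omega_mul, hj]⟩

/-- The unit circle is mapped to the boundary of the triangle. -/
theorem discMap_mem_of_norm_eq_one {u : ℂ} (hu : ‖u‖ = 1) :
    discMap u ∈ unitTriangle ∧ ∃ j, tau j (discMap u) = 0 := by
  obtain ⟨k, θ, hθ, rfl⟩ := exists_eq_omega_pow_mul_exp hu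
  obtain ⟨m, hm, hm'⟩ := discMap_exp hθ
  have h3 := sqrt_three_mul_self
  have h0 : tau 0 (1 + m * (omega - 1)) = 1 - m := by simp [tau_zero]; ring
  have h1 : tau 1 (1 + m * (omega - 1)) = m := by
    simp [tau_one]; linear_combination m / 6 * h3
  have h2 : tau 2 (1 + m * (omega - 1)) = 0 := by
    simp [tau_two]; linear_combination -m / 2 * h3
  rw [discMap_omega_pow_mul, hm']
  refine omega_pow_mul_mem ?_ ⟨2, h2⟩ k
  intro j
  fin_cases j
  · exact h0.symm ▸ sub_nonneg.2 hm.2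
  · exact h1.symm ▸ hm.1
  · exact h2.symm ▸ le_rfl

/-- Maximum principle for `exp (-omega * discMap u)`. The real part of `-omega * y` is `(1 - 3 * tau
2 y) / 2`, so the norm is at most `exp (1/2)` exactly on the half-plane `0 ≤ tau 2`, which contains
the image of the circle. -/
theorem tau_two_discMap_nonneg {u : ℂ} (hu : ‖u‖ ≤ 1) : 0 ≤ tau 2 (discMap u) := by
  have hre : ∀ y, ‖exp (-omega * y)‖ ≤ Real.exp (1 / 2) ↔ 0 ≤ tau 2 y := by
    intro y
    rw [norm_exp, Real.exp_le_exp, tau_two]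
    simp
    constructor <;> intro h <;> linarith
  rw [← hre]
  refine norm_le_of_forall_mem_frontier_norm_le (f := fun u => exp (-omega * discMap u))
    (U := ball 0 1) isBounded_ball ?_ ?_ ?_
  · refine ⟨fun v hv => ?_, ?_⟩
    · have := (hasDerivAt_discMap (u := v) (by simpa using hv)).differentiableAt
      exact ((this.const_mul _).cexp).differentiableWithinAt
    · rw [closure_ball _ one_ne_zero]
      exact (continuousOn_const.mul continuousOn_discMap).cexp
  · intro v hv
    rw [frontier_ball _ one_ne_zero] at hv
    exact (hre _).2 ((discMap_mem_of_norm_eq_one (by simpa using hv)).1 2)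
  · rw [closure_ball _ one_ne_zero]; simpa using hu

theorem discMap_mem_unitTriangle {u : ℂ} (hu : ‖u‖ ≤ 1) : discMap u ∈ unitTriangle := by
  have h2 := tau_two_discMap_nonneg hu
  have h1 := tau_two_discMap_nonneg (u := omega * u) (by simpa [norm_omega] using hu)
  have h0 := tau_two_discMap_nonneg (u := omega * (omega * u)) (by simpa [norm_omega] using hu)
  rw [discMap_omega_mul, show (2 : Fin 3) = 1 + 1 from rfl, tau_omega_mul] at h1
  rw [discMap_omega_mul, discMap_omega_mul, show (2 : Fin 3) = 1 + 1 from rfl, tau_omega_mul,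
    show (1 : Fin 3) = 0 + 1 from rfl, tau_omega_mul] at h0
  intro j
  fin_cases j
  exacts [h0, h1, h2]

theorem deriv_discMap_ne_zero {u : ℂ} (hu : ‖u‖ < 1) : density u / (primitive 1).re ≠ 0 :=
  div_ne_zero (density_ne_zero hu) primitive_one_re_ne

theorem analyticAt_discMap {u : ℂ} (hu : ‖u‖ < 1) : AnalyticAt ℂ discMap u := by
  rw [Complex.analyticAt_iff_eventually_differentiableAt]
  filter_upwards [isOpen_ball.mem_nhds (show u ∈ ball (0 : ℂ) 1 by simpa using hu)] with v hv
  exact (hasDerivAt_discMap (by simpa using hv)).differentiableAt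

theorem isOpen_discMap_image_ball : IsOpen (discMap '' ball 0 1) := by
  rw [isOpen_iff_mem_nhds]
  rintro _ ⟨u, hu, rfl⟩
  have hu' : ‖u‖ < 1 := by simpa using hu
  have h1 := (analyticAt_discMap hu').hasStrictDerivAt
  rw [(hasDerivAt_discMap hu').deriv] at h1
  rw [← h1.map_nhds_eq (deriv_discMap_ne_zero hu')]
  exact image_mem_map (isOpen_ball.mem_nhds hu)

theorem discMap_image_ball_subset : discMap '' ball 0 1 ⊆ openUnitTriangle := by
  refine interior_unitTriangle_subset isOpen_discMap_image_ball ?_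
  rintro _ ⟨u, hu, rfl⟩
  exact discMap_mem_unitTriangle (by simpa using (mem_ball_zero_iff.1 hu).le)

/-- Connectedness of the open triangle. The image of the open disc is open, and it is relatively
closed because the image of the closed disc is compact while the circle goes to the boundary. -/
theorem discMap_image_ball : discMap '' ball 0 1 = openUnitTriangle := by
  refine discMap_image_ball_subset.antisymm ?_
  have hcl : IsClosed (discMap '' closedBall 0 1) :=
    ((isCompact_closedBall 0 1).image_of_continuousOn continuousOn_discMap).isClosed
  refine convex_openUnitTriangle.isPreconnected.subset_left_of_subset_union
    isOpen_discMap_image_ball hcl.isOpen_compl ?_ ?_ ?_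
  · rw [disjoint_compl_right_iff_subset]
    exact image_mono ball_subset_closedBall
  · intro y hy
    by_contra h
    simp only [mem_union, mem_compl_iff, not_or, not_not] at h
    obtain ⟨h1, u, hu, rfl⟩ := h
    have hu' : ‖u‖ = 1 := by
      refine le_antisymm (by simpa using hu) (le_of_not_gt fun h2 => h1 ⟨u, by simpa using h2, rfl⟩)
    obtain ⟨-, j, hj⟩ := discMap_mem_of_norm_eq_one hu'
    exact (hy j).ne' hj
  · refine ⟨0, ?_, 0, by simp, discMap_zero⟩
    intro j
    fin_cases j <;> simp [tau]

theorem subset_closure_openUnitTriangle : unitTriangle ⊆ closure openUnitTriangle := by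
  intro y hy
  have hc : Tendsto (fun s : ℝ => (s : ℂ) * y) (𝓝[<] 1) (𝓝 y) := by
    have : ContinuousAt (fun s : ℝ => (s : ℂ) * y) 1 := by fun_prop
    simpa using (this.tendsto.mono_left nhdsWithin_le_nhds)
  refine mem_closure_of_tendsto hc ?_
  filter_upwards [self_mem_nhdsWithin, nhdsWithin_le_nhds (Ioi_mem_nhds one_pos)] with s hs hs0 j
  have h1 := tau_combo j y 0 (a := s) (b := 1 - s) (by ring)
  have h2 : tau j 0 = 1 / 3 := by fin_cases j <;> simp [tau]
  rw [mul_zero, add_zero, h2] at h1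
  rw [h1]
  have h3 : s < 1 := hs
  have h4 : 0 < s := hs0
  have h5 := mul_nonneg h4.le (hy j)
  linarith

theorem discMap_image_closedBall : discMap '' closedBall 0 1 = unitTriangle := by
  refine Subset.antisymm ?_ ?_
  · rintro _ ⟨u, hu, rfl⟩
    exact discMap_mem_unitTriangle (by simpa using hu)
  · have hcl : IsClosed (discMap '' closedBall 0 1) :=
      ((isCompact_closedBall 0 1).image_of_continuousOn continuousOn_discMap).isClosed
    refine subset_closure_openUnitTriangle.trans (hcl.closure_subset_iff.2 ?_)
    rw [← discMap_image_ball]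
    exact image_mono ball_subset_closedBall

/-- The conformal map from the triangle with vertices `1`, `ω`, `ω²` to the unit disc. -/
def triMap : ℂ → ℂ := Function.invFunOn discMap (closedBall 0 1)

theorem norm_triMap_le {y : ℂ} (hy : y ∈ unitTriangle) : ‖triMap y‖ ≤ 1 := by
  rw [← discMap_image_closedBall] at hy
  exact mem_closedBall_zero_iff.1 (Function.invFunOn_mem hy)

theorem discMap_triMap {y : ℂ} (hy : y ∈ unitTriangle) : discMap (triMap y) = y := by
  rw [← discMap_image_closedBall] at hy
  exact Function.invFunOn_eq hy

theorem triMap_discMap {u : ℂ} (hu : ‖u‖ ≤ 1) : triMap (discMap u) = u :=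
  injOn_discMap (by simpa using norm_triMap_le (discMap_mem_unitTriangle hu)) (by simpa using hu)
    (discMap_triMap (discMap_mem_unitTriangle hu))

theorem continuousOn_triMap : ContinuousOn triMap unitTriangle := by
  rw [← discMap_image_closedBall]
  exact (isCompact_closedBall 0 1).continuousOn_leftInverse continuousOn_discMap
    fun u hu => triMap_discMap (by simpa using hu)

theorem openUnitTriangle_subset : openUnitTriangle ⊆ unitTriangle := fun _ hy j => (hy j).le

theorem norm_triMap_lt {y : ℂ} (hy : y ∈ openUnitTriangle) : ‖triMap y‖ < 1 := by
  rw [← discMap_image_ball] at hy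
  obtain ⟨u, hu, rfl⟩ := hy
  have hu' : ‖u‖ < 1 := by simpa using hu
  rwa [triMap_discMap hu'.le]

theorem norm_triMap_eq {y : ℂ} (hy : y ∈ unitTriangle) (h : ∃ j, tau j y = 0) : ‖triMap y‖ = 1 := by
  refine le_antisymm (norm_triMap_le hy) (le_of_not_gt fun h1 => ?_)
  obtain ⟨j, hj⟩ := h
  have : y ∈ openUnitTriangle := by
    rw [← discMap_image_ball]
    exact ⟨_, by simpa using h1, discMap_triMap hy⟩
  exact (this j).ne' hj

theorem hasDerivAt_triMap {y : ℂ} (hy : y ∈ openUnitTriangle) : ∃ d ≠ 0, HasDerivAt triMap d y := by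
  have hn := isOpen_openUnitTriangle.mem_nhds hy
  refine ⟨_, inv_ne_zero (deriv_discMap_ne_zero (norm_triMap_lt hy)),
    HasDerivAt.of_local_left_inverse (f := discMap)
    ((continuousOn_triMap.mono openUnitTriangle_subset).continuousAt hn)
    (hasDerivAt_discMap (norm_triMap_lt hy)) (deriv_discMap_ne_zero (norm_triMap_lt hy)) ?_⟩
  filter_upwards [hn] with y' hy'
  exact discMap_triMap (openUnitTriangle_subset hy')

theorem triMap_omega_mul {y : ℂ} (hy : y ∈ unitTriangle) : triMap (omega * y) = omega * triMap y := by
  have h1 : ‖omega * triMap y‖ ≤ 1 := by simpa [norm_omega] using norm_triMap_le hy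
  rw [← triMap_discMap h1, discMap_omega_mul, discMap_triMap hy]

theorem triMap_conj {y : ℂ} (hy : y ∈ unitTriangle) :
    triMap ((starRingEnd ℂ) y) = (starRingEnd ℂ) (triMap y) := by
  have h1 : ‖(starRingEnd ℂ) (triMap y)‖ ≤ 1 := by simpa using norm_triMap_le hy
  rw [← triMap_discMap h1, discMap_conj (norm_triMap_le hy), discMap_triMap hy]

theorem tau_triMap_le_iff {y : ℂ} (hy : y ∈ unitTriangle) (a b : Fin 3) :
    tau a (triMap y) ≤ tau b (triMap y) ↔ tau a y ≤ tau b y := by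
  rw [← tau_discMap_le_iff (norm_triMap_le hy), discMap_triMap hy]

theorem triMap_zero : triMap 0 = 0 := by
  conv_lhs => rw [← discMap_zero]
  exact triMap_discMap (by simp)

theorem triMap_one : triMap 1 = 1 := by
  conv_lhs => rw [← discMap_one]
  exact triMap_discMap (by simp)

theorem triMap_eq_zero_iff {y : ℂ} (hy : y ∈ unitTriangle) : triMap y = 0 ↔ y = 0 := by
  refine ⟨fun h => ?_, fun h => by rw [h, triMap_zero]⟩
  rw [← discMap_triMap hy, h, discMap_zero]

end

end SchwarzChristoffel

/-! ### Barycentric coordinates and the six right triangles of a face -/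

namespace Equilateral

open SchwarzChristoffel Set

noncomputable section

theorem corner_two : corner 2 = -omega ^ 2 := by
  have h : corner 2 = Complex.exp ((Real.pi / 3 : ℝ) * Complex.I) := by
    simp [corner]
  rw [h, omega_sq]
  apply Complex.ext
  · rw [Complex.exp_ofReal_mul_I_re, Real.cos_pi_div_three]; simp; norm_num
  · rw [Complex.exp_ofReal_mul_I_im, Real.sin_pi_div_three]; simp

theorem corner_zero : corner 0 = 0 := rfl
theorem corner_one : corner 1 = 1 := rfl

theorem omega_sub_one_ne_zero : omega - 1 ≠ 0 := fun h => by
  have := congrArg Complex.re h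
  norm_num at this

/-- The affine map sending the corners to `1`, `ω`, `ω²`. -/
def toUnit (z : ℂ) : ℂ := 1 + (omega - 1) * z

/-- The inverse of `toUnit`. -/
def ofUnit (y : ℂ) : ℂ := (y - 1) / (omega - 1)

theorem toUnit_ofUnit (y : ℂ) : toUnit (ofUnit y) = y := by
  rw [toUnit, ofUnit, mul_div_cancel₀ _ omega_sub_one_ne_zero]; ring

theorem ofUnit_toUnit (z : ℂ) : ofUnit (toUnit z) = z := by
  rw [toUnit, ofUnit, add_sub_cancel_left, mul_div_cancel_left₀ _ omega_sub_one_ne_zero]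

theorem toUnit_injective : Function.Injective toUnit :=
  Function.LeftInverse.injective ofUnit_toUnit

theorem continuous_toUnit : Continuous toUnit := by unfold toUnit; fun_prop

theorem toUnit_combo (x y : ℂ) {a b : ℝ} (h : a + b = 1) :
    toUnit (a * x + b * y) = a * toUnit x + b * toUnit y := by
  have h' : (a : ℂ) + b = 1 := by exact_mod_cast h
  simp only [toUnit]
  linear_combination (-1 : ℂ) * h'

theorem toUnit_corner (j : Fin 3) : toUnit (corner j) = omega ^ (j : ℕ) := by
  fin_cases j
  · simp [toUnit, corner_zero]
  · simp [toUnit, corner_one]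
  · change 1 + (omega - 1) * corner 2 = omega ^ 2
    rw [corner_two]
    linear_combination (-1 : ℂ) * omega_cube

theorem center_eq : center = (2 + omega) / 3 := by
  rw [center, corner_zero, corner_one, corner_two, omega_sq]; ring

theorem toUnit_center : toUnit center = 0 := by
  rw [toUnit, center_eq]
  linear_combination (1 / 3 : ℂ) * omega_sq

/-- Barycentric coordinates with respect to the corners. -/
def bary (j : Fin 3) (z : ℂ) : ℝ := tau j (toUnit z)

theorem continuous_bary (j : Fin 3) : Continuous (bary j) :=
  (continuous_tau j).comp continuous_toUnit

theorem bary_corner (j k : Fin 3) : bary j (corner k) = if j = k then 1 else 0 := by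
  have := sqrt_three_mul_self
  rw [bary, toUnit_corner]
  fin_cases j <;> fin_cases k <;> simp [tau, omega_sq] <;> nlinarith

theorem bary_combo (j : Fin 3) (x y : ℂ) {a b : ℝ} (h : a + b = 1) :
    bary j (a * x + b * y) = a * bary j x + b * bary j y := by
  rw [bary, toUnit_combo x y h, tau_combo j _ _ h, bary, bary]

theorem bary_sum (z : ℂ) : bary 0 z + bary 1 z + bary 2 z = 1 := by
  simp only [bary, tau_zero, tau_one, tau_two]; ring

theorem sum_tau_mul (y : ℂ) : (tau 0 y : ℂ) + tau 1 y * omega + tau 2 y * omega ^ 2 = y := by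
  have := sqrt_three_mul_self
  rw [omega_sq]
  apply Complex.ext
  · simp [tau]; ring
  · simp [tau]; linear_combination y.im / 3 * this

theorem eq_sum_bary (z : ℂ) :
    z = bary 0 z * corner 0 + bary 1 z * corner 1 + bary 2 z * corner 2 := by
  have h2 : (bary 0 z : ℂ) + bary 1 z + bary 2 z = 1 := by exact_mod_cast bary_sum z
  have h1 := sum_tau_mul (toUnit z)
  refine toUnit_injective ?_
  rw [← h1]
  change (bary 0 z : ℂ) + bary 1 z * omega + bary 2 z * omega ^ 2 = _
  rw [toUnit, corner_zero, corner_one, corner_two]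
  linear_combination h2 + bary 2 z * omega_cube

theorem bary_ext {z w : ℂ} (h : ∀ j, bary j z = bary j w) : z = w := by
  rw [eq_sum_bary z, eq_sum_bary w, h, h, h]

theorem bary_center (j : Fin 3) : bary j center = 1 / 3 := by
  rw [bary, toUnit_center]
  fin_cases j <;> simp [tau]

theorem mem_triangle_iff {z : ℂ} : z ∈ triangle ↔ ∀ j, 0 ≤ bary j z := by
  constructor
  · intro h
    have hc : Convex ℝ {z | ∀ j, 0 ≤ bary j z} := by
      intro x hx y hy a b ha hb hab j
      rw [Complex.real_smul, Complex.real_smul, bary_combo j x y hab]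
      exact add_nonneg (mul_nonneg ha (hx j)) (mul_nonneg hb (hy j))
    refine convexHull_min ?_ hc h
    rintro _ ⟨k, rfl⟩ j
    rw [bary_corner]
    split_ifs <;> norm_num
  · intro h
    have h1 : ∑ j, bary j z = 1 := by rw [Fin.sum_univ_three, bary_sum]
    have := (convex_convexHull ℝ (Set.range corner)).sum_mem (t := Finset.univ)
      (w := fun j => bary j z) (z := corner) (fun j _ => h j) h1 (fun j _ => corner_mem j)
    rw [Fin.sum_univ_three] at this
    simp only [Complex.real_smul] at this
    rwa [← eq_sum_bary] at this

theorem toUnit_mem_iff {z : ℂ} : toUnit z ∈ unitTriangle ↔ z ∈ triangle := mem_triangle_iff.symm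

theorem isCompact_triangle : IsCompact triangle :=
  (Set.finite_range corner).isCompact_convexHull ℝ

instance : CompactSpace triangle := isCompact_iff_compactSpace.1 isCompact_triangle

/-- The interior of the triangle. -/
def openTriangle : Set ℂ := {z | ∀ j, 0 < bary j z}

theorem isOpen_openTriangle : IsOpen openTriangle := by
  simp only [openTriangle, ofPred_forall]
  exact isOpen_iInter_of_finite fun j => isOpen_lt continuous_const (continuous_bary j)

theorem openTriangle_subset : openTriangle ⊆ triangle := fun _ h =>
  mem_triangle_iff.2 fun j => (h j).le

theorem toUnit_mem_open_iff {z : ℂ} : toUnit z ∈ openUnitTriangle ↔ z ∈ openTriangle := Iff.rfl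

theorem bary_sub_mul (j a b : Fin 3) (z : ℂ) (s : ℝ) :
    bary j (z - s * (corner a - corner b)) =
      bary j z - s * (bary j (corner a) - bary j (corner b)) := by
  have h : bary j (z - s * (corner a - corner b)) - bary j z =
      - s * (bary j (corner a) - bary j (corner b)) := by
    have ht : ∀ (x y : ℂ), tau j (x + y) = tau j x + (tau j y - tau j 0) := by
      intro x y
      fin_cases j <;> simp [tau] <;> ring
    have h1 : toUnit (z - s * (corner a - corner b)) =
        toUnit z + ((-s : ℝ) : ℂ) * (toUnit (corner a) + ((-1 : ℝ) : ℂ) * toUnit (corner b)) := by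
      simp only [toUnit]; push_cast; ring
    have hs' : ∀ (s : ℝ) x, tau j (s * x) - tau j 0 = s * (tau j x - tau j 0) := by
      intro s x
      fin_cases j <;> simp [tau] <;> ring
    simp only [bary]
    rw [h1, ht, hs', ht, hs']
    ring
  linarith

/-- The right triangle with a corner at the centre, at `corner a` and at the midpoint of
`corner a` and `corner b`. -/
def chamber (a b : Fin 3) : Set ℂ :=
  {z | 0 ≤ bary (-a - b) z ∧ bary (-a - b) z ≤ bary b z ∧ bary b z ≤ bary a z}

/-- The elements of `Fin 3` sum to `0`, so `-a - b` is the index different from `a` and `b`. -/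
theorem add_third {M : Type*} [AddCommMonoid M] (F : Fin 3 → M) {a b : Fin 3} (hab : a ≠ b) :
    F a + F b + F (-a - b) = F 0 + F 1 + F 2 := by
  have : (a = 0 ∧ b = 1 ∧ -a - b = 2) ∨ (a = 0 ∧ b = 2 ∧ -a - b = 1) ∨
      (a = 1 ∧ b = 0 ∧ -a - b = 2) ∨ (a = 1 ∧ b = 2 ∧ -a - b = 0) ∨
      (a = 2 ∧ b = 0 ∧ -a - b = 1) ∨ (a = 2 ∧ b = 1 ∧ -a - b = 0) := by
    clear F; revert a b; decide
  rcases this with ⟨h1, h2, h3⟩ | ⟨h1, h2, h3⟩ | ⟨h1, h2, h3⟩ | ⟨h1, h2, h3⟩ | ⟨h1, h2, h3⟩ |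
    ⟨h1, h2, h3⟩ <;> rw [h1, h2] at h3 ⊢ <;> rw [h3] <;> abel

theorem bary_sum' {a b : Fin 3} (hab : a ≠ b) (z : ℂ) :
    bary a z + bary b z + bary (-a - b) z = 1 := by
  rw [add_third (fun j => bary j z) hab, bary_sum]

theorem forall_fin_three {a b : Fin 3} (hab : a ≠ b) {p : Fin 3 → Prop} :
    (∀ j, p j) ↔ p a ∧ p b ∧ p (-a - b) := by
  refine ⟨fun h => ⟨h _, h _, h _⟩, fun h j => ?_⟩
  have : j = a ∨ j = b ∨ j = -a - b := by clear h; clear p; revert a b j; decide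
  rcases this with rfl | rfl | rfl
  exacts [h.1, h.2.1, h.2.2]

theorem third_ne {a b : Fin 3} (hab : a ≠ b) : -a - b ≠ a ∧ -a - b ≠ b := by
  revert a b; decide

theorem chamber_subset_triangle {a b : Fin 3} (hab : a ≠ b) : chamber a b ⊆ triangle := by
  rintro z ⟨h1, h2, h3⟩
  rw [mem_triangle_iff, forall_fin_three hab]
  exact ⟨by linarith, by linarith, h1⟩

theorem convexHull_eq_chamber {a b : Fin 3} (hab : a ≠ b) :
    convexHull ℝ {midpoint ℝ (corner a) (corner b), corner a, center} = chamber a b := by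
  obtain ⟨hd1, hd2⟩ := third_ne hab
  have hmid : midpoint ℝ (corner a) (corner b) =
      ((1 / 2 : ℝ) : ℂ) * corner a + ((1 / 2 : ℝ) : ℂ) * corner b := by
    rw [midpoint_eq_smul_add, Complex.real_smul]; push_cast [invOf_eq_inv]; ring
  have bm : ∀ j, bary j (midpoint ℝ (corner a) (corner b)) =
      1 / 2 * bary j (corner a) + 1 / 2 * bary j (corner b) := fun j => by
    rw [hmid, bary_combo j _ _ (by norm_num)]
  apply Subset.antisymm
  · refine convexHull_min ?_ ?_
    · rintro z (rfl | rfl | rfl)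
      · simp only [chamber, mem_ofPred_eq, bm, bary_corner]
        simp [hd1, hd2, hab, hab.symm]
      · simp only [chamber, mem_ofPred_eq, bary_corner]
        simp [hd1, hab.symm]
      · simp only [chamber, mem_ofPred_eq, bary_center]
        norm_num
    · rintro x ⟨hx1, hx2, hx3⟩ y ⟨hy1, hy2, hy3⟩ s t hs ht hst
      simp only [chamber, mem_ofPred_eq, Complex.real_smul, bary_combo _ x y hst]
      exact ⟨by positivity, by gcongr, by gcongr⟩
  · rintro z ⟨h1, h2, h3⟩
    set V : Set ℂ := {midpoint ℝ (corner a) (corner b), corner a, center} with hV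
    have m0 : midpoint ℝ (corner a) (corner b) ∈ convexHull ℝ V :=
      subset_convexHull ℝ _ (by simp [hV])
    have m1 : corner a ∈ convexHull ℝ V := subset_convexHull ℝ _ (by simp [hV])
    have m2 : center ∈ convexHull ℝ V := subset_convexHull ℝ _ (by simp [hV])
    have hs := bary_sum' hab z
    -- The weights solve the linear system expressing `z` by the three vertices. The centre alone
    -- involves `corner (-a - b)`, so it carries three times that coordinate; the midpoint makes up
    -- the rest of the `b`-coordinate, and `corner a` takes the remainder.
    have := (convex_convexHull ℝ V).sum_mem (t := Finset.univ)
      (w := ![2 * (bary b z - bary (-a - b) z), bary a z - bary b z, 3 * bary (-a - b) z])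
      (z := ![midpoint ℝ (corner a) (corner b), corner a, center])
      (by intro j _; fin_cases j <;> simp <;> linarith)
      (by rw [Fin.sum_univ_three]; simp; linarith)
      (by intro j _; fin_cases j <;> simp [m0, m1, m2])
    rw [Fin.sum_univ_three] at this
    convert this using 1
    simp only [Matrix.cons_val_zero, Matrix.cons_val_one, Matrix.cons_val_two, Matrix.head_cons,
      Matrix.tail_cons, Complex.real_smul, hmid]
    have hc : 3 * center = corner a + corner b + corner (-a - b) := by
      have : 3 * center = corner 0 + corner 1 + corner 2 := by rw [center]; ring
      rw [this]
      exact (add_third corner hab).symm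
    have hz : z = bary a z * corner a + bary b z * corner b + bary (-a - b) z * corner (-a - b) := by
      rw [add_third (fun j => (bary j z : ℂ) * corner j) hab, ← eq_sum_bary]
    nth_rw 1 [hz]
    push_cast
    linear_combination (-(bary (-a - b) z : ℂ)) * hc

theorem minusTriangle_eq (i : Fin 3) : minusTriangle i = chamber i (i + 1) :=
  convexHull_eq_chamber (by revert i; decide)

theorem plusTriangle_eq (i : Fin 3) : plusTriangle i = chamber (i + 1) i := by
  rw [← convexHull_eq_chamber (by revert i; decide), midpoint_comm]; rfl

theorem isClosed_chamber (a b : Fin 3) : IsClosed (chamber a b) :=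
  (isClosed_le continuous_const (continuous_bary _)).inter
    ((isClosed_le (continuous_bary _) (continuous_bary _)).inter
      (isClosed_le (continuous_bary _) (continuous_bary _)))

/-- Each defining inequality is strict at an interior point, because some difference of two corners
is a direction along which it would otherwise fail at once. -/
theorem interior_chamber {a b : Fin 3} (hab : a ≠ b) : interior (chamber a b) =
    {z | 0 < bary (-a - b) z ∧ bary (-a - b) z < bary b z ∧ bary b z < bary a z} := by
  obtain ⟨hd1, hd2⟩ := third_ne hab
  apply Subset.antisymm
  · intro z hz
    rw [mem_interior_iff_mem_nhds] at hz
    refine ⟨?_, ?_, ?_⟩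
    · refine pos_of_eventually_nonneg (d := corner (-a - b) - corner a) (k := 1) one_pos
        (fun s => ?_) (Filter.mem_of_superset hz fun y hy => hy.1)
      rw [bary_sub_mul]; simp [bary_corner, hd1]
    · rw [← sub_pos]
      refine pos_of_eventually_nonneg (l := fun z => bary b z - bary (-a - b) z)
        (d := corner b - corner (-a - b)) (k := 2) two_pos
        (fun s => ?_) (Filter.mem_of_superset hz fun y hy => sub_nonneg.2 hy.2.1)
      simp only [bary_sub_mul]; simp [bary_corner, hd2, hd2.symm]; ring
    · rw [← sub_pos]
      refine pos_of_eventually_nonneg (l := fun z => bary a z - bary b z)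
        (d := corner a - corner b) (k := 2) two_pos
        (fun s => ?_) (Filter.mem_of_superset hz fun y hy => sub_nonneg.2 hy.2.2)
      simp only [bary_sub_mul]; simp [bary_corner, hab, hab.symm]; ring
  · refine interior_maximal (fun z hz => ⟨hz.1.le, hz.2.1.le, hz.2.2.le⟩) ?_
    exact (isOpen_lt continuous_const (continuous_bary _)).inter
      ((isOpen_lt (continuous_bary _) (continuous_bary _)).inter
        (isOpen_lt (continuous_bary _) (continuous_bary _)))

theorem interior_chamber_subset {a b : Fin 3} (hab : a ≠ b) :
    interior (chamber a b) ⊆ openTriangle := by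
  rw [interior_chamber hab]
  rintro z ⟨h1, h2, h3⟩
  change ∀ j, 0 < bary j z
  rw [forall_fin_three hab]
  exact ⟨by linarith, by linarith, h1⟩

theorem mem_frontier_chamber_iff {a b : Fin 3} (hab : a ≠ b) {z : ℂ} (hz : z ∈ chamber a b) :
    z ∈ frontier (chamber a b) ↔
      bary (-a - b) z = 0 ∨ bary (-a - b) z = bary b z ∨ bary b z = bary a z := by
  rw [(isClosed_chamber a b).frontier_eq, mem_sdiff, interior_chamber hab]
  obtain ⟨h1, h2, h3⟩ := hz
  constructor
  · rintro ⟨-, h⟩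
    by_contra! hc
    exact h ⟨lt_of_le_of_ne h1 hc.1.symm, lt_of_le_of_ne h2 hc.2.1, lt_of_le_of_ne h3 hc.2.2⟩
  · intro h
    refine ⟨⟨h1, h2, h3⟩, fun h' => ?_⟩
    rcases h with h | h | h
    · exact h'.1.ne' h
    · exact h'.2.1.ne h
    · exact h'.2.2.ne h

/-- The order of the three barycentric coordinates selects the right triangle. -/
theorem exists_mem_chamber {z : ℂ} (hz : z ∈ triangle) :
    ∃ i, z ∈ plusTriangle i ∨ z ∈ minusTriangle i := by
  simp only [plusTriangle_eq, minusTriangle_eq]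
  rw [mem_triangle_iff] at hz
  have h0 := hz 0
  have h1 := hz 1
  have h2 := hz 2
  rcases le_total (bary 0 z) (bary 1 z) with h01 | h01 <;>
    rcases le_total (bary 1 z) (bary 2 z) with h12 | h12 <;>
    rcases le_total (bary 0 z) (bary 2 z) with h02 | h02
  · exact ⟨1, Or.inl ⟨h0, h01, h12⟩⟩
  · exact ⟨1, Or.inl ⟨h0, h01, h12⟩⟩
  · exact ⟨1, Or.inr ⟨h0, h02, h12⟩⟩
  · exact ⟨0, Or.inl ⟨h2, h02, h01⟩⟩
  · exact ⟨2, Or.inr ⟨h1, h01, h02⟩⟩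
  · exact ⟨2, Or.inl ⟨h1, h12, h02⟩⟩
  · exact ⟨0, Or.inr ⟨h2, h12, h01⟩⟩
  · exact ⟨0, Or.inr ⟨h2, h12, h01⟩⟩

end

end Equilateral

/-! ### The Belyi function of one equilateral triangle -/

namespace Equilateral

open SchwarzChristoffel Set RiemannSphere

noncomputable section

/-- The function `(1 + u³)² / (4u³)` with finite values. -/
def discBelyiFinite (u : ℂ) : ℂ := (1 + u ^ 3) ^ 2 / (4 * u ^ 3)

open Classical in
/-- The function `(1 + u³)² / (4u³)` on the unit disc. -/
def discBelyi (u : ℂ) : OnePoint ℂ := if u = 0 then OnePoint.infty else (discBelyiFinite u : ℂ)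

theorem discBelyi_zero : discBelyi 0 = OnePoint.infty := if_pos rfl

theorem discBelyi_of_ne {u : ℂ} (h : u ≠ 0) : discBelyi u = (discBelyiFinite u : ℂ) := if_neg h

theorem discBelyi_omega_mul (u : ℂ) : discBelyi (omega * u) = discBelyi u := by
  by_cases h : u = 0
  · simp [h]
  · rw [discBelyi_of_ne h, discBelyi_of_ne (mul_ne_zero omega_ne_zero h), discBelyiFinite,
      mul_pow, omega_cube, one_mul, discBelyiFinite]

/-- Complex conjugation on the sphere. -/
def sphereConj : OnePoint ℂ → OnePoint ℂ := OnePoint.map (starRingEnd ℂ)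

theorem sphereConj_coe (z : ℂ) : sphereConj z = ((starRingEnd ℂ z : ℂ) : OnePoint ℂ) := rfl
theorem sphereConj_infty : sphereConj OnePoint.infty = OnePoint.infty := rfl

theorem sphereConj_sphereConj (p : OnePoint ℂ) : sphereConj (sphereConj p) = p := by
  induction p using OnePoint.rec with
  | infty => rfl
  | coe z => rw [sphereConj_coe, sphereConj_coe, Complex.conj_conj]

theorem discBelyi_conj (u : ℂ) : discBelyi (starRingEnd ℂ u) = sphereConj (discBelyi u) := by
  by_cases h : u = 0
  · simp [h, discBelyi_zero, sphereConj_infty]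
  · rw [discBelyi_of_ne h, discBelyi_of_ne ((map_ne_zero _).2 h), sphereConj_coe]
    simp [discBelyiFinite, map_ofNat (starRingEnd ℂ) 4]

theorem coe_mem_upperHemisphere {z : ℂ} : (z : OnePoint ℂ) ∈ upperHemisphere ↔ 0 ≤ z.im := by
  simp [upperHemisphere]

theorem coe_mem_lowerHemisphere {z : ℂ} : (z : OnePoint ℂ) ∈ lowerHemisphere ↔ z.im ≤ 0 := by
  simp [lowerHemisphere]

theorem coe_mem_equator {z : ℂ} : (z : OnePoint ℂ) ∈ equator ↔ z.im = 0 := by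
  simp [equator]

theorem infty_mem_equator : OnePoint.infty ∈ equator := by simp [equator]

theorem equator_subset_upperHemisphere : equator ⊆ upperHemisphere := by
  intro p
  induction p using OnePoint.rec with
  | infty => simp [upperHemisphere]
  | coe z => rw [coe_mem_equator, coe_mem_upperHemisphere]; exact fun h => h.ge

theorem equator_subset_lowerHemisphere : equator ⊆ lowerHemisphere := by
  intro p
  induction p using OnePoint.rec with
  | infty => simp [lowerHemisphere]
  | coe z => rw [coe_mem_equator, coe_mem_lowerHemisphere]; exact fun h => h.le

theorem bijOn_sphereConj : BijOn sphereConj lowerHemisphere upperHemisphere := by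
  refine ⟨?_, fun p _ q _ h => ?_, ?_⟩
  · intro p
    induction p using OnePoint.rec with
    | infty => simp [upperHemisphere, sphereConj_infty]
    | coe z => rw [sphereConj_coe, coe_mem_upperHemisphere, coe_mem_lowerHemisphere]; simp
  · rw [← sphereConj_sphereConj p, h, sphereConj_sphereConj]
  · intro p hp
    refine ⟨sphereConj p, ?_, sphereConj_sphereConj p⟩
    revert hp
    induction p using OnePoint.rec with
    | infty => simp [lowerHemisphere, sphereConj_infty]
    | coe z => rw [sphereConj_coe, coe_mem_upperHemisphere, coe_mem_lowerHemisphere]; simp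

theorem im_joukowsky {v : ℂ} (hv : v ≠ 0) :
    ((1 + v) ^ 2 / (4 * v)).im = v.im * (1 - (Complex.normSq v)⁻¹) / 4 := by
  have h : (1 + v) ^ 2 / (4 * v) = ((1 / 4 : ℝ) : ℂ) * (v + v⁻¹) + ((1 / 2 : ℝ) : ℂ) := by
    push_cast; field_simp; ring
  rw [h, Complex.add_im, Complex.im_ofReal_mul, Complex.add_im, Complex.inv_im, Complex.ofReal_im]
  ring

theorem normSq_le_one {v : ℂ} (hv : ‖v‖ ≤ 1) : Complex.normSq v ≤ 1 := by
  rw [Complex.normSq_eq_norm_sq]; exact pow_le_one₀ (norm_nonneg _) hv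

/-- The values at `v` and `v⁻¹` coincide and there are no other coincidences, so every value is
taken in the closed disc. By `im_joukowsky` the upper half of the disc goes to the lower half-plane;
on the circle the sign of `v.im` chooses between `v` and its conjugate. -/
theorem bijOn_joukowsky : BijOn
    (fun v : ℂ => if v = 0 then OnePoint.infty else (((1 + v) ^ 2 / (4 * v) : ℂ) : OnePoint ℂ))
    {v | ‖v‖ ≤ 1 ∧ 0 ≤ v.im} lowerHemisphere := by
  refine ⟨?_, ?_, ?_⟩
  · rintro v ⟨h1, h2⟩
    by_cases hv : v = 0
    · simp [hv, lowerHemisphere]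
    · simp only [hv, if_false]
      rw [coe_mem_lowerHemisphere, im_joukowsky hv]
      have h3 := Complex.normSq_pos.2 hv
      have h4 := (one_le_inv₀ h3).2 (normSq_le_one h1)
      nlinarith
  · rintro v ⟨h1, h2⟩ w ⟨h3, h4⟩ h
    by_cases hv : v = 0 <;> by_cases hw : w = 0
    · rw [hv, hw]
    · simp [hv, hw] at h
    · simp [hv, hw] at h
    · simp only [hv, hw, if_false, OnePoint.coe_eq_coe] at h
      -- If `v * w = 1` with both in the disc, both are on the circle and conjugate; as neither
      -- imaginary part is negative, both are real and hence equal.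
      have h5 : (v - w) * (v * w - 1) = 0 := by
        field_simp at h
        linear_combination h
      rcases mul_eq_zero.1 h5 with h6 | h6
      · exact sub_eq_zero.1 h6
      · have h7 : v * w = 1 := sub_eq_zero.1 h6
        have h8 : ‖v‖ * ‖w‖ = 1 := by rw [← norm_mul, h7, norm_one]
        have h9 : ‖w‖ = 1 := by nlinarith [norm_nonneg v, norm_nonneg w]
        have h10 : v = (starRingEnd ℂ) w := by
          rw [eq_inv_of_mul_eq_one_left h7, Complex.inv_eq_conj h9]
        have h11 : v.im = - w.im := by rw [h10, Complex.conj_im]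
        have h12 : w.im = 0 := by linarith
        rw [h10, Complex.conj_eq_iff_im.2 h12]
  · intro p hp
    induction p using OnePoint.rec with
    | infty => exact ⟨0, by simp, by simp⟩
    | coe z =>
      rw [coe_mem_lowerHemisphere] at hp
      -- The equation `(1 + v)² = 4vz` is `v² - 2(2z - 1)v + 1 = 0`. Its roots are `2z - 1 ± s`,
      -- with product `1`, so one of them lies in the closed disc.
      obtain ⟨s, hs⟩ := IsAlgClosed.exists_pow_nat_eq ((2 * z - 1) ^ 2 - 1) (n := 2) two_pos
      have key : ∃ v : ℂ, v ≠ 0 ∧ (1 + v) ^ 2 / (4 * v) = z ∧ ‖v‖ ≤ 1 := by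
        set v := 2 * z - 1 + s with hv
        have hq : v * (2 * z - 1 - s) = 1 := by rw [hv]; linear_combination (-1 : ℂ) * hs
        have hv0 : v ≠ 0 := left_ne_zero_of_mul_eq_one hq
        have hJ : (1 + v) ^ 2 / (4 * v) = z := by
          rw [div_eq_iff (by simpa using hv0), hv]
          linear_combination (1 : ℂ) * hs
        rcases le_or_gt ‖v‖ 1 with h | h
        · exact ⟨v, hv0, hJ, h⟩
        · refine ⟨v⁻¹, inv_ne_zero hv0, ?_, ?_⟩
          · rw [← hJ]; field_simp; ring
          · rw [norm_inv]; exact inv_le_one_of_one_le₀ h.le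
      obtain ⟨v, hv0, hJ, hv1⟩ := key
      have him := im_joukowsky hv0
      rw [hJ] at him
      rcases le_or_gt 0 v.im with h | h
      · exact ⟨v, ⟨hv1, h⟩, by simp [hv0, hJ]⟩
      -- A root strictly inside the disc with negative imaginary part would give `z` a positive
      -- imaginary part. So the root lies on the circle, and its inverse is its conjugate in the
      -- upper half.
      · have h3 := Complex.normSq_pos.2 hv0
        have h4 := (one_le_inv₀ h3).2 (normSq_le_one hv1)
        have h5 : (Complex.normSq v)⁻¹ = 1 := by
          by_contra hne
          have : 1 < (Complex.normSq v)⁻¹ := lt_of_le_of_ne h4 (Ne.symm hne)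
          nlinarith
        have h6 : v⁻¹ = (starRingEnd ℂ) v := by
          rw [Complex.inv_def, h5]; simp
        refine ⟨v⁻¹, ⟨?_, ?_⟩, ?_⟩
        · rw [h6]; simpa using hv1
        · rw [h6]; simpa using h.le
        · simp only [inv_eq_zero, hv0, if_false, OnePoint.coe_eq_coe]
          rw [← hJ]; field_simp; ring

/-- The sector of the unit disc corresponding to the right triangle `chamber a b`. -/
def discChamber (a b : Fin 3) : Set ℂ :=
  {u | ‖u‖ ≤ 1 ∧ tau (-a - b) u ≤ tau b u ∧ tau b u ≤ tau a u}

theorem tau_le_omega (u : ℂ) : tau 1 u ≤ tau 0 u ↔ 0 ≤ (omega * u).im := by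
  rw [← tau_one_le_tau_two, show (2 : Fin 3) = 1 + 1 from rfl, tau_omega_mul,
    show tau 1 (omega * u) = tau (0 + 1) (omega * u) from rfl, tau_omega_mul]

theorem mem_discChamber_zero_one {u : ℂ} :
    u ∈ discChamber 0 1 ↔ ‖u‖ ≤ 1 ∧ 0 ≤ u.im ∧ 0 ≤ (omega * u).im := by
  rw [← tau_le_omega, ← tau_one_le_tau_two]
  rfl

/-- The real locus of `u³` consists of the three symmetry axes, one for each factor. Together with
`im_sum` this determines the possible signs of the factors. -/
theorem im_cube (u : ℂ) :
    (u ^ 3).im = -4 * (u.im * (omega * u).im * (omega * (omega * u)).im) := by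
  have h := sqrt_three_mul_self
  simp [pow_succ]
  linear_combination (-u.re ^ 2 * u.im - √3 / 2 * u.re * u.im ^ 2 + u.im ^ 3 / 2) * h

theorem im_sum (u : ℂ) : u.im + (omega * u).im + (omega * (omega * u)).im = 0 := by
  have h : u + omega * u + omega * (omega * u) = 0 := by linear_combination u * omega_sq
  simpa using congrArg Complex.im h

/-- Cubing opens the sector of angle `π/3` to a half-disc. For surjectivity, the imaginary parts of
the three cube roots have sum `0` and, by `im_cube`, product at most `0`. Hence at most one is
negative, and the other two are cyclically adjacent. -/
theorem bijOn_cube : BijOn (fun u : ℂ => u ^ 3) (discChamber 0 1) {v | ‖v‖ ≤ 1 ∧ 0 ≤ v.im} := by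
  have h3 : omega * (omega * omega) = 1 := by linear_combination omega_cube
  refine ⟨?_, ?_, ?_⟩
  · intro u hu
    rw [mem_discChamber_zero_one] at hu
    refine ⟨by rw [norm_pow]; exact pow_le_one₀ (norm_nonneg _) hu.1, ?_⟩
    rw [im_cube]
    have := im_sum u
    have h2 : (omega * (omega * u)).im ≤ 0 := by linarith [hu.2.1, hu.2.2]
    have := mul_nonneg hu.2.1 hu.2.2
    nlinarith
  · intro u hu v hv h
    rw [mem_discChamber_zero_one] at hu hv
    have hzero : ∀ u : ℂ, 0 ≤ u.im → 0 ≤ (omega * u).im → 0 ≤ (omega * (omega * u)).im → u = 0 := by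
      intro u h1 h2 h3
      have := im_sum u
      have h4 : u.im = 0 := by linarith
      have h5 : (omega * u).im = 0 := by linarith
      have h6 : u.re = 0 := by
        simp [h4] at h5; exact h5
      exact Complex.ext h6 h4
    have hfac : (u - v) * (u - omega * v) * (u - omega * (omega * v)) = 0 := by
      simp only at h
      linear_combination h + (-u ^ 2 * v + u * v ^ 2 * omega) * omega_sq - v ^ 3 * omega_cube
    rcases mul_eq_zero.1 hfac with h1 | h1
    · rcases mul_eq_zero.1 h1 with h1 | h1
      · exact sub_eq_zero.1 h1
      · have h1 := sub_eq_zero.1 h1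
        have : v = 0 := hzero v hv.2.1 hv.2.2 (by rw [← h1]; exact hu.2.2)
        rw [h1, this, mul_zero]
    · have h1 := sub_eq_zero.1 h1
      have h2 : omega * u = v := by rw [h1]; linear_combination v * h3
      have : u = 0 := hzero u hu.2.1 hu.2.2 (by rw [h2]; exact hv.2.2)
      rw [← h2, this, mul_zero]
  · rintro w ⟨hw1, hw2⟩
    obtain ⟨u, hu⟩ := IsAlgClosed.exists_pow_nat_eq w (n := 3) (by norm_num)
    have hn : ‖u‖ ≤ 1 := by
      rw [← hu, norm_pow] at hw1
      exact (pow_le_one_iff_of_nonneg (norm_nonneg _) (by norm_num)).1 hw1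
    have hs := im_sum u
    have hp := im_cube u
    rw [hu] at hp
    have hc : (omega * u) ^ 3 = w := by rw [mul_pow, omega_cube, one_mul, hu]
    have hc' : (omega * (omega * u)) ^ 3 = w := by rw [mul_pow, omega_cube, one_mul, hc]
    have hback : omega * (omega * (omega * u)) = u := by linear_combination u * h3
    simp only [mem_image]
    by_cases h1 : 0 ≤ u.im <;> by_cases h2 : 0 ≤ (omega * u).im
    · exact ⟨u, mem_discChamber_zero_one.2 ⟨hn, h1, h2⟩, hu⟩
    · push Not at h2
      by_cases h3 : 0 ≤ (omega * (omega * u)).im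
      · exact ⟨_, mem_discChamber_zero_one.2 ⟨by simpa [norm_omega] using hn, h3,
          by rw [hback]; exact h1⟩, hc'⟩
      · push Not at h3
        have h4 : 0 < u.im := by linarith
        have := mul_pos h4 (mul_pos_of_neg_of_neg h2 h3)
        nlinarith
    · push Not at h1
      by_cases h3 : 0 ≤ (omega * (omega * u)).im
      · exact ⟨_, mem_discChamber_zero_one.2 ⟨by simpa [norm_omega] using hn, h2, h3⟩, hc⟩
      · push Not at h3
        have h4 : 0 < (omega * u).im := by linarith
        have := mul_pos h4 (mul_pos_of_neg_of_neg h1 h3)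
        nlinarith
    · push Not at h1 h2
      have h4 : 0 < (omega * (omega * u)).im := by linarith
      have := mul_pos h4 (mul_pos_of_neg_of_neg h1 h2)
      nlinarith

theorem bijOn_discBelyi_zero_one : BijOn discBelyi (discChamber 0 1) lowerHemisphere := by
  refine (bijOn_joukowsky.comp bijOn_cube).congr fun u _ => ?_
  simp only [Function.comp, discBelyi, discBelyiFinite, pow_eq_zero_iff (three_ne_zero)]

theorem bijOn_discChamber_omega (a b : Fin 3) :
    BijOn (fun u => omega * u) (discChamber a b) (discChamber (a + 1) (b + 1)) := by
  have hd : -(a + 1) - (b + 1) = (-a - b) + 1 := by revert a b; decide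
  refine ⟨?_, fun u _ v _ h => mul_left_cancel₀ omega_ne_zero h, ?_⟩
  · rintro u ⟨h1, h2, h3⟩
    refine ⟨by simpa [norm_omega] using h1, ?_, ?_⟩
    · rw [hd, tau_omega_mul, tau_omega_mul]; exact h2
    · rw [tau_omega_mul, tau_omega_mul]; exact h3
  · rintro u ⟨h1, h2, h3⟩
    have hu : omega * (omega ^ 2 * u) = u := by linear_combination u * omega_cube
    refine ⟨omega ^ 2 * u, ⟨by simpa [norm_omega] using h1, ?_, ?_⟩, hu⟩
    · rw [hd, ← hu, tau_omega_mul, tau_omega_mul] at h2; exact h2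
    · rw [← hu, tau_omega_mul, tau_omega_mul] at h3; exact h3

theorem bijOn_discBelyi_rotate {a b : Fin 3} {H : Set (OnePoint ℂ)}
    (h : BijOn discBelyi (discChamber a b) H) :
    BijOn discBelyi (discChamber (a + 1) (b + 1)) H := by
  -- Two further rotations serve as the inverse of the rotation by `omega`.
  have h1 := bijOn_discChamber_omega (a + 1) (b + 1)
  have h2 := (bijOn_discChamber_omega (a + 1 + 1) (b + 1 + 1))
  have h3 : ∀ a : Fin 3, a + 1 + 1 + 1 = a := by decide
  rw [h3, h3] at h2
  refine (h.comp (h2.comp h1)).congr fun u _ => ?_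
  simp only [Function.comp, discBelyi_omega_mul]

theorem bijOn_discBelyi_zero_two : BijOn discBelyi (discChamber 0 2) upperHemisphere := by
  have h : BijOn (starRingEnd ℂ) (discChamber 0 2) (discChamber 0 1) := by
    have e0 : ∀ u, tau 0 ((starRingEnd ℂ) u) = tau 0 u := fun u => by simp [tau]
    have e1 : ∀ u, tau 1 ((starRingEnd ℂ) u) = tau 2 u := fun u => by simp [tau, sub_eq_add_neg]
    have e2 : ∀ u, tau 2 ((starRingEnd ℂ) u) = tau 1 u := fun u => by simp [tau]
    refine ⟨?_, (RingHom.injective _).injOn, ?_⟩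
    · rintro u ⟨h1, h2, h3⟩
      refine ⟨by simpa using h1, ?_, ?_⟩
      · change tau 2 _ ≤ tau 1 _
        rw [e1, e2]; exact h2
      · rw [e1, e0]; exact h3
    · rintro u ⟨h1, h2, h3⟩
      refine ⟨(starRingEnd ℂ) u, ⟨by simpa using h1, ?_, ?_⟩, Complex.conj_conj u⟩
      · change tau 1 _ ≤ tau 2 _
        rw [e1, e2]; exact h2
      · rw [e2, e0]; exact h3
  refine ((bijOn_sphereConj.comp bijOn_discBelyi_zero_one).comp h).congr fun u _ => ?_
  simp only [Function.comp, discBelyi_conj, sphereConj_sphereConj]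

theorem bijOn_discBelyi_minus (i : Fin 3) :
    BijOn discBelyi (discChamber i (i + 1)) lowerHemisphere := by
  have h0 := bijOn_discBelyi_zero_one
  have h1 := bijOn_discBelyi_rotate h0
  have h2 := bijOn_discBelyi_rotate h1
  fin_cases i
  exacts [h0, h1, h2]

theorem bijOn_discBelyi_plus (i : Fin 3) :
    BijOn discBelyi (discChamber (i + 1) i) upperHemisphere := by
  have h2 := bijOn_discBelyi_zero_two
  have h0 := bijOn_discBelyi_rotate h2
  have h1 := bijOn_discBelyi_rotate h0
  fin_cases i
  exacts [h0, h1, h2]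

/-- The function on the triangle which maps the right triangles of the barycentric subdivision
conformally onto half-planes. -/
def triBelyi (z : ℂ) : OnePoint ℂ := discBelyi (triMap (toUnit z))

/-- `triBelyi` with finite values. -/
def triBelyiFinite (z : ℂ) : ℂ := discBelyiFinite (triMap (toUnit z))

theorem triMap_toUnit_eq_zero_iff {z : ℂ} (hz : z ∈ triangle) :
    triMap (toUnit z) = 0 ↔ z = center := by
  rw [triMap_eq_zero_iff (toUnit_mem_iff.2 hz), ← toUnit_center, toUnit_injective.eq_iff]

theorem triBelyi_of_ne {z : ℂ} (hz : z ∈ triangle) (h : z ≠ center) :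
    triBelyi z = (triBelyiFinite z : ℂ) :=
  discBelyi_of_ne fun h' => h ((triMap_toUnit_eq_zero_iff hz).1 h')

theorem triBelyi_center : triBelyi center = OnePoint.infty := by
  rw [triBelyi, toUnit_center, triMap_zero, discBelyi_zero]

theorem continuous_discBelyi : Continuous discBelyi := by
  rw [continuous_iff_continuousAt]
  intro u
  by_cases h : u = 0
  -- Near the pole the function is the inversion of its reciprocal, a rational function regular at
  -- `0`.
  · have h1 : ContinuousAt (fun u : ℂ =>
        inversion ((4 * u ^ 3 / (1 + u ^ 3) ^ 2 : ℂ) : OnePoint ℂ)) u := by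
      refine continuous_inversion.continuousAt.comp (OnePoint.continuous_coe.continuousAt.comp ?_)
      refine ContinuousAt.div (by fun_prop) (by fun_prop) ?_
      simp [h]
    refine h1.congr ?_
    have hev : ∀ᶠ v : ℂ in 𝓝 u, 1 + v ^ 3 ≠ 0 :=
      ContinuousAt.eventually_ne (by fun_prop) (by simp [h])
    filter_upwards [hev] with v hv
    by_cases hv0 : v = 0
    · simp [hv0, inversion_coe, discBelyi_zero]
    · have : 4 * v ^ 3 / (1 + v ^ 3) ^ 2 ≠ 0 := by
        refine div_ne_zero (mul_ne_zero (by norm_num) (pow_ne_zero _ hv0)) (pow_ne_zero _ hv)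
      rw [inversion_coe, if_neg this, discBelyi_of_ne hv0, discBelyiFinite, inv_div]
  · have h1 : ContinuousAt (fun u : ℂ => (discBelyiFinite u : OnePoint ℂ)) u := by
      refine OnePoint.continuous_coe.continuousAt.comp ?_
      unfold discBelyiFinite
      exact ContinuousAt.div (by fun_prop) (by fun_prop) (by simpa using h)
    refine h1.congr ?_
    filter_upwards [isOpen_ne.mem_nhds h] with v hv
    exact (discBelyi_of_ne hv).symm

theorem continuousOn_triBelyi : ContinuousOn triBelyi triangle :=
  continuous_discBelyi.comp_continuousOn (continuousOn_triMap.comp continuous_toUnit.continuousOn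
    fun _ hz => toUnit_mem_iff.2 hz)

/-- The derivative of `discBelyiFinite` is `3(u⁶ - 1) / (4u⁴)`. Its zeros lie on the unit circle,
which corresponds to the boundary of the triangle. -/
theorem hasDerivAt_triBelyiFinite {z : ℂ} (hz : z ∈ openTriangle) (hc : z ≠ center) :
    ∃ d ≠ 0, HasDerivAt triBelyiFinite d z := by
  have hu0 : triMap (toUnit z) ≠ 0 := fun h =>
    hc ((triMap_toUnit_eq_zero_iff (openTriangle_subset hz)).1 h)
  have hu1 := norm_triMap_lt (toUnit_mem_open_iff.2 hz)
  obtain ⟨d, hd, hd'⟩ := hasDerivAt_triMap (toUnit_mem_open_iff.2 hz)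
  have h1 : HasDerivAt toUnit (omega - 1) z :=
    (((hasDerivAt_id z).const_mul (omega - 1)).const_add 1).congr_deriv (mul_one _)
  set u := triMap (toUnit z) with hu
  have hn : ‖u ^ 6‖ ≠ 1 := by
    rw [norm_pow]
    exact (pow_lt_one₀ (norm_nonneg _) hu1 (by norm_num)).ne
  have h2 : HasDerivAt discBelyiFinite (3 * (u ^ 6 - 1) / (4 * u ^ 4)) u := by
    have a1 : HasDerivAt (fun u : ℂ => u ^ 3) (3 * u ^ 2) u := by simpa using hasDerivAt_pow 3 u
    have a2 := ((a1.const_add 1).pow 2).div (a1.const_mul 4)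
      (mul_ne_zero (by norm_num) (pow_ne_zero 3 hu0))
    refine a2.congr_deriv ?_
    rw [Pi.pow_apply]
    field_simp
    ring
  refine ⟨_, ?_, (h2.comp z (hd'.comp z h1))⟩
  refine mul_ne_zero (div_ne_zero (mul_ne_zero three_ne_zero ?_) (by simpa using hu0))
    (mul_ne_zero hd omega_sub_one_ne_zero)
  intro h
  rw [sub_eq_zero.1 h] at hn
  simp at hn

/-- The chambers are described by the order of the barycentric coordinates, which the disc map
preserves by symmetry. -/
theorem bijOn_triMap {a b : Fin 3} (hab : a ≠ b) :
    BijOn (fun z => triMap (toUnit z)) (chamber a b) (discChamber a b) := by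
  refine ⟨?_, ?_, ?_⟩
  · intro z hz
    have hy := toUnit_mem_iff.2 (chamber_subset_triangle hab hz)
    exact ⟨norm_triMap_le hy, (tau_triMap_le_iff hy _ _).2 hz.2.1, (tau_triMap_le_iff hy _ _).2 hz.2.2⟩
  · intro z hz w hw h
    have hy := toUnit_mem_iff.2 (chamber_subset_triangle hab hz)
    have hy' := toUnit_mem_iff.2 (chamber_subset_triangle hab hw)
    refine toUnit_injective ?_
    rw [← discMap_triMap hy, ← discMap_triMap hy']
    exact congrArg discMap h
  · rintro u ⟨h1, h2, h3⟩
    refine ⟨ofUnit (discMap u), ⟨?_, ?_, ?_⟩, ?_⟩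
    · rw [bary, toUnit_ofUnit]; exact discMap_mem_unitTriangle h1 _
    · rw [bary, bary, toUnit_ofUnit, tau_discMap_le_iff h1]; exact h2
    · rw [bary, bary, toUnit_ofUnit, tau_discMap_le_iff h1]; exact h3
    · simp only [toUnit_ofUnit, triMap_discMap h1]

theorem bijOn_triBelyi_plus (i : Fin 3) : BijOn triBelyi (plusTriangle i) upperHemisphere := by
  rw [plusTriangle_eq]
  exact (bijOn_discBelyi_plus i).comp (bijOn_triMap (by revert i; decide))

theorem bijOn_triBelyi_minus (i : Fin 3) : BijOn triBelyi (minusTriangle i) lowerHemisphere := by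
  rw [minusTriangle_eq]
  exact (bijOn_discBelyi_minus i).comp (bijOn_triMap (by revert i; decide))

theorem discBelyi_mem_equator_iff {u : ℂ} : discBelyi u ∈ equator ↔
    ‖u‖ = 1 ∨ ∃ j : Fin 3, tau (j + 1) u = tau (j + 2) u := by
  have hex : (∃ j : Fin 3, tau (j + 1) u = tau (j + 2) u) ↔ (u ^ 3).im = 0 := by
    have h12 : ∀ u, tau 1 u = tau 2 u ↔ u.im = 0 := by
      intro u
      rw [← sub_eq_zero, tau_one_sub_tau_two, mul_eq_zero_iff_left (by positivity)]
    have h01 : tau 0 u = tau 1 u ↔ (omega * u).im = 0 := by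
      rw [← h12, ← tau_omega_mul, ← tau_omega_mul 1]; rfl
    have h20 : tau 2 u = tau 0 u ↔ (omega * (omega * u)).im = 0 := by
      rw [← h12, ← tau_omega_mul, ← tau_omega_mul 0, ← tau_omega_mul, ← tau_omega_mul (0 + 1)]; rfl
    rw [im_cube, Fin.exists_fin_succ, Fin.exists_fin_two]
    change tau 1 u = tau 2 u ∨ tau 2 u = tau 0 u ∨ tau 0 u = tau 1 u ↔ _
    rw [h12, h01, h20]
    simp only [mul_eq_zero, neg_eq_zero]
    norm_num
    tauto
  rw [hex]
  by_cases h : u = 0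
  · simp [h, discBelyi_zero, infty_mem_equator]
  · rw [discBelyi_of_ne h, coe_mem_equator, discBelyiFinite, im_joukowsky (pow_ne_zero 3 h)]
    have h1 : Complex.normSq (u ^ 3) = 1 ↔ ‖u‖ = 1 := by
      rw [Complex.normSq_eq_norm_sq, norm_pow, ← pow_mul]
      exact pow_eq_one_iff_of_nonneg (norm_nonneg _) (by norm_num)
    rw [← h1, div_eq_zero_iff, mul_eq_zero, sub_eq_zero, eq_comm (a := (1 : ℝ)), inv_eq_one]
    norm_num
    tauto

/-- The points of the triangle which `triBelyi` maps to the equator are those on the edges and the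
medians. -/
theorem triBelyi_mem_equator_iff {z : ℂ} (hz : z ∈ triangle) : triBelyi z ∈ equator ↔
    (∃ j, bary j z = 0) ∨ ∃ j : Fin 3, bary (j + 1) z = bary (j + 2) z := by
  have hy := toUnit_mem_iff.2 hz
  rw [triBelyi, discBelyi_mem_equator_iff]
  refine or_congr ?_ ?_
  · refine ⟨fun h => ?_, fun h => norm_triMap_eq hy h⟩
    by_contra! hc
    refine (norm_triMap_lt (y := toUnit z) fun j => ?_).ne h
    exact lt_of_le_of_ne (hy j) (hc j).symm
  · simp only [le_antisymm_iff, tau_triMap_le_iff hy]; rfl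

theorem triBelyi_mem_equator_iff_of_mem {a b : Fin 3} (hab : a ≠ b) {z : ℂ} (hz : z ∈ chamber a b) :
    triBelyi z ∈ equator ↔ z ∈ frontier (chamber a b) := by
  rw [triBelyi_mem_equator_iff (chamber_subset_triangle hab hz), mem_frontier_chamber_iff hab hz]
  obtain ⟨h1, h2, h3⟩ := hz
  constructor
  · rintro (⟨j, hj⟩ | ⟨j, hj⟩)
    · left
      have : j = a ∨ j = b ∨ j = -a - b := by clear h1 h2 h3 hj; revert a b j; decide
      rcases this with rfl | rfl | rfl <;> linarith
    · have : (j + 1 = a ∧ j + 2 = b) ∨ (j + 1 = b ∧ j + 2 = a) ∨ (j + 1 = a ∧ j + 2 = -a - b) ∨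
        (j + 1 = -a - b ∧ j + 2 = a) ∨ (j + 1 = b ∧ j + 2 = -a - b) ∨
        (j + 1 = -a - b ∧ j + 2 = b) := by clear h1 h2 h3 hj; revert a b j; decide
      right
      rcases this with ⟨e1, e2⟩ | ⟨e1, e2⟩ | ⟨e1, e2⟩ | ⟨e1, e2⟩ | ⟨e1, e2⟩ | ⟨e1, e2⟩ <;>
        rw [e1, e2] at hj
      · exact Or.inr hj.symm
      · exact Or.inr hj
      · exact Or.inl (by linarith)
      · exact Or.inl (by linarith)
      · exact Or.inl hj.symm
      · exact Or.inl hj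
  · have hex : ∀ c d : Fin 3, c ≠ d → bary c z = bary d z →
        ∃ j : Fin 3, bary (j + 1) z = bary (j + 2) z := by
      intro c d hcd h
      have : ∃ j : Fin 3, (j + 1 = c ∧ j + 2 = d) ∨ (j + 1 = d ∧ j + 2 = c) := by
        clear h; revert c d; decide
      obtain ⟨j, ⟨e1, e2⟩ | ⟨e1, e2⟩⟩ := this
      · exact ⟨j, by rw [e1, e2, h]⟩
      · exact ⟨j, by rw [e1, e2, h]⟩
    rintro (h | h | h)
    · exact Or.inl ⟨_, h⟩
    · exact Or.inr (hex _ _ (third_ne hab).2 h)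
    · exact Or.inr (hex _ _ hab.symm h)

end

end Equilateral

/-! ### Values of the Belyi function on the sides -/

namespace Equilateral

open SchwarzChristoffel Set RiemannSphere

noncomputable section

theorem sidePoint_eq (i : Fin 3) (s : ℝ) :
    sidePoint i s = ((1 - s : ℝ) : ℂ) * corner i + (s : ℂ) * corner (i + 1) := by
  rw [sidePoint, AffineMap.lineMap_apply_module, Complex.real_smul, Complex.real_smul]

theorem bary_sidePoint (i j : Fin 3) (s : ℝ) :
    bary j (sidePoint i s) = (1 - s) * (if j = i then 1 else 0) + s * if j = i + 1 then 1 else 0 := by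
  rw [sidePoint_eq, bary_combo _ _ _ (by ring), bary_corner, bary_corner]

theorem fin_three_facts (i : Fin 3) : i ≠ i + 1 ∧ i + 1 ≠ i ∧ i + 2 ≠ i ∧ i + 2 ≠ i + 1 ∧
    i ≠ i + 2 ∧ i + 1 ≠ i + 2 ∧ -i - (i + 1) = i + 2 ∧ -(i + 1) - i = i + 2 := by
  revert i; decide

theorem bary_sidePoint_zero (i : Fin 3) (s : ℝ) : bary i (sidePoint i s) = 1 - s := by
  rw [bary_sidePoint]; simp [fin_three_facts i]

theorem bary_sidePoint_one (i : Fin 3) (s : ℝ) : bary (i + 1) (sidePoint i s) = s := by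
  rw [bary_sidePoint]; simp

theorem bary_sidePoint_two (i : Fin 3) (s : ℝ) : bary (i + 2) (sidePoint i s) = 0 := by
  rw [bary_sidePoint]; simp [fin_three_facts i]

theorem forall_fin_three_add (i : Fin 3) {p : Fin 3 → Prop} :
    (∀ j, p j) ↔ p i ∧ p (i + 1) ∧ p (i + 2) := by
  obtain ⟨h1, -, -, -, -, -, h2, -⟩ := fin_three_facts i
  rw [forall_fin_three h1, h2]

theorem bary_sum_add (i : Fin 3) (z : ℂ) : bary i z + bary (i + 1) z + bary (i + 2) z = 1 := by
  obtain ⟨h1, -, -, -, -, -, h2, -⟩ := fin_three_facts i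
  rw [← h2, bary_sum' h1]

theorem sidePoint_mem (i : Fin 3) {s : ℝ} (hs : s ∈ Icc (0 : ℝ) 1) : sidePoint i s ∈ triangle := by
  rw [mem_triangle_iff, forall_fin_three_add i, bary_sidePoint_zero, bary_sidePoint_one,
    bary_sidePoint_two]
  exact ⟨by linarith [hs.2], hs.1, le_rfl⟩

theorem eq_sidePoint {i : Fin 3} {z : ℂ} (h : bary (i + 2) z = 0) :
    z = sidePoint i (bary (i + 1) z) := by
  refine bary_ext ?_
  rw [forall_fin_three_add i, bary_sidePoint_zero, bary_sidePoint_one, bary_sidePoint_two]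
  exact ⟨by linarith [bary_sum_add i z], rfl, h⟩

theorem mid_eq (i : Fin 3) : mid i = sidePoint i (1 / 2) := by
  rw [mid, sidePoint_eq, midpoint_eq_smul_add, Complex.real_smul]; push_cast [invOf_eq_inv]; ring

theorem corner_eq_sidePoint (i : Fin 3) : corner i = sidePoint i 0 := by
  rw [sidePoint_eq]; simp

theorem corner_add_one_eq_sidePoint (i : Fin 3) : corner (i + 1) = sidePoint i 1 := by
  rw [sidePoint_eq]; simp

theorem toUnit_sidePoint (i : Fin 3) (s : ℝ) :
    toUnit (sidePoint i s) = omega ^ (i : ℕ) * ((1 - s : ℝ) + s * omega) := by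
  rw [sidePoint_eq, toUnit_combo _ _ (by ring), toUnit_corner, toUnit_corner]
  have : omega ^ ((i + 1 : Fin 3) : ℕ) = omega ^ (i : ℕ) * omega := by
    fin_cases i
    · simp
    · simp [sq]
    · simp [← pow_succ, omega_cube]
  rw [this]; ring

theorem toUnit_sidePoint_zero_mem {s : ℝ} (hs : s ∈ Icc (0 : ℝ) 1) :
    ((1 - s : ℝ) : ℂ) + s * omega ∈ unitTriangle := by
  have := toUnit_mem_iff.2 (sidePoint_mem 0 hs)
  rw [toUnit_sidePoint] at this
  simpa using this

theorem discBelyi_triMap_omega_pow_mul (k : ℕ) {y : ℂ} (hy : y ∈ unitTriangle) :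
    discBelyi (triMap (omega ^ k * y)) = discBelyi (triMap y) ∧ omega ^ k * y ∈ unitTriangle := by
  induction k with
  | zero => simpa using hy
  | succ k ih =>
    rw [pow_succ', mul_assoc, triMap_omega_mul ih.2, discBelyi_omega_mul, ih.1]
    exact ⟨rfl, omega_mul_mem_unitTriangle ih.2⟩

theorem triBelyi_sidePoint (i : Fin 3) {s : ℝ} (hs : s ∈ Icc (0 : ℝ) 1) :
    triBelyi (sidePoint i s) = discBelyi (triMap ((1 - s : ℝ) + s * omega)) := by
  rw [triBelyi, toUnit_sidePoint]
  exact (discBelyi_triMap_omega_pow_mul _ (toUnit_sidePoint_zero_mem hs)).1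

theorem norm_triMap_sidePoint {s : ℝ} (hs : s ∈ Icc (0 : ℝ) 1) :
    ‖triMap ((1 - s : ℝ) + s * omega)‖ = 1 := by
  refine norm_triMap_eq (toUnit_sidePoint_zero_mem hs) ⟨2, ?_⟩
  have h : (((1 - s : ℝ) : ℂ) + s * omega) = toUnit (sidePoint 0 s) := by
    rw [toUnit_sidePoint]; simp
  rw [h]
  exact bary_sidePoint_two 0 s

theorem sphereConj_of_mem_equator {p : OnePoint ℂ} (hp : p ∈ equator) : sphereConj p = p := by
  induction p using OnePoint.rec with
  | infty => rfl
  | coe z => rw [sphereConj_coe, Complex.conj_eq_iff_im.2 (coe_mem_equator.1 hp)]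

/-- The reflection `y ↦ omega * conj y` reverses the side from `1` to `omega`, and `triMap` commutes
with it. -/
theorem triMap_sidePoint_symm {s : ℝ} (hs : s ∈ Icc (0 : ℝ) 1) :
    triMap ((1 - (1 - s) : ℝ) + (1 - s : ℝ) * omega) =
      omega * (starRingEnd ℂ) (triMap ((1 - s : ℝ) + s * omega)) := by
  have h := toUnit_sidePoint_zero_mem hs
  have hc : (starRingEnd ℂ) (((1 - s : ℝ) : ℂ) + s * omega) ∈ unitTriangle := by
    have := discMap_mem_unitTriangle (u := (starRingEnd ℂ) (triMap ((1 - s : ℝ) + s * omega)))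
      (by simpa using norm_triMap_le h)
    rwa [discMap_conj (norm_triMap_le h), discMap_triMap h] at this
  rw [← triMap_conj h, ← triMap_omega_mul hc]
  congr 1
  have : (starRingEnd ℂ) omega = omega ^ 2 := by
    rw [omega_sq]
    apply Complex.ext <;> simp
    norm_num
  simp only [map_add, map_mul, Complex.conj_ofReal, this]
  push_cast
  linear_combination (-s : ℂ) * omega_cube

/-- Invariance under `omega` identifies the three sides. Reversing a side conjugates the value,
which changes nothing because the value lies on the equator. This is the compatibility with the
gluing. -/
theorem triBelyi_sidePoint_symm (i j : Fin 3) {s : ℝ} (hs : s ∈ Icc (0 : ℝ) 1) :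
    triBelyi (sidePoint i s) = triBelyi (sidePoint j (1 - s)) := by
  have hs' : 1 - s ∈ Icc (0 : ℝ) 1 := ⟨by linarith [hs.2], by linarith [hs.1]⟩
  rw [triBelyi_sidePoint i hs, triBelyi_sidePoint j hs', triMap_sidePoint_symm hs,
    discBelyi_omega_mul, discBelyi_conj, sphereConj_of_mem_equator]
  exact discBelyi_mem_equator_iff.2 (Or.inl (norm_triMap_sidePoint hs))

theorem triBelyi_corner (i : Fin 3) : triBelyi (corner i) = ((1 : ℂ) : OnePoint ℂ) := by
  rw [corner_eq_sidePoint, triBelyi_sidePoint i (by simp)]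
  simp [triMap_one, discBelyi_of_ne, discBelyiFinite]
  norm_num

theorem triBelyi_mid (i : Fin 3) : triBelyi (mid i) = ((0 : ℂ) : OnePoint ℂ) := by
  have hm : (1 / 2 : ℝ) ∈ Icc (0 : ℝ) 1 := by norm_num
  have h12 : (1 - (1 - 1 / 2) : ℝ) = 1 - 1 / 2 := by norm_num
  have h22 : (1 - 1 / 2 : ℝ) = 1 / 2 := by norm_num
  rw [mid_eq, triBelyi_sidePoint i hm]
  have h := triMap_sidePoint_symm hm
  have hn := norm_triMap_sidePoint hm
  have hmem := toUnit_sidePoint_zero_mem hm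
  rw [h12, h22] at h
  rw [h22] at hn hmem ⊢
  set y : ℂ := ((1 / 2 : ℝ) : ℂ) + ((1 / 2 : ℝ) : ℂ) * omega with hy
  set u := triMap y with hu
  have h1 : u * (starRingEnd ℂ) u = 1 := by
    rw [Complex.mul_conj, Complex.normSq_eq_norm_sq, hn]; norm_num
  -- Symmetry of the midpoint gives `u = omega * conj u`, so `u² = omega` on the unit circle. The
  -- root `omega ^ 2` belongs to a corner, so `u = -omega ^ 2` and `u³ = -1`, a zero of the Belyi
  -- function.
  have h2 : (u - omega ^ 2) * (u + omega ^ 2) = 0 := by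
    linear_combination u * h + omega * h1 - omega * omega_cube
  have hu0 : u ≠ 0 := left_ne_zero_of_mul_eq_one h1
  rcases mul_eq_zero.1 h2 with h3 | h3
  · exfalso
    have h4 : y = omega ^ 2 := by
      have h5 := discMap_omega_pow_mul 2 1
      rw [mul_one, discMap_one, mul_one] at h5
      rw [← discMap_triMap hmem, ← h5, ← sub_eq_zero.1 h3]
    have := congrArg Complex.im h4
    rw [hy, omega_sq] at this
    simp at this
    have := sqrt_three_pos
    linarith
  · rw [discBelyi_of_ne hu0, discBelyiFinite, eq_neg_of_add_eq_zero_left h3]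
    have : 1 + (-omega ^ 2) ^ 3 = 0 := by
      linear_combination (-omega ^ 3 - 1) * omega_cube
    simp [this]

theorem differentiableAt_triBelyiFinite {z : ℂ} (hz : z ∈ openTriangle) (hc : z ≠ center) :
    DifferentiableAt ℂ triBelyiFinite z := by
  obtain ⟨d, -, hd⟩ := hasDerivAt_triBelyiFinite hz hc
  exact hd.differentiableAt

theorem bijOn_frontier_chamber {a b : Fin 3} (hab : a ≠ b) {H : Set (OnePoint ℂ)}
    (h : BijOn triBelyi (chamber a b) H) (hH : equator ⊆ H) :
    BijOn triBelyi (frontier (chamber a b)) equator := by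
  have hs : frontier (chamber a b) ⊆ chamber a b := (isClosed_chamber a b).frontier_subset
  refine ⟨fun z hz => (triBelyi_mem_equator_iff_of_mem hab (hs hz)).2 hz, h.injOn.mono hs, ?_⟩
  intro p hp
  obtain ⟨z, hz, rfl⟩ := h.surjOn (hH hp)
  exact ⟨z, (triBelyi_mem_equator_iff_of_mem hab hz).1 hp, rfl⟩

theorem ne_center_of_mem_interior_chamber {a b : Fin 3} (hab : a ≠ b) {z : ℂ}
    (hz : z ∈ interior (chamber a b)) : z ≠ center := by
  rintro rfl
  rw [interior_chamber hab] at hz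
  have := hz.2.1
  rw [bary_center, bary_center] at this
  exact lt_irrefl _ this

theorem triBelyi_of_mem_interior_chamber {a b : Fin 3} (hab : a ≠ b) {z : ℂ}
    (hz : z ∈ interior (chamber a b)) : triBelyi z = (triBelyiFinite z : ℂ) :=
  triBelyi_of_ne (openTriangle_subset (interior_chamber_subset hab hz))
    (ne_center_of_mem_interior_chamber hab hz)

theorem differentiableOn_interior_chamber {a b : Fin 3} (hab : a ≠ b) :
    DifferentiableOn ℂ triBelyiFinite (interior (chamber a b)) := fun _ hz =>
  (differentiableAt_triBelyiFinite (interior_chamber_subset hab hz)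
    (ne_center_of_mem_interior_chamber hab hz)).differentiableWithinAt

theorem bijOn_interior_chamber {a b : Fin 3} (hab : a ≠ b) {H : Set (OnePoint ℂ)}
    (h : BijOn triBelyi (chamber a b) H) :
    BijOn triBelyiFinite (interior (chamber a b)) {w | (w : OnePoint ℂ) ∈ H ∧ w.im ≠ 0} := by
  have key : ∀ z ∈ chamber a b, z ∈ interior (chamber a b) ↔ triBelyi z ∉ equator := by
    intro z hz
    rw [triBelyi_mem_equator_iff_of_mem hab hz, (isClosed_chamber a b).frontier_eq]
    simp [hz]
  refine ⟨?_, ?_, ?_⟩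
  · intro z hz
    have h1 := interior_subset hz
    have h2 := h.mapsTo h1
    have h3 := (key z h1).1 hz
    rw [triBelyi_of_mem_interior_chamber hab hz] at h2 h3
    exact ⟨h2, fun h4 => h3 (coe_mem_equator.2 h4)⟩
  · intro z hz w hw hzw
    refine h.injOn (interior_subset hz) (interior_subset hw) ?_
    rw [triBelyi_of_mem_interior_chamber hab hz, triBelyi_of_mem_interior_chamber hab hw, hzw]
  · rintro w ⟨hw, hw'⟩
    obtain ⟨z, hz, hzw⟩ := h.surjOn hw
    have hzi := (key z hz).2 (by rw [hzw]; exact fun h4 => hw' (coe_mem_equator.1 h4))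
    refine ⟨z, hzi, ?_⟩
    rw [triBelyi_of_mem_interior_chamber hab hzi] at hzw
    exact OnePoint.coe_injective hzw

end

end Equilateral

/-! ### The Belyi function of a polyhedron -/

namespace TriangleGluing

open Equilateral Set RiemannSphere

noncomputable section

variable {G : TriangleGluing}

theorem Ident.symm {p q : Σ _ : G.Face, triangle} (h : G.Ident p q) : G.Ident q p := by
  obtain ⟨i, s, hs, h1, h2, h3⟩ := h
  refine ⟨(G.glue (p.1, i)).2, 1 - s, ⟨by linarith [hs.2], by linarith [hs.1]⟩, h3, ?_, ?_⟩
  · rw [h2, Prod.mk.eta, G.glue_glue]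
  · rw [h2, Prod.mk.eta, G.glue_glue, sub_sub_cancel]; exact h1

/-- A set of points of the faces which respects the gluing contains all points identified with one
of its members. -/
theorem mem_of_mk_eq {Q : Set (Σ _ : G.Face, triangle)} (hQ : ∀ p q, G.Ident p q → p ∈ Q → q ∈ Q)
    {p q : Σ _ : G.Face, triangle} (h : Quot.mk G.Ident p = Quot.mk G.Ident q) (hp : p ∈ Q) :
    q ∈ Q := by
  have : ∀ p q, Relation.EqvGen G.Ident p q → (p ∈ Q ↔ q ∈ Q) := by
    intro p q h
    induction h with
    | rel p q h => exact ⟨hQ p q h, hQ q p h.symm⟩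
    | refl p => exact Iff.rfl
    | symm p q _ ih => exact ih.symm
    | trans p q r _ _ ih1 ih2 => exact ih1.trans ih2
  exact (this p q (Quot.eqvGen_exact h)).1 hp

theorem isOpen_image_mk {Q : Set (Σ _ : G.Face, triangle)}
    (hQ : ∀ p q, G.Ident p q → p ∈ Q → q ∈ Q) (ho : IsOpen Q) :
    IsOpen (Quot.mk G.Ident '' Q : Set G.Polyhedron) := by
  have : IsOpen (Quot.mk G.Ident ⁻¹' (Quot.mk G.Ident '' Q)) := by
    convert ho using 1
    ext q
    constructor
    · rintro ⟨p, hp, hpq⟩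
      exact mem_of_mk_eq hQ hpq hp
    · exact fun hq => ⟨q, hq, rfl⟩
  exact this

theorem continuous_pt (f : G.Face) : Continuous (G.pt f) :=
  continuous_quot_mk.comp continuous_sigmaMk

theorem exists_pt_eq (p : G.Polyhedron) : ∃ f z, G.pt f z = p := by
  induction p using Quot.ind with
  | mk p => exact ⟨p.1, p.2, rfl⟩

theorem pt_sidePoint (c : G.Face × Fin 3) {s : ℝ} (hs : s ∈ Icc (0 : ℝ) 1) (z w : triangle)
    (hz : (z : ℂ) = sidePoint c.2 s) (hw : (w : ℂ) = sidePoint (G.glue c).2 (1 - s)) :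
    G.pt c.1 z = G.pt (G.glue c).1 w :=
  Quot.sound ⟨c.2, s, hs, hz, rfl, hw⟩

variable (G) in
/-- The Belyi function of the polyhedron which is conformal on the right triangles of the
barycentric subdivision. -/
def belyi : G.Polyhedron → OnePoint ℂ :=
  Quot.lift (fun p => triBelyi p.2) (by
    rintro p q ⟨i, s, hs, h1, h2, h3⟩
    rw [h1, h3]
    exact triBelyi_sidePoint_symm _ _ hs)

theorem belyi_pt (f : G.Face) (z : triangle) : G.belyi (G.pt f z) = triBelyi z := rfl

theorem continuous_belyi : Continuous G.belyi := by
  refine continuous_quot_lift _ (continuous_sigma fun f => ?_)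
  exact continuousOn_iff_continuous_domRestrict.1 continuousOn_triBelyi

theorem bijOn_belyi_pt (f : G.Face) {S : Set ℂ} (hS : S ⊆ triangle) {H : Set (OnePoint ℂ)}
    (h : BijOn triBelyi S H) :
    BijOn (fun z : triangle => G.belyi (G.pt f z)) (Subtype.val ⁻¹' S) H := by
  refine ⟨fun z hz => h.mapsTo hz, fun z hz w hw hzw => Subtype.ext (h.injOn hz hw hzw), ?_⟩
  intro p hp
  obtain ⟨z, hz, rfl⟩ := h.surjOn hp
  exact ⟨⟨z, hS hz⟩, hz, rfl⟩

theorem plusTriangle_subset (i : Fin 3) : plusTriangle i ⊆ triangle := by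
  rw [plusTriangle_eq]; exact chamber_subset_triangle (fin_three_facts i).2.1

theorem minusTriangle_subset (i : Fin 3) : minusTriangle i ⊆ triangle := by
  rw [minusTriangle_eq]; exact chamber_subset_triangle (fin_three_facts i).1

theorem isBelyiMap_belyi : IsBelyiMap G.belyi where
  continuous := continuous_belyi
  white f i := triBelyi_mid i
  black f i := triBelyi_corner i
  star f := triBelyi_center
  plus f i := bijOn_belyi_pt f (plusTriangle_subset i) (bijOn_triBelyi_plus i)
  minus f i := bijOn_belyi_pt f (minusTriangle_subset i) (bijOn_triBelyi_minus i)
  plus_boundary f i := by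
    have h := bijOn_triBelyi_plus i
    have hs := plusTriangle_subset i
    rw [plusTriangle_eq] at h hs ⊢
    exact bijOn_belyi_pt f ((isClosed_chamber _ _).frontier_subset.trans hs)
      (bijOn_frontier_chamber (fin_three_facts i).2.1 h equator_subset_upperHemisphere)
  minus_boundary f i := by
    have h := bijOn_triBelyi_minus i
    have hs := minusTriangle_subset i
    rw [minusTriangle_eq] at h hs ⊢
    exact bijOn_belyi_pt f ((isClosed_chamber _ _).frontier_subset.trans hs)
      (bijOn_frontier_chamber (fin_three_facts i).1 h equator_subset_lowerHemisphere)

theorem isConformalOnRightTriangles_belyi : IsConformalOnRightTriangles G.belyi := by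
  intro f i
  constructor
  · have h := bijOn_triBelyi_plus i
    rw [plusTriangle_eq] at h ⊢
    have hne := (fin_three_facts i).2.1
    refine ⟨triBelyiFinite, differentiableOn_interior_chamber hne, ?_,
      fun z hz => triBelyi_of_mem_interior_chamber hne hz⟩
    convert bijOn_interior_chamber hne h using 1
    ext w
    simp only [mem_ofPred_eq, coe_mem_upperHemisphere]
    exact ⟨fun h => ⟨h.le, h.ne'⟩, fun h => lt_of_le_of_ne h.1 h.2.symm⟩
  · have h := bijOn_triBelyi_minus i
    rw [minusTriangle_eq] at h ⊢
    have hne := (fin_three_facts i).1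
    refine ⟨triBelyiFinite, differentiableOn_interior_chamber hne, ?_,
      fun z hz => triBelyi_of_mem_interior_chamber hne hz⟩
    convert bijOn_interior_chamber hne h using 1
    ext w
    simp only [mem_ofPred_eq, coe_mem_lowerHemisphere]
    exact ⟨fun h => ⟨h.le, h.ne⟩, fun h => lt_of_le_of_ne h.1 h.2⟩

end

end TriangleGluing

/-- Turns an open parametrization into a chart; the Euclidean charts of faces and edges arise as
inverses of explicit maps from plane sets. -/
theorem exists_openPartialHomeomorph_of_injOn {A B : Type*} [TopologicalSpace A]
    [TopologicalSpace B] [Nonempty A] {s : Set A} {f : A → B} (hs : IsOpen s)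
    (hc : ContinuousOn f s) (hi : Set.InjOn f s) (ho : ∀ t ⊆ s, IsOpen t → IsOpen (f '' t)) :
    ∃ e : OpenPartialHomeomorph B A, e.source = f '' s ∧ e.target = s ∧
      (∀ x ∈ s, e (f x) = x) ∧ ∀ x, e.symm x = f x := by
  let e₀ := hi.toPartialEquiv f s
  have hopen : IsOpenMap (e₀.source.domRestrict e₀) := by
    intro t ht
    have h1 : (e₀.source.domRestrict e₀) '' t = f '' (Subtype.val '' t) := by
      rw [Set.image_image]; rfl
    rw [h1]
    refine ho _ ?_ (hs.isOpenMap_subtype_val t ht)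
    rintro _ ⟨x, -, rfl⟩
    exact x.2
  let e := OpenPartialHomeomorph.ofContinuousOpenRestrict e₀ hc hopen hs
  exact ⟨e.symm, rfl, rfl, fun x hx => e.left_inv hx, fun x => rfl⟩

/-! ### Sector coordinates and the rhombus around a side -/

namespace Equilateral

open SchwarzChristoffel Set

noncomputable section

open Classical in
/-- A retraction of the plane (as a set) to the triangle. -/
def toTriangle (z : ℂ) : triangle := if h : z ∈ triangle then ⟨z, h⟩ else ⟨center, center_mem⟩

theorem toTriangle_of_mem {z : ℂ} (h : z ∈ triangle) : toTriangle z = ⟨z, h⟩ := dif_pos h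

theorem toTriangle_coe (z : triangle) : toTriangle z = z := toTriangle_of_mem z.2

theorem continuousOn_toTriangle : ContinuousOn toTriangle triangle := by
  rw [continuousOn_iff_continuous_domRestrict]
  refine continuous_id.congr fun z => (toTriangle_coe z).symm

theorem corner_succ_sub_ne_zero (i : Fin 3) : corner (i + 1) - corner i ≠ 0 := by
  intro h
  have h1 := bary_corner i i
  rw [← sub_eq_zero.1 h, bary_corner] at h1
  simp [fin_three_facts i] at h1

/-- The factor `-omega ^ 2` is `exp (iπ/3)`, the rotation through the angle of a corner. -/
theorem corner_add_two_sub (i : Fin 3) :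
    corner (i + 2) - corner i = -omega ^ 2 * (corner (i + 1) - corner i) := by
  fin_cases i
  · change corner 2 - corner 0 = -omega ^ 2 * (corner 1 - corner 0)
    rw [corner_zero, corner_one, corner_two]; ring
  · change corner 0 - corner 1 = -omega ^ 2 * (corner 2 - corner 1)
    rw [corner_zero, corner_one, corner_two]
    linear_combination (-omega) * omega_cube - omega_sq
  · change corner 1 - corner 2 = -omega ^ 2 * (corner 0 - corner 2)
    rw [corner_zero, corner_one, corner_two]
    linear_combination omega * omega_cube + omega_sq

theorem norm_corner_succ_sub (i : Fin 3) : ‖corner (i + 1) - corner i‖ = 1 := by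
  have h2 : ‖-omega ^ 2‖ = 1 := by rw [norm_neg, norm_pow, norm_omega, one_pow]
  have h := corner_add_two_sub
  fin_cases i
  · change ‖corner 1 - corner 0‖ = 1
    simp [corner_zero, corner_one]
  · change ‖corner 2 - corner 1‖ = 1
    have h1 : corner 2 - corner 1 = omega := by
      rw [corner_one, corner_two, omega_sq]; ring
    rw [h1, norm_omega]
  · change ‖corner 0 - corner 2‖ = 1
    rw [corner_zero, corner_two, zero_sub, neg_neg, norm_pow, norm_omega, one_pow]

theorem sectorCoord_eq (i : Fin 3) (z : ℂ) :
    sectorCoord i z = bary (i + 1) z + bary (i + 2) z * (-omega ^ 2) := by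
  rw [sectorCoord, div_eq_iff (corner_succ_sub_ne_zero i)]
  have h1 : z = bary i z * corner i + bary (i + 1) z * corner (i + 1) +
      bary (i + 2) z * corner (i + 2) := by
    obtain ⟨h1, -, -, -, -, -, h2, -⟩ := fin_three_facts i
    rw [← h2, add_third (fun j => (bary j z : ℂ) * corner j) h1, ← eq_sum_bary]
  have h2 : (bary i z : ℂ) + bary (i + 1) z + bary (i + 2) z = 1 := by
    exact_mod_cast bary_sum_add i z
  linear_combination h1 + bary (i + 2) z * corner_add_two_sub i + corner i * h2

theorem sectorCoord_re (i : Fin 3) (z : ℂ) :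
    (sectorCoord i z).re = bary (i + 1) z + bary (i + 2) z / 2 := by
  rw [sectorCoord_eq, omega_sq]; simp; ring

theorem sectorCoord_im (i : Fin 3) (z : ℂ) :
    (sectorCoord i z).im = √3 / 2 * bary (i + 2) z := by
  rw [sectorCoord_eq, omega_sq]; simp; ring

/-- The inverse of `sectorCoord i`. -/
def sectorPoint (i : Fin 3) (w : ℂ) : ℂ := corner i + w * (corner (i + 1) - corner i)

theorem sectorCoord_sectorPoint (i : Fin 3) (w : ℂ) : sectorCoord i (sectorPoint i w) = w := by
  rw [sectorCoord, sectorPoint, add_sub_cancel_left, mul_div_cancel_right₀ _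
    (corner_succ_sub_ne_zero i)]

theorem sectorPoint_sectorCoord (i : Fin 3) (z : ℂ) : sectorPoint i (sectorCoord i z) = z := by
  rw [sectorCoord, sectorPoint, div_mul_cancel₀ _ (corner_succ_sub_ne_zero i)]; ring

theorem sectorPoint_ofReal (i : Fin 3) (s : ℝ) : sectorPoint i s = sidePoint i s := by
  rw [sectorPoint, sidePoint_eq]; push_cast; ring

theorem sectorCoord_sidePoint (i : Fin 3) (s : ℝ) : sectorCoord i (sidePoint i s) = s := by
  rw [← sectorPoint_ofReal, sectorCoord_sectorPoint]

theorem continuous_sectorCoord (i : Fin 3) : Continuous (sectorCoord i) := by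
  unfold sectorCoord; fun_prop

theorem continuous_sectorPoint (i : Fin 3) : Continuous (sectorPoint i) := by
  unfold sectorPoint; fun_prop

theorem sectorCoord_affine (i : Fin 3) (z : ℂ) : sectorCoord i z =
    (corner (i + 1) - corner i)⁻¹ * z + -(corner i / (corner (i + 1) - corner i)) := by
  rw [sectorCoord]; ring

/-- The open rhombus with two vertices at `0` and `1` and angles `π/3` there. -/
def kite : Set ℂ := {w | √3 * |w.im| < w.re ∧ √3 * |w.im| < 1 - w.re}

theorem isOpen_kite : IsOpen kite := by
  have h1 : IsOpen {w : ℂ | √3 * |w.im| < w.re} := isOpen_lt (by fun_prop) (by fun_prop)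
  have h2 : IsOpen {w : ℂ | √3 * |w.im| < 1 - w.re} := isOpen_lt (by fun_prop) (by fun_prop)
  exact h1.inter h2

theorem one_sub_mem_kite {w : ℂ} (h : w ∈ kite) : 1 - w ∈ kite := by
  obtain ⟨h1, h2⟩ := h
  exact ⟨by simpa using h2, by simpa using h1⟩

/-- Within a face the kite at side `i` is the region where the coordinate vanishing on that side is
strictly the smallest, so that kites of different sides are disjoint. -/
theorem sectorCoord_mem_kite_iff (i : Fin 3) {z : ℂ} (hz : z ∈ triangle) :
    sectorCoord i z ∈ kite ↔ bary (i + 2) z < bary (i + 1) z ∧ bary (i + 2) z < bary i z := by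
  have h2 := mem_triangle_iff.1 hz (i + 2)
  have h3 := sqrt_three_mul_self
  have hs := bary_sum_add i z
  have h4 : √3 * |(sectorCoord i z).im| = 3 / 2 * bary (i + 2) z := by
    rw [sectorCoord_im, abs_of_nonneg (by positivity)]
    linear_combination bary (i + 2) z / 2 * h3
  change _ < _ ∧ _ < _ ↔ _
  rw [h4, sectorCoord_re]
  constructor
  · rintro ⟨h5, h6⟩
    exact ⟨by linarith, by linarith⟩
  · rintro ⟨h5, h6⟩
    exact ⟨by linarith, by linarith⟩

theorem bary_sectorPoint (i : Fin 3) (w : ℂ) :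
    bary (i + 2) (sectorPoint i w) = 2 / √3 * w.im ∧
      bary (i + 1) (sectorPoint i w) = w.re - w.im / √3 := by
  have h1 := sectorCoord_re i (sectorPoint i w)
  have h2 := sectorCoord_im i (sectorPoint i w)
  rw [sectorCoord_sectorPoint] at h1 h2
  have h3 := sqrt_three_pos
  have h4 : bary (i + 2) (sectorPoint i w) = 2 / √3 * w.im := by
    rw [h2]; field_simp
  refine ⟨h4, ?_⟩
  rw [h4] at h1
  rw [h1]; field_simp; ring

theorem sectorPoint_mem_triangle (i : Fin 3) {w : ℂ} (hw : w ∈ kite) (h : 0 ≤ w.im) :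
    sectorPoint i w ∈ triangle := by
  obtain ⟨h1, h2⟩ := hw
  rw [abs_of_nonneg h] at h1 h2
  obtain ⟨h3, h4⟩ := bary_sectorPoint i w
  have h5 := sqrt_three_pos
  have h6 := bary_sum_add i (sectorPoint i w)
  have h7 : w.im / √3 ≤ √3 * w.im := by
    rw [div_le_iff₀ h5]
    have := sqrt_three_mul_self
    nlinarith
  rw [mem_triangle_iff, forall_fin_three_add i, h3, h4]
  have h8 : 2 / √3 * w.im = 2 * (w.im / √3) := by ring
  have h9 : 0 ≤ w.im / √3 := by positivity
  refine ⟨by linarith, by linarith, by positivity⟩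

theorem sectorCoord_im_nonneg (i : Fin 3) {z : ℂ} (hz : z ∈ triangle) :
    0 ≤ (sectorCoord i z).im := by
  rw [sectorCoord_im]
  have := mem_triangle_iff.1 hz (i + 2)
  positivity

/-- The kites at different sides of the triangle are disjoint. -/
theorem eq_of_sectorCoord_mem_kite {i j : Fin 3} {z : ℂ} (hz : z ∈ triangle)
    (hi : sectorCoord i z ∈ kite) (hj : sectorCoord j z ∈ kite) : i = j := by
  rw [sectorCoord_mem_kite_iff _ hz] at hi hj
  have : j = i ∨ (j + 2 = i ∧ (i + 2 = j ∨ i + 2 = j + 1)) ∨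
      (j + 2 = i + 1 ∧ (i + 2 = j ∨ i + 2 = j + 1)) := by
    clear hi hj; revert i j; decide
  rcases this with h | ⟨h1, h2⟩ | ⟨h1, h2⟩
  · exact h.symm
  · rw [h1] at hj
    rcases h2 with h2 | h2 <;> rw [h2] at hi <;> linarith [hi.1, hi.2, hj.1, hj.2]
  · rw [h1] at hj
    rcases h2 with h2 | h2 <;> rw [h2] at hi <;> linarith [hi.1, hi.2, hj.1, hj.2]

end

end Equilateral

/-! ### Euclidean charts in faces and across edges -/

namespace TriangleGluing

open Equilateral Set Filter

noncomputable section

variable {G : TriangleGluing}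

theorem not_mem_openTriangle_sidePoint (i : Fin 3) (s : ℝ) : sidePoint i s ∉ openTriangle :=
  fun h => (h (i + 2)).ne' (bary_sidePoint_two i s)

/-- The set of points of the faces given by a subset of the interior of one face. -/
def faceSet (f : G.Face) (U : Set ℂ) : Set (Σ _ : G.Face, triangle) := {p | p.1 = f ∧ (p.2 : ℂ) ∈ U}

theorem faceSet_saturated (f : G.Face) {U : Set ℂ} (hU : U ⊆ openTriangle)
    (p q : Σ _ : G.Face, triangle) (h : G.Ident p q) (hp : p ∈ faceSet f U) : q ∈ faceSet f U := by
  obtain ⟨i, s, -, h1, -⟩ := h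
  exact absurd (h1 ▸ hU hp.2) (not_mem_openTriangle_sidePoint i s)

theorem isOpen_sigma_setOf {p : G.Face → Prop} {U : Set ℂ} (hU : IsOpen U) {φ : ℂ → ℂ}
    (hφ : Continuous φ) :
    IsOpen {q : Σ _ : G.Face, triangle | p q.1 ∧ φ q.2 ∈ U} := by
  rw [isOpen_sigma_iff]
  intro g
  by_cases h : p g
  · have : IsOpen {z : triangle | φ z ∈ U} := hU.preimage (hφ.comp continuous_subtype_val)
    convert this using 1
    ext z
    simp [h]
  · convert isOpen_empty using 1
    ext z
    simp [h]

theorem mem_of_pt_mem_image {f : G.Face} {z : triangle} {Q : Set (Σ _ : G.Face, triangle)}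
    (hQ : ∀ p q, G.Ident p q → p ∈ Q → q ∈ Q)
    (h : G.pt f z ∈ (Quot.mk G.Ident '' Q : Set G.Polyhedron)) : (⟨f, z⟩ : Σ _ : G.Face, triangle) ∈ Q := by
  obtain ⟨p, hp, hpq⟩ := h
  exact mem_of_mk_eq hQ hpq hp

/-- The Euclidean coordinate in the interior of a face. -/
theorem exists_faceChart (f : G.Face) : ∃ e : OpenPartialHomeomorph G.Polyhedron ℂ, IsFlatChart e ∧
    (∀ z : triangle, (z : ℂ) ∈ openTriangle → G.pt f z ∈ e.source ∧ e (G.pt f z) = z) ∧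
    ∀ g z, G.pt g z ∈ e.source → g = f ∧ (z : ℂ) ∈ openTriangle := by
  have himg : ∀ U ⊆ openTriangle, (fun z => G.pt f (toTriangle z)) '' U =
      (Quot.mk G.Ident '' faceSet f U : Set G.Polyhedron) := by
    intro U hU
    ext p
    constructor
    · rintro ⟨z, hz, rfl⟩
      refine ⟨⟨f, toTriangle z⟩, ⟨rfl, ?_⟩, rfl⟩
      simpa [toTriangle_of_mem (openTriangle_subset (hU hz))] using hz
    · rintro ⟨⟨g, z⟩, ⟨rfl, hz⟩, rfl⟩
      exact ⟨z, hz, by simp only [toTriangle_coe]; rfl⟩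
  have hc : ContinuousOn (fun z => G.pt f (toTriangle z)) openTriangle :=
    (continuous_pt f).comp_continuousOn
      (continuousOn_toTriangle.mono openTriangle_subset)
  have hi : InjOn (fun z => G.pt f (toTriangle z)) openTriangle := by
    intro z hz w hw h
    have h1 : (⟨f, toTriangle w⟩ : Σ _ : G.Face, triangle) ∈ faceSet f {z} :=
      mem_of_mk_eq (faceSet_saturated f (singleton_subset_iff.2 hz)) h
        ⟨rfl, by simp [toTriangle_of_mem (openTriangle_subset hz)]⟩
    have h2 : ((toTriangle w : triangle) : ℂ) = z := h1.2
    rw [toTriangle_of_mem (openTriangle_subset hw)] at h2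
    exact h2.symm
  obtain ⟨e, hes, -, he, -⟩ := exists_openPartialHomeomorph_of_injOn isOpen_openTriangle hc hi (by
    intro U hU hUo
    rw [himg U hU]
    exact isOpen_image_mk (faceSet_saturated f hU)
      (isOpen_sigma_setOf (p := fun g => g = f) hUo continuous_id))
  rw [himg _ subset_rfl] at hes
  have hmem : ∀ g z, G.pt g z ∈ e.source → g = f ∧ (z : ℂ) ∈ openTriangle := by
    intro g z h
    rw [hes] at h
    exact mem_of_pt_mem_image (faceSet_saturated f subset_rfl) h
  have hval : ∀ z : triangle, (z : ℂ) ∈ openTriangle → e (G.pt f z) = z := by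
    intro z hz
    have := he z hz
    rwa [toTriangle_coe] at this
  refine ⟨e, ⟨?_, ?_⟩, fun z hz => ⟨?_, hval z hz⟩, hmem⟩
  · intro c hc
    have : corner c.2 ∈ openTriangle := (hmem _ _ hc).2
    rw [corner_eq_sidePoint] at this
    exact not_mem_openTriangle_sidePoint _ _ this
  · intro g z h
    obtain ⟨rfl, hz⟩ := hmem g z h
    refine ⟨1, 0, by simp, ?_⟩
    filter_upwards [continuous_subtype_val.continuousAt.preimage_mem_nhds
      (isOpen_openTriangle.mem_nhds hz)] with w hw
    rw [hval w hw]; ring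
  · rw [hes]
    exact ⟨⟨f, z⟩, ⟨rfl, hz⟩, rfl⟩

/-- The set of points of the two faces adjacent to a side given by a set of coordinates along the
side. -/
def edgeSet (c : G.Face × Fin 3) (U : Set ℂ) : Set (Σ _ : G.Face, triangle) :=
  {p | (p.1 = c.1 ∧ sectorCoord c.2 p.2 ∈ U) ∨
    (p.1 = (G.glue c).1 ∧ 1 - sectorCoord (G.glue c).2 p.2 ∈ U)}

/-- The coordinate `j + 2` vanishes on side `j`, so no other nonnegative coordinate can be strictly
smaller, as the kite of a different side would require. Hence an edge neighbourhood meets the gluing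
only along its own side. -/
theorem eq_of_sectorCoord_sidePoint_mem_kite {i j : Fin 3} {s : ℝ} (hs : s ∈ Icc (0 : ℝ) 1)
    (h : sectorCoord i (sidePoint j s) ∈ kite) : i = j := by
  have hm := sidePoint_mem j hs
  rw [sectorCoord_mem_kite_iff i hm] at h
  have h2 : j + 2 ≠ i + 1 := fun e => by
    have h3 := mem_triangle_iff.1 hm (i + 2)
    rw [← e, bary_sidePoint_two] at h
    linarith [h.1]
  have h3 : j + 2 ≠ i := fun e => by
    have h3 := mem_triangle_iff.1 hm (i + 2)
    rw [← e, bary_sidePoint_two] at h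
    rw [← e] at h3
    linarith [h.2]
  clear h hm
  revert i j; decide

theorem edgeSet_saturated (c : G.Face × Fin 3) {U : Set ℂ} (hU : U ⊆ kite)
    (p q : Σ _ : G.Face, triangle) (h : G.Ident p q) (hp : p ∈ edgeSet c U) : q ∈ edgeSet c U := by
  obtain ⟨j, s, hs, h1, h2, h3⟩ := h
  rcases hp with ⟨hp1, hp2⟩ | ⟨hp1, hp2⟩
  · rw [h1] at hp2
    obtain rfl := eq_of_sectorCoord_sidePoint_mem_kite hs (hU hp2)
    rw [sectorCoord_sidePoint] at hp2
    right
    rw [hp1, Prod.mk.eta] at h2 h3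
    refine ⟨h2, ?_⟩
    rw [h3, sectorCoord_sidePoint]
    simpa using hp2
  · rw [h1] at hp2
    have hk := one_sub_mem_kite (hU hp2)
    rw [sub_sub_cancel] at hk
    obtain rfl := eq_of_sectorCoord_sidePoint_mem_kite hs hk
    rw [sectorCoord_sidePoint] at hp2
    left
    rw [hp1, Prod.mk.eta, G.glue_glue] at h2 h3
    refine ⟨h2, ?_⟩
    rw [h3, sectorCoord_sidePoint]
    simpa using hp2

open Classical in
/-- The parametrization of a neighbourhood of a side. -/
def edgeParam (c : G.Face × Fin 3) (w : ℂ) : G.Polyhedron :=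
  if 0 ≤ w.im then G.pt c.1 (toTriangle (sectorPoint c.2 w))
  else G.pt (G.glue c).1 (toTriangle (sectorPoint (G.glue c).2 (1 - w)))

/-- The gluing matches the parameter `s` with `1 - s`. The half-turn `w ↦ 1 - w` therefore lays the
second face below the real axis so that the two branches agree on the axis. -/
theorem edgeParam_of_im_eq_zero (c : G.Face × Fin 3) {w : ℂ} (hw : w ∈ kite) (h : w.im = 0) :
    G.pt c.1 (toTriangle (sectorPoint c.2 w)) =
      G.pt (G.glue c).1 (toTriangle (sectorPoint (G.glue c).2 (1 - w))) := by
  have hwr : w = (w.re : ℂ) := Complex.ext rfl (by simpa using h)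
  obtain ⟨h1, h2⟩ := hw
  rw [h] at h1 h2
  simp only [abs_zero, mul_zero] at h1 h2
  have hs : w.re ∈ Icc (0 : ℝ) 1 := ⟨h1.le, by linarith⟩
  have hs' : 1 - w.re ∈ Icc (0 : ℝ) 1 := ⟨h2.le, by linarith⟩
  have e1 : sectorPoint c.2 w = sidePoint c.2 w.re := by rw [hwr, sectorPoint_ofReal]; simp
  have e2 : sectorPoint (G.glue c).2 (1 - w) = sidePoint (G.glue c).2 (1 - w.re) := by
    rw [← sectorPoint_ofReal]; push_cast; rw [← hwr]
  refine pt_sidePoint c hs _ _ ?_ ?_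
  · rw [e1, toTriangle_of_mem (sidePoint_mem _ hs)]
  · rw [e2, toTriangle_of_mem (sidePoint_mem _ hs')]

theorem edgeParam_of_im_nonpos (c : G.Face × Fin 3) {w : ℂ} (hw : w ∈ kite) (h : w.im ≤ 0) :
    edgeParam c w = G.pt (G.glue c).1 (toTriangle (sectorPoint (G.glue c).2 (1 - w))) := by
  rcases h.lt_or_eq with h | h
  · exact if_neg (not_le.2 h)
  · rw [edgeParam, if_pos h.ge, edgeParam_of_im_eq_zero c hw h]

theorem edgeParam_sectorCoord (c : G.Face × Fin 3) (z : triangle) :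
    edgeParam c (sectorCoord c.2 z) = G.pt c.1 z := by
  rw [edgeParam, if_pos (sectorCoord_im_nonneg _ z.2), sectorPoint_sectorCoord, toTriangle_coe]

theorem edgeParam_one_sub_sectorCoord (c : G.Face × Fin 3) (z : triangle)
    (hz : 1 - sectorCoord (G.glue c).2 z ∈ kite) :
    edgeParam c (1 - sectorCoord (G.glue c).2 z) = G.pt (G.glue c).1 z := by
  rw [edgeParam_of_im_nonpos c hz, sub_sub_cancel, sectorPoint_sectorCoord, toTriangle_coe]
  simpa using sectorCoord_im_nonneg _ z.2

theorem exists_rep_edgeParam (c : G.Face × Fin 3) {w : ℂ} (hw : w ∈ kite) :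
    ∃ p : Σ _ : G.Face, triangle, edgeParam c w = Quot.mk G.Ident p ∧
      ((p.1 = c.1 ∧ sectorCoord c.2 p.2 = w) ∨
        (p.1 = (G.glue c).1 ∧ 1 - sectorCoord (G.glue c).2 p.2 = w)) := by
  rcases le_total 0 w.im with h | h
  · refine ⟨⟨c.1, toTriangle (sectorPoint c.2 w)⟩, if_pos h, Or.inl ⟨rfl, ?_⟩⟩
    rw [toTriangle_of_mem (sectorPoint_mem_triangle _ hw h), sectorCoord_sectorPoint]
  · refine ⟨⟨(G.glue c).1, toTriangle (sectorPoint (G.glue c).2 (1 - w))⟩,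
      edgeParam_of_im_nonpos c hw h, Or.inr ⟨rfl, ?_⟩⟩
    rw [toTriangle_of_mem (sectorPoint_mem_triangle _ (one_sub_mem_kite hw) (by simpa using h)),
      sectorCoord_sectorPoint, sub_sub_cancel]

theorem edgeParam_image (c : G.Face × Fin 3) {U : Set ℂ} (hU : U ⊆ kite) :
    edgeParam c '' U = (Quot.mk G.Ident '' edgeSet c U : Set G.Polyhedron) := by
  ext p
  constructor
  · rintro ⟨w, hw, rfl⟩
    obtain ⟨q, hq, hq'⟩ := exists_rep_edgeParam c (hU hw)
    refine ⟨q, ?_, hq.symm⟩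
    rcases hq' with ⟨h1, h2⟩ | ⟨h1, h2⟩
    · exact Or.inl ⟨h1, h2.symm ▸ hw⟩
    · exact Or.inr ⟨h1, h2.symm ▸ hw⟩
  · rintro ⟨⟨g, z⟩, ⟨h1, h2⟩ | ⟨h1, h2⟩, rfl⟩
    · simp only at h1 h2
      subst h1
      exact ⟨_, h2, edgeParam_sectorCoord c z⟩
    · simp only at h1 h2
      subst h1
      exact ⟨_, h2, edgeParam_one_sub_sectorCoord c z (hU h2)⟩

theorem injOn_edgeParam (c : G.Face × Fin 3) : InjOn (edgeParam c) kite := by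
  intro w hw v hv h
  obtain ⟨p, hp, hp'⟩ := exists_rep_edgeParam c hw
  obtain ⟨q, hq, hq'⟩ := exists_rep_edgeParam c hv
  rw [hp, hq] at h
  have h1 : q ∈ edgeSet c {w} := mem_of_mk_eq (edgeSet_saturated c (singleton_subset_iff.2 hw)) h hp'
  -- Two sides of the same face may be glued; then both kites lie in one face, but they are disjoint
  -- because a side is never glued to itself.
  have key : ∀ z : triangle, c.1 = (G.glue c).1 → sectorCoord c.2 z ∈ kite →
      1 - sectorCoord (G.glue c).2 z ∈ kite → False := by
    intro z h1 h2 h3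
    have h4 := one_sub_mem_kite h3
    rw [sub_sub_cancel] at h4
    exact G.glue_ne c (Prod.ext h1 (eq_of_sectorCoord_mem_kite z.2 h2 h4)).symm
  rcases h1 with ⟨a1, a2⟩ | ⟨a1, a2⟩ <;> rcases hq' with ⟨b1, b2⟩ | ⟨b1, b2⟩ <;>
    rw [mem_singleton_iff] at a2
  · rw [← a2, ← b2]
  · exact (key q.2 (a1.symm.trans b1) (a2 ▸ hw) (b2 ▸ hv)).elim
  · exact (key q.2 (b1.symm.trans a1) (b2 ▸ hv) (a2 ▸ hw)).elim
  · rw [← a2, ← b2]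

theorem continuousOn_edgeParam (c : G.Face × Fin 3) : ContinuousOn (edgeParam c) kite := by
  unfold edgeParam
  refine ContinuousOn.if ?_ ?_ ?_
  · rintro w ⟨hw, hw'⟩
    refine edgeParam_of_im_eq_zero c hw ?_
    rwa [Complex.frontier_setOfPred_le_im] at hw'
  · refine (continuous_pt _).comp_continuousOn (continuousOn_toTriangle.comp
      (continuous_sectorPoint _).continuousOn ?_)
    rintro w ⟨hw, hw'⟩
    rw [(isClosed_le continuous_const Complex.continuous_im).closure_eq] at hw'
    exact sectorPoint_mem_triangle _ hw hw'
  · refine (continuous_pt _).comp_continuousOn (continuousOn_toTriangle.comp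
      ((continuous_sectorPoint _).comp (by fun_prop)).continuousOn ?_)
    rintro w ⟨hw, hw'⟩
    simp only [not_le] at hw'
    rw [Complex.closure_setOfPred_im_lt] at hw'
    exact sectorPoint_mem_triangle _ (one_sub_mem_kite hw) (by simpa using hw')

theorem isFlat_sectorCoord (i : Fin 3) : ‖(corner (i + 1) - corner i)⁻¹‖ = 1 := by
  rw [norm_inv, norm_corner_succ_sub, inv_one]

/-- The Euclidean coordinate in a neighbourhood of the interior of a side. -/
theorem exists_edgeChart (c : G.Face × Fin 3) :
    ∃ e : OpenPartialHomeomorph G.Polyhedron ℂ, IsFlatChart e ∧ e.target = kite ∧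
      (∀ w, e.symm w = edgeParam c w) ∧
      ∀ z : triangle, sectorCoord c.2 z ∈ kite →
        G.pt c.1 z ∈ e.source ∧ e (G.pt c.1 z) = sectorCoord c.2 z := by
  obtain ⟨e, hes, het, he, hsymm⟩ := exists_openPartialHomeomorph_of_injOn isOpen_kite
    (continuousOn_edgeParam c) (injOn_edgeParam c) (fun U hU hUo => by
      rw [edgeParam_image c hU]
      refine isOpen_image_mk (edgeSet_saturated c hU) (IsOpen.union ?_ ?_)
      · exact isOpen_sigma_setOf (p := fun g => g = c.1) hUo (continuous_sectorCoord _)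
      · exact isOpen_sigma_setOf (p := fun g => g = (G.glue c).1) hUo
          (continuous_const.sub (continuous_sectorCoord _)))
  have hval1 : ∀ z : triangle, sectorCoord c.2 z ∈ kite →
      G.pt c.1 z ∈ e.source ∧ e (G.pt c.1 z) = sectorCoord c.2 z := by
    intro z hz
    rw [← edgeParam_sectorCoord, hes]
    exact ⟨⟨_, hz, rfl⟩, he _ hz⟩
  have hval2 : ∀ z : triangle, 1 - sectorCoord (G.glue c).2 z ∈ kite →
      e (G.pt (G.glue c).1 z) = 1 - sectorCoord (G.glue c).2 z := by
    intro z hz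
    rw [← edgeParam_one_sub_sectorCoord c z hz, he _ hz]
  have hmem : ∀ g z, G.pt g z ∈ e.source → (⟨g, z⟩ : Σ _ : G.Face, triangle) ∈ edgeSet c kite := by
    intro g z h
    rw [hes, edgeParam_image c subset_rfl] at h
    exact mem_of_pt_mem_image (edgeSet_saturated c subset_rfl) h
  have hcor : ∀ i j : Fin 3, sectorCoord i (corner j) ∉ kite := by
    intro i j h
    rw [sectorCoord_mem_kite_iff i (corner_mem j), bary_corner, bary_corner, bary_corner] at h
    have : i ≠ j ∨ i + 1 ≠ j := by clear h; revert i j; decide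
    rcases this with h1 | h1
    · rw [if_neg h1] at h
      have h2 := h.2
      split_ifs at h2 <;> norm_num at h2
    · rw [if_neg h1] at h
      have h2 := h.1
      split_ifs at h2 <;> norm_num at h2
  refine ⟨e, ⟨?_, ?_⟩, het, hsymm, hval1⟩
  · intro b hb
    rcases hmem _ _ hb with ⟨-, h⟩ | ⟨-, h⟩
    · exact hcor _ _ h
    · have h' := one_sub_mem_kite h
      rw [sub_sub_cancel] at h'
      exact hcor _ _ h'
  · intro g z hz
    rcases hmem _ _ hz with ⟨h1, h2⟩ | ⟨h1, h2⟩
    · simp only at h1 h2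
      subst h1
      refine ⟨_, -(corner c.2 / (corner (c.2 + 1) - corner c.2)), isFlat_sectorCoord c.2, ?_⟩
      filter_upwards [((continuous_sectorCoord c.2).comp continuous_subtype_val).continuousAt.preimage_mem_nhds
        (isOpen_kite.mem_nhds h2)] with w hw
      rw [(hval1 w hw).2, ← sectorCoord_affine]
    · simp only at h1 h2
      subst h1
      refine ⟨-(corner ((G.glue c).2 + 1) - corner (G.glue c).2)⁻¹,
        1 + corner (G.glue c).2 / (corner ((G.glue c).2 + 1) - corner (G.glue c).2),
        by rw [norm_neg]; exact isFlat_sectorCoord _, ?_⟩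
      filter_upwards [((continuous_const (y := (1 : ℂ))).sub ((continuous_sectorCoord (G.glue c).2).comp
        continuous_subtype_val)).continuousAt.preimage_mem_nhds (isOpen_kite.mem_nhds h2)] with w hw
      rw [hval2 w hw, sectorCoord_affine]; ring

/-- Every point of a face lies in its interior, or in the interior of a side, or is a corner. -/
theorem mem_openTriangle_or (z : triangle) : (z : ℂ) ∈ openTriangle ∨
    (∃ i, ∃ s ∈ Ioo (0 : ℝ) 1, (z : ℂ) = sidePoint i s) ∨ ∃ i, (z : ℂ) = corner i := by
  by_cases h : (z : ℂ) ∈ openTriangle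
  · exact Or.inl h
  right
  have h0 := mem_triangle_iff.1 z.2
  simp only [openTriangle, mem_ofPred_eq, not_forall, not_lt] at h
  obtain ⟨k, hk⟩ := h
  obtain ⟨i, rfl⟩ : ∃ i : Fin 3, i + 2 = k := by clear hk; revert k; decide
  have h2 : bary (i + 2) (z : ℂ) = 0 := le_antisymm hk (h0 _)
  have h1 := eq_sidePoint h2
  have hs := bary_sum_add i z
  rcases (h0 (i + 1)).eq_or_lt with h3 | h3
  · right
    refine ⟨i, ?_⟩
    rw [h1, ← h3, ← corner_eq_sidePoint]
  · rcases (h0 i).eq_or_lt with h4 | h4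
    · right
      refine ⟨i + 1, ?_⟩
      have : bary (i + 1) (z : ℂ) = 1 := by linarith
      rw [h1, this, ← corner_add_one_eq_sidePoint]
    · exact Or.inl ⟨i, _, ⟨h3, by linarith⟩, h1⟩

theorem ofReal_mem_kite {s : ℝ} (hs : s ∈ Ioo (0 : ℝ) 1) : (s : ℂ) ∈ kite := by
  refine ⟨?_, ?_⟩
  · simpa using hs.1
  · simpa using hs.2

end

end TriangleGluing

/-! ### How a topological Belyi function maps the sides of a right triangle -/

namespace Equilateral

open SchwarzChristoffel Set RiemannSphere

noncomputable section

/-- Three disjoint open sets which cover the equator without `0`, `1`, `∞`. -/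
def arcNhd : Fin 3 → Set (OnePoint ℂ) :=
  ![(↑) '' {z : ℂ | z.re < 0}, (↑) '' Metric.ball (1 / 2 : ℂ) (1 / 2), (↑) '' {z : ℂ | 1 < z.re}]

theorem coe_mem_arcNhd {z : ℂ} : ((z : OnePoint ℂ) ∈ arcNhd 0 ↔ z.re < 0) ∧
    ((z : OnePoint ℂ) ∈ arcNhd 1 ↔ ‖z - 1 / 2‖ < 1 / 2) ∧
    ((z : OnePoint ℂ) ∈ arcNhd 2 ↔ 1 < z.re) := by
  refine ⟨?_, ?_, ?_⟩
  · change _ ∈ ((↑) : ℂ → OnePoint ℂ) '' {z : ℂ | z.re < 0} ↔ _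
    rw [OnePoint.coe_injective.mem_set_image]; rfl
  · change _ ∈ ((↑) : ℂ → OnePoint ℂ) '' Metric.ball (1 / 2 : ℂ) (1 / 2) ↔ _
    rw [OnePoint.coe_injective.mem_set_image, mem_ball_iff_norm]
  · change _ ∈ ((↑) : ℂ → OnePoint ℂ) '' {z : ℂ | 1 < z.re} ↔ _
    rw [OnePoint.coe_injective.mem_set_image]; rfl

theorem isOpen_arcNhd (k : Fin 3) : IsOpen (arcNhd k) := by
  have h := OnePoint.isOpenEmbedding_coe (X := ℂ)
  fin_cases k
  · exact h.isOpenMap _ (isOpen_lt Complex.continuous_re continuous_const)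
  · exact h.isOpenMap _ Metric.isOpen_ball
  · exact h.isOpenMap _ (isOpen_lt continuous_const Complex.continuous_re)

theorem abs_le_of_norm_lt {z : ℂ} (h : ‖z - 1 / 2‖ < 1 / 2) : 0 < z.re ∧ z.re < 1 := by
  have h1 := (abs_lt.1 ((Complex.abs_re_le_norm _).trans_lt h))
  simp at h1
  exact ⟨by linarith [h1.1], by linarith [h1.2]⟩

theorem disjoint_arcNhd {j k : Fin 3} (h : j ≠ k) : Disjoint (arcNhd j) (arcNhd k) := by
  rw [disjoint_left]
  have hc : ∀ k p, p ∈ arcNhd k → ∃ z : ℂ, (z : OnePoint ℂ) = p := by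
    intro k p hp
    fin_cases k <;> obtain ⟨z, -, rfl⟩ := hp <;> exact ⟨z, rfl⟩
  intro p hj hk
  obtain ⟨z, rfl⟩ := hc j p hj
  obtain ⟨c0, c1, c2⟩ := coe_mem_arcNhd (z := z)
  have key : (z.re < 0 ∧ ‖z - 1 / 2‖ < 1 / 2) ∨ (z.re < 0 ∧ 1 < z.re) ∨
      (‖z - 1 / 2‖ < 1 / 2 ∧ 1 < z.re) := by
    fin_cases j <;> fin_cases k <;> first
      | exact absurd rfl h
      | exact Or.inl ⟨c0.1 hj, c1.1 hk⟩
      | exact Or.inl ⟨c0.1 hk, c1.1 hj⟩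
      | exact Or.inr (Or.inl ⟨c0.1 hj, c2.1 hk⟩)
      | exact Or.inr (Or.inl ⟨c0.1 hk, c2.1 hj⟩)
      | exact Or.inr (Or.inr ⟨c1.1 hj, c2.1 hk⟩)
      | exact Or.inr (Or.inr ⟨c1.1 hk, c2.1 hj⟩)
  rcases key with ⟨h1, h2⟩ | ⟨h1, h2⟩ | ⟨h1, h2⟩
  · linarith [(abs_le_of_norm_lt h2).1]
  · linarith
  · linarith [(abs_le_of_norm_lt h1).2]

theorem mem_arcNhd_of_mem_equator {p : OnePoint ℂ} (hp : p ∈ equator) (h0 : p ≠ ((0 : ℂ) : OnePoint ℂ))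
    (h1 : p ≠ ((1 : ℂ) : OnePoint ℂ)) (h2 : p ≠ OnePoint.infty) : ∃ k, p ∈ arcNhd k := by
  induction p using OnePoint.rec with
  | infty => exact absurd rfl h2
  | coe z =>
    obtain ⟨c0, c1, c2⟩ := coe_mem_arcNhd (z := z)
    have him := coe_mem_equator.1 hp
    have e0 : z.re ≠ 0 := fun h => h0 (by rw [show z = 0 from Complex.ext h him])
    have e1 : z.re ≠ 1 := fun h => h1 (by rw [show z = 1 from Complex.ext h him])
    rcases lt_or_gt_of_ne e0 with h | h
    · exact ⟨0, c0.2 h⟩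
    · rcases lt_or_gt_of_ne e1 with h' | h'
      · refine ⟨1, c1.2 ?_⟩
        have : z - 1 / 2 = ((z.re - 1 / 2 : ℝ) : ℂ) := by
          apply Complex.ext <;> simp [him]
        rw [this, Complex.norm_real, Real.norm_eq_abs, abs_lt]
        constructor <;> linarith
      · exact ⟨2, c2.2 h'⟩

/-- The point among `0`, `1`, `∞` which does not lie on the given arc. -/
def oppositePoint : Fin 3 → OnePoint ℂ := ![((1 : ℂ) : OnePoint ℂ), OnePoint.infty, ((0 : ℂ) : OnePoint ℂ)]

theorem exists_nhds_disjoint_arcNhd (k : Fin 3) : ∃ V ∈ 𝓝 (oppositePoint k), Disjoint V (arcNhd k) := by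
  have h := OnePoint.isOpenEmbedding_coe (X := ℂ)
  fin_cases k
  · refine ⟨((↑) : ℂ → OnePoint ℂ) '' {z : ℂ | 0 < z.re}, (h.isOpenMap _ (isOpen_lt continuous_const
      Complex.continuous_re)).mem_nhds ⟨1, by simp, rfl⟩, ?_⟩
    rw [disjoint_left]
    rintro _ ⟨z, hz, rfl⟩ hz'
    exact lt_asymm hz (coe_mem_arcNhd.1.1 hz')
  · have hcl : IsClosed ((↑) '' Metric.closedBall (1 / 2 : ℂ) (1 / 2) : Set (OnePoint ℂ)) :=
      ((isCompact_closedBall _ _).image OnePoint.continuous_coe).isClosed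
    refine ⟨(((↑) : ℂ → OnePoint ℂ) '' Metric.closedBall (1 / 2 : ℂ) (1 / 2))ᶜ, hcl.isOpen_compl.mem_nhds ?_, ?_⟩
    · rintro ⟨z, -, hz⟩
      exact OnePoint.coe_ne_infty z hz
    · rw [disjoint_compl_left_iff_subset]
      exact image_mono Metric.ball_subset_closedBall
  · refine ⟨((↑) : ℂ → OnePoint ℂ) '' {z : ℂ | z.re < 1}, (h.isOpenMap _ (isOpen_lt Complex.continuous_re
      continuous_const)).mem_nhds ⟨0, by simp, rfl⟩, ?_⟩
    rw [disjoint_left]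
    rintro _ ⟨z, hz, rfl⟩ hz'
    exact lt_asymm hz (coe_mem_arcNhd.2.2.1 hz')

/-- A path in the equator without `0`, `1`, `∞` which starts at one of these three points does not
meet the opposite arc. -/
theorem not_mem_arcNhd {K S : Set ℂ} {g : ℂ → OnePoint ℂ} (hS : IsPreconnected S) (hSK : S ⊆ K)
    (hg : ContinuousOn g K) (hE : ∀ z ∈ S, ∃ k, g z ∈ arcNhd k) {p : ℂ} (hpK : p ∈ K)
    (hp : p ∈ closure S) {k : Fin 3} (hk : g p = oppositePoint k) {z : ℂ} (hz : z ∈ S) :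
    g z ∉ arcNhd k := by
  intro hzk
  -- A connected image in a disjoint union of arc neighbourhoods lies in one of them. This one stays
  -- away from `g p`, although `p` is a limit of points of `S`.
  have hsub : g '' S ⊆ arcNhd k := by
    refine (hS.image g (hg.mono hSK)).subset_left_of_subset_union (isOpen_arcNhd k)
      (isOpen_iUnion fun j : {j // j ≠ k} => isOpen_arcNhd j) ?_ ?_ ⟨_, ⟨z, hz, rfl⟩, hzk⟩
    · rw [disjoint_iUnion_right]
      exact fun j => disjoint_arcNhd j.2.symm
    · rintro _ ⟨w, hw, rfl⟩
      obtain ⟨j, hj⟩ := hE w hw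
      by_cases h : j = k
      · exact Or.inl (h ▸ hj)
      · exact Or.inr (mem_iUnion.2 ⟨⟨j, h⟩, hj⟩)
  obtain ⟨V, hV, hVd⟩ := exists_nhds_disjoint_arcNhd k
  have h1 : ContinuousWithinAt g S p := (hg p hpK).mono hSK
  rw [← hk] at hV
  have h2 : ∀ᶠ w in 𝓝[S] p, g w ∈ V ∧ w ∈ S := (h1.eventually hV).and self_mem_nhdsWithin
  have h3 : (𝓝[S] p).NeBot := mem_closure_iff_nhdsWithin_neBot.1 hp
  obtain ⟨w, hw, hwS⟩ := h2.exists
  exact disjoint_left.1 hVd hw (hsub ⟨w, hwS, rfl⟩)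

open Classical in
/-- The hemisphere to which a Belyi function maps the right triangle `chamber a b`. -/
def hemisphere (a b : Fin 3) : Set (OnePoint ℂ) :=
  if b = a + 1 then lowerHemisphere else upperHemisphere

/-- The properties of the restriction of a Belyi function to a face. -/
structure IsFaceBelyi (g : ℂ → OnePoint ℂ) : Prop where
  cont : ContinuousOn g triangle
  white : ∀ a b, a ≠ b → g (midpoint ℝ (corner a) (corner b)) = ((0 : ℂ) : OnePoint ℂ)
  black : ∀ a, g (corner a) = ((1 : ℂ) : OnePoint ℂ)
  star : g center = OnePoint.infty
  bij : ∀ a b, a ≠ b → BijOn g (chamber a b) (hemisphere a b)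
  bdry : ∀ a b, a ≠ b → BijOn g (frontier (chamber a b)) equator

theorem bary_midpoint (j a b : Fin 3) : bary j (midpoint ℝ (corner a) (corner b)) =
    1 / 2 * bary j (corner a) + 1 / 2 * bary j (corner b) := by
  have hmid : midpoint ℝ (corner a) (corner b) =
      ((1 / 2 : ℝ) : ℂ) * corner a + ((1 / 2 : ℝ) : ℂ) * corner b := by
    rw [midpoint_eq_smul_add, Complex.real_smul]; push_cast [invOf_eq_inv]; ring
  rw [hmid, bary_combo j _ _ (by norm_num)]

/-- The vertices of a right triangle, each one mapped by Belyi functions to `oppositePoint k`. -/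
def chamberVertex (a b : Fin 3) : Fin 3 → ℂ :=
  ![corner a, center, midpoint ℝ (corner a) (corner b)]

/-- The equation of the side of a right triangle which is opposite to `chamberVertex a b k`. -/
def ChamberSide (a b : Fin 3) (k : Fin 3) (z : ℂ) : Prop :=
  ![bary b z = bary a z, bary (-a - b) z = 0, bary (-a - b) z = bary b z] k

theorem mem_frontier_chamber_iff_chamberSide {a b : Fin 3} (hab : a ≠ b) {z : ℂ}
    (hz : z ∈ chamber a b) : z ∈ frontier (chamber a b) ↔ ∃ k, ChamberSide a b k z := by
  rw [mem_frontier_chamber_iff hab hz, Fin.exists_fin_succ, Fin.exists_fin_two]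
  change _ ↔ bary b z = bary a z ∨ bary (-a - b) z = 0 ∨ bary (-a - b) z = bary b z
  tauto

theorem bary_chamberVertex {a b : Fin 3} (hab : a ≠ b) (k : Fin 3) :
    bary a (chamberVertex a b k) = ![1, 1 / 3, 1 / 2] k ∧
    bary b (chamberVertex a b k) = ![0, 1 / 3, 1 / 2] k ∧
    bary (-a - b) (chamberVertex a b k) = ![0, 1 / 3, 0] k := by
  obtain ⟨h1, h2⟩ := third_ne hab
  fin_cases k
  · simp [chamberVertex, bary_corner, hab.symm, h1]
  · simp [chamberVertex, bary_center]
  · simp [chamberVertex, bary_midpoint, bary_corner, hab, hab.symm, h1, h2]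

theorem chamberVertex_mem {a b : Fin 3} (hab : a ≠ b) (k : Fin 3) :
    chamberVertex a b k ∈ chamber a b := by
  rw [← convexHull_eq_chamber hab]
  refine subset_convexHull ℝ _ ?_
  fin_cases k <;> simp [chamberVertex]

theorem chamberSide_chamberVertex {a b : Fin 3} (hab : a ≠ b) {j k : Fin 3} (h : j ≠ k) :
    ChamberSide a b k (chamberVertex a b j) := by
  obtain ⟨h1, h2, h3⟩ := bary_chamberVertex hab j
  unfold ChamberSide
  rw [h1, h2, h3]
  fin_cases j <;> fin_cases k <;> simp at h ⊢

theorem mem_segment_of_chamberSide {a b : Fin 3} (hab : a ≠ b) {i j k : Fin 3} (hij : i ≠ j)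
    (hik : i ≠ k) (hjk : j ≠ k) {z : ℂ} (hz : z ∈ chamber a b) (h : ChamberSide a b k z) :
    z ∈ segment ℝ (chamberVertex a b i) (chamberVertex a b j) := by
  wlog hlt : i < j generalizing i j
  · rw [segment_symm]
    exact this hij.symm hjk hik (lt_of_le_of_ne (not_lt.1 hlt) hij.symm)
  have key : ∀ t : ℝ, 0 ≤ t → t ≤ 1 →
      (∀ l, bary l z = (1 - t) * bary l (chamberVertex a b i) + t * bary l (chamberVertex a b j)) →
      z ∈ segment ℝ (chamberVertex a b i) (chamberVertex a b j) := by
    intro t h0 h1 ht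
    refine ⟨1 - t, t, by linarith, h0, by ring, ?_⟩
    rw [Complex.real_smul, Complex.real_smul]
    refine bary_ext fun l => ?_
    rw [bary_combo _ _ _ (by ring), ht]
  have hs := bary_sum' hab z
  obtain ⟨z1, z2, z3⟩ := hz
  obtain ⟨i1, i2, i3⟩ := bary_chamberVertex hab i
  obtain ⟨j1, j2, j3⟩ := bary_chamberVertex hab j
  simp only [forall_fin_three hab (p := fun l => bary l z = _), i1, i2, i3, j1, j2, j3] at key
  have hc : (i = 1 ∧ j = 2 ∧ k = 0) ∨ (i = 0 ∧ j = 2 ∧ k = 1) ∨ (i = 0 ∧ j = 1 ∧ k = 2) := by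
    clear key i1 i2 i3 j1 j2 j3 h; revert i j k; decide
  rcases hc with ⟨rfl, rfl, rfl⟩ | ⟨rfl, rfl, rfl⟩ | ⟨rfl, rfl, rfl⟩
  · replace h : bary b z = bary a z := h
    refine key (6 * bary a z - 2) (by linarith) (by linarith)
      ⟨
      by change _ = (1 - (6 * bary a z - 2)) * (1 / 3) + (6 * bary a z - 2) * (1 / 2); linarith,
      by change _ = (1 - (6 * bary a z - 2)) * (1 / 3) + (6 * bary a z - 2) * (1 / 2); linarith,
      by change _ = (1 - (6 * bary a z - 2)) * (1 / 3) + (6 * bary a z - 2) * 0; linarith⟩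
  · replace h : bary (-a - b) z = 0 := h
    refine key (2 * bary b z) (by linarith) (by linarith)
      ⟨
      by change _ = (1 - (2 * bary b z)) * 1 + (2 * bary b z) * (1 / 2); linarith,
      by change _ = (1 - (2 * bary b z)) * 0 + (2 * bary b z) * (1 / 2); linarith,
      by change _ = (1 - (2 * bary b z)) * 0 + (2 * bary b z) * 0; linarith⟩
  · replace h : bary (-a - b) z = bary b z := h
    refine key (3 * bary b z) (by linarith) (by linarith)
      ⟨
      by change _ = (1 - (3 * bary b z)) * 1 + (3 * bary b z) * (1 / 3); linarith,
      by change _ = (1 - (3 * bary b z)) * 0 + (3 * bary b z) * (1 / 3); linarith,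
      by change _ = (1 - (3 * bary b z)) * 0 + (3 * bary b z) * (1 / 3); linarith⟩

theorem convex_chamberSide {a b : Fin 3} (hab : a ≠ b) (k : Fin 3) :
    Convex ℝ {z | z ∈ chamber a b ∧ ChamberSide a b k z} := by
  have hc : Convex ℝ (chamber a b) := by
    rw [← convexHull_eq_chamber hab]; exact convex_convexHull ℝ _
  refine hc.inter ?_
  intro x hx y hy s t hs ht hst
  rw [Complex.real_smul, Complex.real_smul]
  change ChamberSide a b k x at hx
  change ChamberSide a b k y at hy
  change ChamberSide a b k _
  unfold ChamberSide at hx hy ⊢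
  simp only [bary_combo _ x y hst]
  fin_cases k <;> simp at hx hy ⊢ <;> simp [hx, hy]

/-- The arc of the equator between two of the points `0`, `1`, `∞` which avoids the third one. -/
def equatorArc (k : Fin 3) : Set (OnePoint ℂ) :=
  {p | p ∈ equator ∧ p ≠ oppositePoint k ∧ ∀ j ≠ k, p ∉ arcNhd j}

theorem oppositePoint_injective : Function.Injective oppositePoint := by
  intro i j h
  fin_cases i <;> fin_cases j <;> simp_all [oppositePoint]

theorem oppositePoint_not_mem_arcNhd (i j : Fin 3) : oppositePoint i ∉ arcNhd j := by
  intro h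
  fin_cases i
  · obtain ⟨c0, c1, c2⟩ := coe_mem_arcNhd (z := 1)
    fin_cases j
    · have := c0.1 h; simp at this; linarith
    · have := c1.1 h; norm_num at this
    · have := c2.1 h; simp at this
  · fin_cases j <;> obtain ⟨z, -, hz⟩ := h <;> exact OnePoint.coe_ne_infty z hz
  · obtain ⟨c0, c1, c2⟩ := coe_mem_arcNhd (z := 0)
    fin_cases j
    · have := c0.1 h; simp at this
    · have := c1.1 h; norm_num at this
    · have := c2.1 h; simp at this; linarith

namespace IsFaceBelyi

variable {g : ℂ → OnePoint ℂ} {a b : Fin 3}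

theorem apply_chamberVertex (hg : IsFaceBelyi g) (hab : a ≠ b) (k : Fin 3) :
    g (chamberVertex a b k) = oppositePoint k := by
  fin_cases k
  exacts [hg.black a, hg.star, hg.white a b hab]

theorem exists_mem_arcNhd (hg : IsFaceBelyi g) (hab : a ≠ b) {z : ℂ} (hz : z ∈ chamber a b)
    (h : ∃ k, ChamberSide a b k z) (h' : ∀ k, z ≠ chamberVertex a b k) : ∃ k, g z ∈ arcNhd k := by
  have hi := (hg.bij a b hab).injOn
  have hE : g z ∈ equator :=
    (hg.bdry a b hab).mapsTo ((mem_frontier_chamber_iff_chamberSide hab hz).2 h)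
  have hk : ∀ k, g z ≠ oppositePoint k := fun k e => h' k (hi hz (chamberVertex_mem hab k)
    (by rw [e, hg.apply_chamberVertex hab]))
  exact mem_arcNhd_of_mem_equator hE (hk 2) (hk 0) (hk 1)

/-- The open side opposite to vertex `k` is connected and avoids the preimages of `0`, `1`, `∞`, so
its image lies on a single arc. It starts at vertex `i`, whose image is not an end of arc `i`, and
`not_mem_arcNhd` excludes that arc. Applied to both ends this leaves only arc `k`. -/
theorem mem_equatorArc (hg : IsFaceBelyi g) (hab : a ≠ b) {z : ℂ} (hz : z ∈ chamber a b)
    {k : Fin 3} (h : ChamberSide a b k z) : g z ∈ equatorArc k := by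
  have hi := (hg.bij a b hab).injOn
  have hv : z ≠ chamberVertex a b k := by
    rintro rfl
    obtain ⟨h1, h2, h3⟩ := bary_chamberVertex hab k
    unfold ChamberSide at h
    rw [h1, h2, h3] at h
    fin_cases k <;> norm_num at h
  refine ⟨(hg.bdry a b hab).mapsTo ((mem_frontier_chamber_iff_chamberSide hab hz).2 ⟨k, h⟩),
    fun e => hv (hi hz (chamberVertex_mem hab k) (by rw [e, hg.apply_chamberVertex hab])), ?_⟩
  intro i hik
  by_cases hzi : ∃ l, z = chamberVertex a b l
  · obtain ⟨l, rfl⟩ := hzi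
    rw [hg.apply_chamberVertex hab]
    exact oppositePoint_not_mem_arcNhd l i
  push Not at hzi
  obtain ⟨j, hij, hjk⟩ : ∃ j, i ≠ j ∧ j ≠ k := by
    clear h hv; revert i k; decide
  set p := chamberVertex a b i
  set q := chamberVertex a b j
  have hC := convex_chamberSide hab k
  have hp : p ∈ {z | z ∈ chamber a b ∧ ChamberSide a b k z} :=
    ⟨chamberVertex_mem hab i, chamberSide_chamberVertex hab hik⟩
  have hq : q ∈ {z | z ∈ chamber a b ∧ ChamberSide a b k z} :=
    ⟨chamberVertex_mem hab j, chamberSide_chamberVertex hab hjk⟩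
  have hpq : p ≠ q := fun e => hij (oppositePoint_injective (by
    rw [← hg.apply_chamberVertex hab, ← hg.apply_chamberVertex hab]; exact congrArg g e))
  have hS : openSegment ℝ p q ⊆ {z | z ∈ chamber a b ∧ ChamberSide a b k z} :=
    hC.openSegment_subset hp hq
  have hzS : z ∈ openSegment ℝ p q :=
    mem_openSegment_of_ne_left_right (hzi i).symm (hzi j).symm
      (mem_segment_of_chamberSide hab hij hik hjk hz h)
  refine not_mem_arcNhd (convex_openSegment p q).isPreconnected
    (hS.trans fun w hw => chamber_subset_triangle hab hw.1) hg.cont ?_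
    (chamber_subset_triangle hab hp.1) (segment_subset_closure_openSegment (left_mem_segment ℝ p q))
    (hg.apply_chamberVertex hab i) hzS
  intro w hw
  refine hg.exists_mem_arcNhd hab (hS hw).1 ⟨k, (hS hw).2⟩ ?_
  rintro l rfl
  have hl : l = k := by
    by_contra hlk
    have hl : l = i ∨ l = j := by
      clear h hv hzi p q hC hp hq hpq hS hzS hw; revert i j k l; decide
    rcases hl with rfl | rfl
    · exact hpq (left_mem_openSegment_iff.1 hw)
    · exact hpq (right_mem_openSegment_iff.1 hw)
  subst hl
  have h := (hS hw).2
  obtain ⟨h1, h2, h3⟩ := bary_chamberVertex hab l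
  unfold ChamberSide at h
  rw [h1, h2, h3] at h
  fin_cases l <;> norm_num at h

/-- The frontier maps onto the equator, and injectivity on the right triangle puts `z` on the
frontier. If `z` is not a vertex, it lies on some side `j`, and its value lies in exactly one arc
neighbourhood, whose index must be both `j` and `k`. -/
theorem mem_equatorArc_iff (hg : IsFaceBelyi g) (hab : a ≠ b) {z : ℂ} (hz : z ∈ chamber a b)
    {k : Fin 3} : g z ∈ equatorArc k ↔ ChamberSide a b k z := by
  refine ⟨fun h => ?_, hg.mem_equatorArc hab hz⟩
  have hi := (hg.bij a b hab).injOn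
  obtain ⟨w, hw, hwz⟩ := (hg.bdry a b hab).surjOn h.1
  have hwc := (isClosed_chamber a b).frontier_subset hw
  obtain rfl := hi hwc hz hwz
  by_cases hv : ∃ l, w = chamberVertex a b l
  · obtain ⟨l, rfl⟩ := hv
    refine chamberSide_chamberVertex hab ?_
    rintro rfl
    exact h.2.1 (hg.apply_chamberVertex hab l)
  push Not at hv
  obtain ⟨j, hj⟩ := (mem_frontier_chamber_iff_chamberSide hab hz).1 hw
  have hja := hg.mem_equatorArc hab hz hj
  obtain ⟨m, hm⟩ := hg.exists_mem_arcNhd hab hz ⟨j, hj⟩ hv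
  have h1 : m = j := by_contra fun hne => hja.2.2 m hne hm
  have h2 : m = k := by_contra fun hne => h.2.2 m hne hm
  rwa [← h2, h1]

end IsFaceBelyi

end

end Equilateral

/-! ### Comparing two Belyi functions on one face -/

namespace Equilateral

open Set RiemannSphere

/-- The points `z`, `w` of a face lie in the same right triangle, where the Belyi functions `g₁` and
`g₂` take the same value at `z` and `w`. -/
def Transfer (g₁ g₂ : ℂ → OnePoint ℂ) (z w : ℂ) : Prop :=
  ∃ a b, a ≠ b ∧ z ∈ chamber a b ∧ w ∈ chamber a b ∧ g₂ w = g₁ z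

namespace Transfer

variable {g₁ g₂ : ℂ → OnePoint ℂ} {z w w' : ℂ}

theorem symm (h : Transfer g₁ g₂ z w) : Transfer g₂ g₁ w z := by
  obtain ⟨a, b, hab, hz, hw, h⟩ := h
  exact ⟨a, b, hab, hw, hz, h.symm⟩

theorem exists_of_mem (h₁ : IsFaceBelyi g₁) (h₂ : IsFaceBelyi g₂) (hz : z ∈ triangle) :
    ∃ w, Transfer g₁ g₂ z w := by
  have key : ∀ a b, a ≠ b → z ∈ chamber a b → ∃ w, Transfer g₁ g₂ z w := by
    intro a b hab hz
    obtain ⟨w, hw, hwz⟩ := (h₂.bij a b hab).surjOn ((h₁.bij a b hab).mapsTo hz)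
    exact ⟨w, a, b, hab, hz, hw, hwz⟩
  obtain ⟨i, hi | hi⟩ := exists_mem_chamber hz
  · exact key _ _ (fin_three_facts i).2.1 (plusTriangle_eq i ▸ hi)
  · exact key _ _ (fin_three_facts i).1 (minusTriangle_eq i ▸ hi)

theorem mem_triangle (h : Transfer g₁ g₂ z w) : w ∈ triangle := by
  obtain ⟨a, b, hab, -, hw, -⟩ := h
  exact chamber_subset_triangle hab hw

theorem chamberSide (h₁ : IsFaceBelyi g₁) (h₂ : IsFaceBelyi g₂) {a b k : Fin 3} (hab : a ≠ b)
    (hz : z ∈ chamber a b) (hw : w ∈ chamber a b) (h : g₂ w = g₁ z) (hk : ChamberSide a b k z) :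
    ChamberSide a b k w := by
  rw [← h₂.mem_equatorArc_iff hab hw, h]
  exact h₁.mem_equatorArc hab hz hk

/-- Inside one right triangle the order of the coordinates is fixed up to ties. The ties are
equations of sides, and sides are preserved by `chamberSide`. -/
theorem bary_le (h₁ : IsFaceBelyi g₁) (h₂ : IsFaceBelyi g₂) (h : Transfer g₁ g₂ z w) (x y : Fin 3) :
    bary x z ≤ bary y z → bary x w ≤ bary y w := by
  obtain ⟨a, b, hab, hz, hw, h⟩ := h
  have s0 : bary b z = bary a z → bary b w = bary a w := chamberSide h₁ h₂ (k := 0) hab hz hw h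
  have s2 : bary (-a - b) z = bary b z → bary (-a - b) w = bary b w :=
    chamberSide h₁ h₂ (k := 2) hab hz hw h
  obtain ⟨-, z2, z3⟩ := hz
  obtain ⟨-, w2, w3⟩ := hw
  revert x y
  rw [forall_fin_three hab]
  simp only [forall_fin_three hab (p := fun y => bary _ z ≤ bary y z → _)]
  refine ⟨⟨fun _ => le_rfl, fun h => (s0 (le_antisymm z3 h)).ge, fun h => ?_⟩,
    ⟨fun _ => w3, fun _ => le_rfl, fun h => (s2 (le_antisymm z2 h)).ge⟩,
    fun _ => w2.trans w3, fun _ => w2, fun _ => le_rfl⟩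
  rw [s2 (by linarith), s0 (by linarith)]

theorem bary_eq_zero (h₁ : IsFaceBelyi g₁) (h₂ : IsFaceBelyi g₂) (h : Transfer g₁ g₂ z w)
    {j : Fin 3} (hj : bary j z = 0) : bary j w = 0 := by
  obtain ⟨a, b, hab, hz, hw, hzw⟩ := id h
  have s1 : bary (-a - b) z = 0 → bary (-a - b) w = 0 := chamberSide h₁ h₂ (k := 1) hab hz hw hzw
  have hd : bary (-a - b) z = 0 := by
    refine le_antisymm ?_ hz.1
    rw [← hj]
    revert j
    rw [forall_fin_three hab]
    exact ⟨fun _ => hz.2.1.trans hz.2.2, fun _ => hz.2.1, fun _ => le_rfl⟩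
  refine le_antisymm ?_ (mem_triangle_iff.1 (h.mem_triangle) j)
  rw [← s1 hd]
  exact bary_le h₁ h₂ h _ _ (by rw [hd, hj])

theorem mem_chamber (h₁ : IsFaceBelyi g₁) (h₂ : IsFaceBelyi g₂) (h : Transfer g₁ g₂ z w)
    {a b : Fin 3} (hz : z ∈ chamber a b) : w ∈ chamber a b :=
  ⟨mem_triangle_iff.1 h.mem_triangle _, bary_le h₁ h₂ h _ _ hz.2.1, bary_le h₁ h₂ h _ _ hz.2.2⟩

/-- The partner of a point common to several right triangles lies in all of them by `mem_chamber`,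
so injectivity in any one of them decides. -/
theorem unique (h₁ : IsFaceBelyi g₁) (h₂ : IsFaceBelyi g₂) (h : Transfer g₁ g₂ z w)
    (h' : Transfer g₁ g₂ z w') : w = w' := by
  obtain ⟨a, b, hab, hz, hw, hzw⟩ := id h'
  refine (h₂.bij a b hab).injOn (mem_chamber h₁ h₂ h hz) hw ?_
  rw [hzw]
  obtain ⟨_, _, _, _, _, h⟩ := h
  exact h

end Transfer

theorem continuous_of_isClosed_graph {A B : Type*} [TopologicalSpace A] [TopologicalSpace B]
    [CompactSpace B] {f : A → B} (h : IsClosed {p : A × B | f p.1 = p.2}) : Continuous f := by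
  rw [continuous_iff_isClosed]
  intro C hC
  have : f ⁻¹' C = Prod.fst '' ({p : A × B | f p.1 = p.2} ∩ Prod.snd ⁻¹' C) := by
    ext a
    constructor
    · exact fun ha => ⟨(a, f a), ⟨rfl, ha⟩, rfl⟩
    · rintro ⟨⟨a, b⟩, ⟨h1, h2⟩, rfl⟩
      change f a ∈ C
      rw [show f a = b from h1]; exact h2
  rw [this]
  exact isClosedMap_fst_of_compactSpace _ (h.inter (hC.preimage continuous_snd))

/-- By uniqueness the graph is the union, over the finitely many right triangles, of the closed sets
`g₂ w = g₁ z`. A map into a compact space with closed graph is continuous. -/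
theorem exists_continuous_transfer {g₁ g₂ : ℂ → OnePoint ℂ} (h₁ : IsFaceBelyi g₁)
    (h₂ : IsFaceBelyi g₂) :
    ∃ τ : triangle → triangle, Continuous τ ∧ ∀ z : triangle, Transfer g₁ g₂ z (τ z) := by
  choose t ht using fun z : triangle => Transfer.exists_of_mem h₁ h₂ z.2
  have hg₁ : Continuous fun z : triangle => g₁ z := continuousOn_iff_continuous_domRestrict.1 h₁.cont
  have hg₂ : Continuous fun z : triangle => g₂ z := continuousOn_iff_continuous_domRestrict.1 h₂.cont
  refine ⟨fun z => ⟨t z, (ht z).mem_triangle⟩, continuous_of_isClosed_graph ?_, ht⟩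
  have : {p : triangle × triangle | (⟨t p.1, (ht p.1).mem_triangle⟩ : triangle) = p.2} =
      ⋃ a, ⋃ b, ⋃ _ : a ≠ b, {p | (p.1 : ℂ) ∈ chamber a b ∧ (p.2 : ℂ) ∈ chamber a b ∧
        g₂ p.2 = g₁ p.1} := by
    ext ⟨z, w⟩
    simp only [mem_iUnion]
    constructor
    · intro e
      obtain rfl : (⟨t z, (ht z).mem_triangle⟩ : triangle) = w := e
      obtain ⟨a, b, hab, h⟩ := ht z
      exact ⟨a, b, hab, h⟩
    · rintro ⟨a, b, hab, h⟩
      exact Subtype.ext ((ht z).unique h₁ h₂ ⟨a, b, hab, h⟩)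
  rw [this]
  refine isClosed_iUnion_of_finite fun a => isClosed_iUnion_of_finite fun b =>
    isClosed_iUnion_of_finite fun _ => ?_
  have hc := isClosed_chamber a b
  exact (hc.preimage (continuous_subtype_val.comp continuous_fst)).inter
    ((hc.preimage (continuous_subtype_val.comp continuous_snd)).inter
      (isClosed_eq (hg₂.comp continuous_snd) (hg₁.comp continuous_fst)))

theorem sidePoint_mem_chamber_iff (i : Fin 3) (s : ℝ) :
    (sidePoint i s ∈ chamber i (i + 1) ↔ 0 ≤ s ∧ s ≤ 1 / 2) ∧
      (sidePoint i s ∈ chamber (i + 1) i ↔ 1 / 2 ≤ s ∧ s ≤ 1) := by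
  obtain ⟨-, -, -, -, -, -, h1, h2⟩ := fin_three_facts i
  simp only [chamber, mem_ofPred_eq, h1, h2, bary_sidePoint_zero, bary_sidePoint_one,
    bary_sidePoint_two]
  refine ⟨⟨fun h => ⟨by linarith, by linarith⟩, fun h => ⟨le_rfl, by linarith, by linarith⟩⟩,
    ⟨fun h => ⟨by linarith, by linarith⟩, fun h => ⟨le_rfl, by linarith, by linarith⟩⟩⟩

end Equilateral

/-! ### Gluing the comparison maps of the faces -/

namespace TriangleGluing

open Equilateral Set RiemannSphere

variable {G : TriangleGluing}

/-- The restriction to a face of a function on the polyhedron. -/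
noncomputable def onFace (β : G.Polyhedron → OnePoint ℂ) (f : G.Face) (z : ℂ) : OnePoint ℂ :=
  β (G.pt f (toTriangle z))

theorem onFace_coe (β : G.Polyhedron → OnePoint ℂ) (f : G.Face) (z : triangle) :
    onFace β f z = β (G.pt f z) := by rw [onFace, toTriangle_coe]

theorem bijOn_onFace {β : G.Polyhedron → OnePoint ℂ} {f : G.Face} {S : Set ℂ} (hS : S ⊆ triangle)
    {H : Set (OnePoint ℂ)} (h : BijOn (fun z : triangle => β (G.pt f z)) (Subtype.val ⁻¹' S) H) :
    BijOn (onFace β f) S H := by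
  refine ⟨fun z hz => ?_, fun z hz w hw hzw => ?_, fun p hp => ?_⟩
  · rw [onFace, toTriangle_of_mem (hS hz)]
    exact h.mapsTo hz
  · rw [onFace, onFace, toTriangle_of_mem (hS hz), toTriangle_of_mem (hS hw)] at hzw
    exact congrArg Subtype.val (h.injOn hz hw hzw)
  · obtain ⟨z, hz, rfl⟩ := h.surjOn hp
    exact ⟨z, hz, onFace_coe β f z⟩

theorem IsBelyiMap.isFaceBelyi {β : G.Polyhedron → OnePoint ℂ} (h : IsBelyiMap β) (f : G.Face) :
    IsFaceBelyi (onFace β f) := by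
  have hcases : ∀ a b : Fin 3, a ≠ b → b = a + 1 ∨ (a = b + 1 ∧ b ≠ a + 1) := by decide
  have hfr : ∀ a b : Fin 3, a ≠ b → frontier (chamber a b) ⊆ triangle := fun a b hab =>
    (isClosed_chamber a b).frontier_subset.trans (chamber_subset_triangle hab)
  refine ⟨?_, ?_, ?_, ?_, ?_, ?_⟩
  · exact (h.continuous.comp (continuous_pt f)).comp_continuousOn continuousOn_toTriangle
  · intro a b hab
    rcases hcases a b hab with rfl | ⟨rfl, -⟩
    · exact (onFace_coe β f ⟨mid a, mid_mem a⟩).trans (h.white f a)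
    · rw [midpoint_comm]
      exact (onFace_coe β f ⟨mid b, mid_mem b⟩).trans (h.white f b)
  · exact fun a => (onFace_coe β f ⟨corner a, corner_mem a⟩).trans (h.black f a)
  · exact (onFace_coe β f ⟨center, center_mem⟩).trans (h.star f)
  · intro a b hab
    rcases hcases a b hab with rfl | ⟨rfl, hne⟩
    · rw [hemisphere, if_pos rfl]
      exact bijOn_onFace (chamber_subset_triangle hab) (minusTriangle_eq a ▸ h.minus f a)
    · rw [hemisphere, if_neg hne]
      exact bijOn_onFace (chamber_subset_triangle hab) (plusTriangle_eq b ▸ h.plus f b)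
  · intro a b hab
    rcases hcases a b hab with rfl | ⟨rfl, hne⟩
    · exact bijOn_onFace (hfr _ _ hab) (minusTriangle_eq a ▸ h.minus_boundary f a)
    · exact bijOn_onFace (hfr _ _ hab) (plusTriangle_eq b ▸ h.plus_boundary f b)

/-- The maps of the faces respect the gluing: the partner of a side point lies on the same side, at
some parameter `r`. Its glued copy `v` has the value required of a partner of `z'`, hence is that
partner by uniqueness. -/
theorem exists_continuous_transfer {β₁ β₂ : G.Polyhedron → OnePoint ℂ} (h₁ : IsBelyiMap β₁)
    (h₂ : IsBelyiMap β₂) : ∃ η : G.Polyhedron → G.Polyhedron, Continuous η ∧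
      ∀ f (z : triangle), ∃ w : triangle, η (G.pt f z) = G.pt f w ∧
        Transfer (onFace β₁ f) (onFace β₂ f) z w := by
  choose τ hτ hτ' using fun f : G.Face =>
    Equilateral.exists_continuous_transfer (h₁.isFaceBelyi f) (h₂.isFaceBelyi f)
  refine ⟨Quot.lift (fun p => G.pt p.1 (τ p.1 p.2)) ?_, ?_, fun f z => ⟨τ f z, rfl, hτ' f z⟩⟩
  · rintro ⟨f, z⟩ ⟨f', z'⟩ ⟨i, s, hs, hz, rfl, hz'⟩
    dsimp only at hz hz' ⊢
    set f' := (G.glue (f, i)).1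
    set i' := (G.glue (f, i)).2
    have ht := hτ' f z
    have hw := eq_sidePoint (ht.bary_eq_zero (h₁.isFaceBelyi f) (h₂.isFaceBelyi f)
      (j := i + 2) (by rw [hz, bary_sidePoint_two]))
    set r := bary (i + 1) (τ f z : ℂ)
    have hr : r ∈ Icc (0 : ℝ) 1 := by
      have h0 := mem_triangle_iff.1 (τ f z).2
      have h1 := bary_sidePoint_zero i r
      rw [← hw] at h1
      exact ⟨h0 _, by linarith [h0 i]⟩
    have hr' : 1 - r ∈ Icc (0 : ℝ) 1 := ⟨by linarith [hr.2], by linarith [hr.1]⟩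
    let v : triangle := ⟨sidePoint i' (1 - r), sidePoint_mem i' hr'⟩
    have hv : G.pt f (τ f z) = G.pt f' v := pt_sidePoint (f, i) hr _ _ hw rfl
    have hzz : G.pt f z = G.pt f' z' := pt_sidePoint (f, i) hs _ _ hz hz'
    have hval : onFace β₂ f' v = onFace β₁ f' z' := by
      obtain ⟨_, _, _, _, _, h⟩ := ht
      rw [onFace_coe, onFace_coe] at h ⊢
      rw [← hv, ← hzz, h]
    -- It remains to find a common right triangle. The parameters `s` and `r` lie in the same half
    -- of the side, and `s ↦ 1 - s` exchanges the halves, so `z'` and `v` share the opposite half on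
    -- the glued side.
    have key : Transfer (onFace β₁ f') (onFace β₂ f') z' v := by
      have hm {a b : Fin 3} : (z : ℂ) ∈ chamber a b → (τ f z : ℂ) ∈ chamber a b :=
        ht.mem_chamber (h₁.isFaceBelyi f) (h₂.isFaceBelyi f)
      rw [hz, hw] at hm
      rcases le_total s (1 / 2) with h | h
      · have h3 := (sidePoint_mem_chamber_iff i r).1.1
          (hm ((sidePoint_mem_chamber_iff i s).1.2 ⟨hs.1, h⟩))
        refine ⟨i' + 1, i', (fin_three_facts i').2.1, ?_, ?_, hval⟩
        · rw [hz']
          exact (sidePoint_mem_chamber_iff i' _).2.2 ⟨by linarith, by linarith [hs.1]⟩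
        · exact (sidePoint_mem_chamber_iff i' _).2.2 ⟨by linarith, by linarith⟩
      · have h3 := (sidePoint_mem_chamber_iff i r).2.1
          (hm ((sidePoint_mem_chamber_iff i s).2.2 ⟨h, hs.2⟩))
        refine ⟨i', i' + 1, (fin_three_facts i').1, ?_, ?_, hval⟩
        · rw [hz']
          exact (sidePoint_mem_chamber_iff i' _).1.2 ⟨by linarith [hs.2], by linarith⟩
        · exact (sidePoint_mem_chamber_iff i' _).1.2 ⟨by linarith, by linarith⟩
    have hvz : v = τ f' z' :=
      Subtype.ext (key.unique (h₁.isFaceBelyi f') (h₂.isFaceBelyi f') (hτ' f' z'))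
    rw [hv, hvz]
  · exact continuous_quot_lift _ (continuous_sigma fun f => (continuous_pt f).comp (hτ f))

/-- Two Belyi functions of the same triangulation differ by a homeomorphism which preserves the
cells. -/
theorem exists_homeomorph_of_isBelyiMap {β₁ β₂ : G.Polyhedron → OnePoint ℂ} (h₁ : IsBelyiMap β₁)
    (h₂ : IsBelyiMap β₂) : ∃ η : G.Polyhedron ≃ₜ G.Polyhedron, (∀ p, β₂ (η p) = β₁ p) ∧
      (∀ f, η '' range (G.pt f) = range (G.pt f)) ∧
      (∀ f i, η '' (G.pt f '' {z | ∃ s ∈ Icc (0 : ℝ) 1, (z : ℂ) = sidePoint i s}) =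
        G.pt f '' {z | ∃ s ∈ Icc (0 : ℝ) 1, (z : ℂ) = sidePoint i s}) ∧
      ∀ c, η (G.vertex c) = G.vertex c := by
  obtain ⟨η, hc, hη⟩ := exists_continuous_transfer h₁ h₂
  obtain ⟨θ, hc', hθ⟩ := exists_continuous_transfer h₂ h₁
  have hθη : Function.LeftInverse θ η := by
    intro p
    obtain ⟨f, z, rfl⟩ := exists_pt_eq p
    obtain ⟨w, hw, hzw⟩ := hη f z
    obtain ⟨z', hz', hwz⟩ := hθ f w
    rw [hw, hz', Subtype.ext (hwz.unique (h₂.isFaceBelyi f) (h₁.isFaceBelyi f) hzw.symm)]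
  have hηθ : Function.RightInverse θ η := by
    intro p
    obtain ⟨f, z, rfl⟩ := exists_pt_eq p
    obtain ⟨w, hw, hzw⟩ := hθ f z
    obtain ⟨z', hz', hwz⟩ := hη f w
    rw [hw, hz', Subtype.ext (hwz.unique (h₁.isFaceBelyi f) (h₂.isFaceBelyi f) hzw.symm)]
  -- A set of face points stable under transfer between any two Belyi functions is mapped onto
  -- itself: transfer by `η` gives one inclusion, transfer back by `θ` the other.
  have himg : ∀ f (S : Set triangle),
      (∀ (γ₁ γ₂ : G.Polyhedron → OnePoint ℂ), IsBelyiMap γ₁ → IsBelyiMap γ₂ →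
        ∀ z w : triangle, Transfer (onFace γ₁ f) (onFace γ₂ f) z w → z ∈ S → w ∈ S) →
      η '' (G.pt f '' S) = G.pt f '' S := by
    intro f S hS
    apply Subset.antisymm
    · rintro _ ⟨_, ⟨z, hz, rfl⟩, rfl⟩
      obtain ⟨w, hw, hzw⟩ := hη f z
      exact ⟨w, hS _ _ h₁ h₂ z w hzw hz, hw.symm⟩
    · rintro _ ⟨z, hz, rfl⟩
      obtain ⟨w, hw, hzw⟩ := hθ f z
      exact ⟨_, ⟨w, hS _ _ h₂ h₁ z w hzw hz, rfl⟩, by rw [← hw, hηθ]⟩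
  refine ⟨⟨⟨η, θ, hθη, hηθ⟩, hc, hc'⟩, ?_, ?_, ?_, ?_⟩
  · intro p
    obtain ⟨f, z, rfl⟩ := exists_pt_eq p
    obtain ⟨w, hw, _, _, _, _, _, h⟩ := hη f z
    rw [onFace_coe, onFace_coe] at h
    change β₂ (η _) = _
    rw [hw, h]
  · intro f
    rw [← image_univ]
    exact himg f univ fun _ _ _ _ _ _ _ _ => mem_univ _
  · intro f i
    refine himg f _ fun γ₁ γ₂ hγ₁ hγ₂ z w hzw => ?_
    rintro ⟨s, hs, hz⟩
    have h0 := hzw.bary_eq_zero (hγ₁.isFaceBelyi f) (hγ₂.isFaceBelyi f) (j := i + 2)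
      (by rw [hz, bary_sidePoint_two])
    have hw := mem_triangle_iff.1 w.2
    exact ⟨_, ⟨hw _, by linarith [hw i, bary_sum_add i (w : ℂ)]⟩, eq_sidePoint h0⟩
  · rintro ⟨f, i⟩
    change η (G.vertex (f, i)) = _
    obtain ⟨w, hw, hzw⟩ := hη f ⟨corner i, corner_mem i⟩
    have hz : ∀ j, j ≠ i → bary j (w : ℂ) = 0 := fun j hj =>
      hzw.bary_eq_zero (h₁.isFaceBelyi f) (h₂.isFaceBelyi f) (by simp [bary_corner, hj])
    have hs := bary_sum_add i (w : ℂ)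
    obtain ⟨-, n1, n2, -⟩ := fin_three_facts i
    rw [hz _ n1, hz _ n2] at hs
    have : w = ⟨corner i, corner_mem i⟩ := by
      refine Subtype.ext (bary_ext ?_)
      rw [forall_fin_three_add i, hz _ n1, hz _ n2]
      simp [bary_corner, fin_three_facts i]
      linarith
    unfold vertex
    rw [hw, this]

end TriangleGluing

/-! ### Holomorphic maps on Riemann surfaces -/

section RiemannSurface

open Filter Set

variable {X : Type*} [TopologicalSpace X] [ChartedSpace ℂ X]
  {M : Type*} [TopologicalSpace M] [ChartedSpace ℂ M]

theorem mdifferentiableAt_of_mem_maximalAtlas_omega {e : OpenPartialHomeomorph X ℂ}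
    (he : e ∈ IsManifold.maximalAtlas 𝓘(ℂ) ω X) {x : X} (hx : x ∈ e.source) :
    MDifferentiableAt 𝓘(ℂ) 𝓘(ℂ) e x :=
  (contMDiffAt_of_mem_maximalAtlas he hx).mdifferentiableAt (by simp)

theorem mdifferentiableAt_symm_of_mem_maximalAtlas_omega {e : OpenPartialHomeomorph X ℂ}
    (he : e ∈ IsManifold.maximalAtlas 𝓘(ℂ) ω X) {z : ℂ} (hz : z ∈ e.target) :
    MDifferentiableAt 𝓘(ℂ) 𝓘(ℂ) e.symm z :=
  (contMDiffAt_symm_of_mem_maximalAtlas he hz).mdifferentiableAt (by simp)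

theorem mdifferentiableAt_iff_comp_symm {e : OpenPartialHomeomorph X ℂ}
    (he : e ∈ IsManifold.maximalAtlas 𝓘(ℂ) ω X) {x : X} (hx : x ∈ e.source) {u : X → M} :
    MDifferentiableAt 𝓘(ℂ) 𝓘(ℂ) u x ↔ MDifferentiableAt 𝓘(ℂ) 𝓘(ℂ) (u ∘ e.symm) (e x) := by
  constructor
  · intro h
    refine MDifferentiableAt.comp (I' := 𝓘(ℂ)) (e x) ?_
      (mdifferentiableAt_symm_of_mem_maximalAtlas_omega he (e.map_source hx))
    rwa [e.left_inv hx]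
  · intro h
    have h1 : MDifferentiableAt 𝓘(ℂ) 𝓘(ℂ) ((u ∘ e.symm) ∘ e) x :=
      MDifferentiableAt.comp (I' := 𝓘(ℂ)) x h (mdifferentiableAt_of_mem_maximalAtlas_omega he hx)
    refine h1.congr_of_eventuallyEq ?_
    filter_upwards [e.open_source.mem_nhds hx] with y hy
    simp [e.left_inv hy]

theorem mdifferentiableAt_iff_differentiableAt_comp_symm {e : OpenPartialHomeomorph X ℂ}
    (he : e ∈ IsManifold.maximalAtlas 𝓘(ℂ) ω X) {x : X} (hx : x ∈ e.source) {u : X → ℂ} :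
    MDifferentiableAt 𝓘(ℂ) 𝓘(ℂ) u x ↔ DifferentiableAt ℂ (u ∘ e.symm) (e x) := by
  rw [mdifferentiableAt_iff_comp_symm he hx, mdifferentiableAt_iff_differentiableAt]

variable [IsManifold 𝓘(ℂ) ω X]

/-- A homeomorphism onto an open subset of the plane which is holomorphic is a chart. -/
theorem mem_maximalAtlas_of_mdifferentiableAt {e : OpenPartialHomeomorph X ℂ}
    (he : ∀ x ∈ e.source, MDifferentiableAt 𝓘(ℂ) 𝓘(ℂ) e x) :
    e ∈ IsManifold.maximalAtlas 𝓘(ℂ) ω X := by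
  -- The transitions from atlas charts to `e` are holomorphic homeomorphisms between plane open
  -- sets; `differentiableOn_symm` makes their inverses holomorphic too.
  have key : ∀ x, DifferentiableOn ℂ ((chartAt ℂ x).symm.trans e)
      ((chartAt ℂ x).symm.trans e).source := by
    intro x z hz
    obtain ⟨h1, h2⟩ := hz
    have h3 := (mdifferentiableAt_iff_differentiableAt_comp_symm
      (IsManifold.chart_mem_maximalAtlas x) ((chartAt ℂ x).map_target h1)).1 (he _ h2)
    rw [(chartAt ℂ x).right_inv h1] at h3
    exact h3.differentiableWithinAt
  refine e.mem_maximalAtlas_of_contMDiffOn (fun x hx => ?_) (fun z hz => ?_)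
  · set φ := chartAt ℂ x
    have hxφ : x ∈ φ.source := mem_chart_source ℂ x
    have hmem : φ x ∈ (φ.symm.trans e).source := ⟨φ.map_source hxφ, by
      change φ.symm (φ x) ∈ e.source; rwa [φ.left_inv hxφ]⟩
    have h1 : ContMDiffAt 𝓘(ℂ) 𝓘(ℂ) ω (φ.symm.trans e) (φ x) :=
      (((key x).contDiffOn (φ.symm.trans e).open_source).contDiffAt
        ((φ.symm.trans e).open_source.mem_nhds hmem)).contMDiffAt
    have h2 := h1.comp x (contMDiffAt_of_mem_maximalAtlas
      (IsManifold.chart_mem_maximalAtlas x) hxφ)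
    refine (h2.congr_of_eventuallyEq ?_).contMDiffWithinAt
    filter_upwards [φ.open_source.mem_nhds hxφ] with y hy
    simp [φ, φ.left_inv hy]
  · set x := e.symm z
    set φ := chartAt ℂ x
    have hxφ : x ∈ φ.source := mem_chart_source ℂ x
    have hmem : z ∈ (φ.symm.trans e).target := ⟨hz, hxφ⟩
    have h1 : ContMDiffAt 𝓘(ℂ) 𝓘(ℂ) ω (φ.symm.trans e).symm z :=
      ((((φ.symm.trans e).differentiableOn_symm (key x)).contDiffOn
        (φ.symm.trans e).open_target).contDiffAt
        ((φ.symm.trans e).open_target.mem_nhds hmem)).contMDiffAt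
    have h3 : ContMDiffAt 𝓘(ℂ) 𝓘(ℂ) ω φ.symm ((φ.symm.trans e).symm z) :=
      contMDiffAt_symm_of_mem_maximalAtlas (IsManifold.chart_mem_maximalAtlas x)
        (φ.map_source hxφ)
    have h2 := h3.comp z h1
    refine (h2.congr_of_eventuallyEq ?_).contMDiffWithinAt
    filter_upwards [(φ.symm.trans e).open_target.mem_nhds hmem] with y hy
    exact (φ.left_inv hy.2).symm

namespace RiemannSphere

open Equilateral

theorem mdifferentiableAt_iff_chart {φ : OpenPartialHomeomorph (OnePoint ℂ) ℂ}
    (hφ : φ ∈ atlas ℂ (OnePoint ℂ)) {f : M → OnePoint ℂ} {x : M} (hx : f x ∈ φ.source) :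
    MDifferentiableAt 𝓘(ℂ) 𝓘(ℂ) f x ↔
      ContinuousAt f x ∧ MDifferentiableAt 𝓘(ℂ) 𝓘(ℂ) (φ ∘ f) x := by
  have hφ' : φ ∈ IsManifold.maximalAtlas 𝓘(ℂ) ω (OnePoint ℂ) := IsManifold.subset_maximalAtlas hφ
  constructor
  · intro h
    exact ⟨h.continuousAt, MDifferentiableAt.comp (I' := 𝓘(ℂ)) x
      (mdifferentiableAt_of_mem_maximalAtlas_omega hφ' hx) h⟩
  · rintro ⟨hc, h⟩
    have h1 : MDifferentiableAt 𝓘(ℂ) 𝓘(ℂ) (φ.symm ∘ (φ ∘ f)) x :=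
      MDifferentiableAt.comp (I' := 𝓘(ℂ)) x
        (mdifferentiableAt_symm_of_mem_maximalAtlas_omega hφ' (φ.map_source hx)) h
    refine h1.congr_of_eventuallyEq ?_
    filter_upwards [hc.preimage_mem_nhds (φ.open_source.mem_nhds hx)] with y hy
    simp [φ.left_inv hy]

theorem chartZero_mem_atlas : chartZero ∈ atlas ℂ (OnePoint ℂ) := Or.inl rfl

theorem coe_mem_chartZero_source (z : ℂ) : (z : OnePoint ℂ) ∈ chartZero.source := by
  rw [chartZero_source]; exact mem_range_self z

theorem inversion_mem_equator {p : OnePoint ℂ} (hp : p ∈ equator) : inversion p ∈ equator := by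
  induction p using OnePoint.rec with
  | infty => rw [inversion_infty, coe_mem_equator]; simp
  | coe z =>
    rw [coe_mem_equator] at hp
    rw [inversion_coe]
    split_ifs
    · exact infty_mem_equator
    · rw [coe_mem_equator, Complex.inv_im, hp]; simp

/-- Both `z` and `1 / z` are real on the equator, so Painlevé's argument works uniformly, poles
included. -/
theorem im_eq_zero_of_mem_equator {φ : OpenPartialHomeomorph (OnePoint ℂ) ℂ}
    (hφ : φ ∈ atlas ℂ (OnePoint ℂ)) {p : OnePoint ℂ} (hp : p ∈ φ.source) (h : p ∈ equator) :
    (φ p).im = 0 := by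
  rcases hφ with rfl | rfl
  · rw [chartZero_source] at hp
    obtain ⟨z, rfl⟩ := hp
    rwa [chartZero_coe, ← coe_mem_equator]
  · rw [chartInfty_source] at hp
    obtain ⟨z, hz⟩ := hp
    have h1 := inversion_mem_equator h
    rw [← hz] at h1
    rwa [chartInfty_apply, ← hz, chartZero_coe, ← coe_mem_equator]

/-- A continuous map to the sphere is holomorphic at an isolated singularity. -/
theorem mdifferentiableAt_of_punctured {f : X → OnePoint ℂ} {x : X} (hc : ContinuousAt f x)
    (h : ∀ᶠ y in 𝓝[≠] x, MDifferentiableAt 𝓘(ℂ) 𝓘(ℂ) f y) : MDifferentiableAt 𝓘(ℂ) 𝓘(ℂ) f x := by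
  set φ := chartAt ℂ (f x)
  have hφ : φ ∈ atlas ℂ (OnePoint ℂ) := chart_mem_atlas ℂ (f x)
  have hfx : f x ∈ φ.source := mem_chart_source ℂ (f x)
  set e := chartAt ℂ x
  have hx : x ∈ e.source := mem_chart_source ℂ x
  have he : e ∈ IsManifold.maximalAtlas 𝓘(ℂ) ω X := IsManifold.chart_mem_maximalAtlas x
  refine (mdifferentiableAt_iff_chart hφ hfx).2 ⟨hc, ?_⟩
  rw [mdifferentiableAt_iff_differentiableAt_comp_symm he hx]
  refine (Complex.analyticAt_of_differentiable_on_punctured_nhds_of_continuousAt ?_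
    ?_).differentiableAt
  · have h1 : ∀ᶠ y in 𝓝 x, y ≠ x → DifferentiableAt ℂ ((φ ∘ f) ∘ e.symm) (e y) := by
      filter_upwards [eventually_nhdsWithin_iff.1 h, e.open_source.mem_nhds hx,
        hc.preimage_mem_nhds (φ.open_source.mem_nhds hfx)] with y h1 h2 h3 h4
      rw [← mdifferentiableAt_iff_differentiableAt_comp_symm he h2]
      exact ((mdifferentiableAt_iff_chart hφ h3).1 (h1 h4)).2
    have h2 := (e.tendsto_symm hx).eventually h1
    rw [eventually_nhdsWithin_iff]
    filter_upwards [h2, e.open_target.mem_nhds (e.map_source hx)] with w hw hw' hne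
    rw [e.right_inv hw'] at hw
    refine hw fun hwx => hne ?_
    rw [mem_singleton_iff, ← hwx, e.right_inv hw']
  · have h1 : ContinuousAt (φ ∘ f) (e.symm (e x)) := by
      rw [e.left_inv hx]
      exact (φ.continuousAt hfx).comp hc
    exact h1.comp (e.continuousAt_symm (e.map_source hx))

/-- A continuous function on a Riemann surface which is holomorphic at the points which a
holomorphic map `f` to the sphere does not map to the equator is holomorphic. -/
theorem mdifferentiableAt_of_not_mem_equator {f : X → OnePoint ℂ}
    (hf : MDifferentiable 𝓘(ℂ) 𝓘(ℂ) f) (hn : ∀ x, ¬ ∀ᶠ y in 𝓝 x, f y = f x) {U : Set X}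
    (hU : IsOpen U) {u : X → ℂ} (hu : ContinuousOn u U)
    (h : ∀ x ∈ U, f x ∉ equator → MDifferentiableAt 𝓘(ℂ) 𝓘(ℂ) u x) {x : X} (hxU : x ∈ U) :
    MDifferentiableAt 𝓘(ℂ) 𝓘(ℂ) u x := by
  set φ := chartAt ℂ (f x)
  have hφ : φ ∈ atlas ℂ (OnePoint ℂ) := chart_mem_atlas ℂ (f x)
  have hfx : f x ∈ φ.source := mem_chart_source ℂ (f x)
  set e := chartAt ℂ x
  have hx : x ∈ e.source := mem_chart_source ℂ x
  have he : e ∈ IsManifold.maximalAtlas 𝓘(ℂ) ω X := IsManifold.chart_mem_maximalAtlas x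
  have hc := (hf x).continuousAt
  have hev : ∀ {p : X → Prop}, (∀ᶠ y in 𝓝 x, p y) → ∀ᶠ w in 𝓝 (e x), p (e.symm w) :=
    fun hp => (e.tendsto_symm hx).eventually hp
  have hsrc : ∀ᶠ y in 𝓝 x, f y ∈ φ.source :=
    hc.preimage_mem_nhds (φ.open_source.mem_nhds hfx)
  have htgt : ∀ᶠ w in 𝓝 (e x), w ∈ e.target := e.open_target.mem_nhds (e.map_source hx)
  rw [mdifferentiableAt_iff_differentiableAt_comp_symm he hx]
  -- Read in charts, the preimage of the equator lies in the real locus of the nonconstant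
  -- holomorphic function `F`.
  refine differentiableAt_of_differentiableAt_of_im_ne_zero (F := (φ ∘ f) ∘ e.symm) ?_ ?_ ?_ ?_
  · rw [Complex.analyticAt_iff_eventually_differentiableAt]
    filter_upwards [hev hsrc, htgt] with w h1 h2
    have h3 := (mdifferentiableAt_iff_differentiableAt_comp_symm he (e.map_target h2)).1
      ((mdifferentiableAt_iff_chart hφ h1).1 (hf _)).2
    rwa [e.right_inv h2] at h3
  · intro hconst
    refine hn x ?_
    have h1 := (e.continuousAt hx).eventually hconst
    filter_upwards [h1, hsrc, e.open_source.mem_nhds hx] with y h1 h2 h3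
    simp only [Function.comp_apply, e.left_inv h3, e.left_inv hx] at h1
    exact φ.injOn h2 hfx h1
  · filter_upwards [hev (hU.mem_nhds hxU), htgt] with w h1 h2
    exact (hu.continuousAt (hU.mem_nhds h1)).comp (e.continuousAt_symm h2)
  · filter_upwards [hev (hU.mem_nhds hxU), hev hsrc, htgt] with w h1 h2 h3 h4
    have h5 := (mdifferentiableAt_iff_differentiableAt_comp_symm he (e.map_target h3)).1
      (h _ h1 fun h6 => h4 (im_eq_zero_of_mem_equator hφ h2 h6))
    rwa [e.right_inv h3] at h5

/-- The restrictions of a holomorphic map to open sets which it maps homeomorphically onto open sets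
give holomorphic charts. -/
theorem _root_.IsC2.of_mdifferentiable {β : X → OnePoint ℂ} (hβ : MDifferentiable 𝓘(ℂ) 𝓘(ℂ) β) :
    IsC2 β := by
  refine ⟨fun g hg φ hφ => mem_maximalAtlas_of_mdifferentiableAt fun x hx => ?_, hβ⟩
  obtain ⟨h1, h2⟩ := hx
  have h3 : β x ∈ φ.source := by rw [← hg h1]; exact h2
  refine ((mdifferentiableAt_iff_chart hφ h3).1 (hβ x)).2.congr_of_eventuallyEq ?_
  filter_upwards [g.open_source.mem_nhds h1] with y hy
  simp [hg hy]

end RiemannSphere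

end RiemannSurface

/-! ### Nonconstancy, and holomorphy across an edge -/

namespace Equilateral

open Filter Set RiemannSphere

theorem mem_openTriangle_of_not_mem_equator {z : ℂ} (hz : z ∈ triangle) (h : triBelyi z ∉ equator) :
    z ∈ openTriangle ∧ z ≠ center := by
  refine ⟨fun j => ?_, ?_⟩
  · refine lt_of_le_of_ne (mem_triangle_iff.1 hz j) fun hj => h ?_
    exact (triBelyi_mem_equator_iff hz).2 (Or.inl ⟨j, hj.symm⟩)
  · rintro rfl
    exact h (triBelyi_center ▸ infty_mem_equator)

/-- The point lies in a right triangle on which the function is injective. That triangle is convex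
with more than one point, so it contains other points arbitrarily near. -/
theorem not_eventually_triBelyi_eq (z : triangle) :
    ¬ ∀ᶠ w : triangle in 𝓝 z, triBelyi w = triBelyi z := by
  intro h
  obtain ⟨a, b, hab, hz, hinj⟩ : ∃ a b : Fin 3, a ≠ b ∧ (z : ℂ) ∈ chamber a b ∧
      InjOn triBelyi (chamber a b) := by
    obtain ⟨i, hi | hi⟩ := exists_mem_chamber z.2
    · exact ⟨_, _, (fin_three_facts i).2.1, plusTriangle_eq i ▸ hi,
        plusTriangle_eq i ▸ (bijOn_triBelyi_plus i).injOn⟩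
    · exact ⟨_, _, (fin_three_facts i).1, minusTriangle_eq i ▸ hi,
        minusTriangle_eq i ▸ (bijOn_triBelyi_minus i).injOn⟩
  obtain ⟨q, hq, hqz⟩ : ∃ q ∈ chamber a b, q ≠ (z : ℂ) := by
    by_contra! hc
    have h1 := hc _ (chamberVertex_mem hab 0)
    have h2 := hc _ (chamberVertex_mem hab 1)
    have h3 := (bary_chamberVertex hab 0).2.1
    rw [h1, ← h2, (bary_chamberVertex hab 1).2.1] at h3
    norm_num at h3
  have hconv : Convex ℝ (chamber a b) := by
    rw [← convexHull_eq_chamber hab]; exact convex_convexHull ℝ _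
  have hγ : ∀ t ∈ Ioo (0 : ℝ) 1, AffineMap.lineMap (z : ℂ) q t ∈ chamber a b := fun t ht =>
    hconv.lineMap_mem hz hq ⟨ht.1.le, ht.2.le⟩
  have htend : Tendsto (fun t : ℝ => (AffineMap.lineMap (z : ℂ) q t : ℂ)) (𝓝[>] 0) (𝓝 (z : ℂ)) := by
    have : Continuous fun t : ℝ => (AffineMap.lineMap (z : ℂ) q t : ℂ) := AffineMap.lineMap_continuous
    have h1 := this.tendsto 0
    rw [AffineMap.lineMap_apply_zero] at h1
    exact h1.mono_left nhdsWithin_le_nhds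
  rw [nhds_subtype, eventually_comap] at h
  have h2 := (htend.eventually h).and (Ioo_mem_nhdsGT (zero_lt_one' ℝ))
  obtain ⟨t, h3, ht⟩ := h2.exists
  have h4 := hγ t ht
  have h5 := hinj h4 hz (h3 ⟨_, chamber_subset_triangle hab h4⟩ rfl)
  rw [AffineMap.lineMap_eq_left_iff] at h5
  rcases h5 with h5 | h5
  · exact hqz h5.symm
  · exact ht.1.ne' h5

theorem center_ne_sectorPoint (i : Fin 3) {w : ℂ} (hw : w ∈ kite) : sectorPoint i w ≠ center := by
  intro h
  have h1 : sectorCoord i center ∈ kite := by rw [← h, sectorCoord_sectorPoint]; exact hw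
  have h2 := ((sectorCoord_mem_kite_iff i center_mem).1 h1).1
  rw [bary_center, bary_center] at h2
  exact lt_irrefl _ h2

theorem sectorPoint_mem_openTriangle (i : Fin 3) {w : ℂ} (hw : w ∈ kite) (h : 0 < w.im) :
    sectorPoint i w ∈ openTriangle := by
  have hm := sectorPoint_mem_triangle i hw h.le
  have h0 : 0 < bary (i + 2) (sectorPoint i w) := by
    rw [(bary_sectorPoint i w).1]
    have := SchwarzChristoffel.sqrt_three_pos
    positivity
  have h1 : sectorCoord i (sectorPoint i w) ∈ kite := by rw [sectorCoord_sectorPoint]; exact hw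
  obtain ⟨h2, h3⟩ := (sectorCoord_mem_kite_iff i hm).1 h1
  change ∀ j, 0 < bary j _
  rw [forall_fin_three_add i]
  exact ⟨h0.trans h3, h0.trans h2, h0⟩

end Equilateral

namespace RiemannSphere

open Filter

theorem mdifferentiableAt_of_eventually_eq_coe {M : Type*} [TopologicalSpace M] [ChartedSpace ℂ M]
    {f : M → OnePoint ℂ} {F : M → ℂ} {x : M} (h : ∀ᶠ y in 𝓝 x, f y = (F y : OnePoint ℂ))
    (hF : MDifferentiableAt 𝓘(ℂ) 𝓘(ℂ) F x) : MDifferentiableAt 𝓘(ℂ) 𝓘(ℂ) f x := by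
  have h1 : MDifferentiableAt 𝓘(ℂ) 𝓘(ℂ) (fun y => (F y : OnePoint ℂ)) x := by
    refine (mdifferentiableAt_iff_chart (f := fun y => (F y : OnePoint ℂ)) chartZero_mem_atlas
      (coe_mem_chartZero_source _)).2
      ⟨ContinuousAt.comp (f := F) OnePoint.continuous_coe.continuousAt hF.continuousAt, ?_⟩
    refine hF.congr_of_eventuallyEq (Eventually.of_forall fun y => ?_)
    exact chartZero_coe _
  exact h1.congr_of_eventuallyEq h

end RiemannSphere

namespace TriangleGluing

open Equilateral Set RiemannSphere Filter

variable {G : TriangleGluing}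

theorem eventually_pt_of_mem_openTriangle {e : OpenPartialHomeomorph G.Polyhedron ℂ} {f : G.Face}
    (he : ∀ z : triangle, (z : ℂ) ∈ openTriangle → G.pt f z ∈ e.source ∧ e (G.pt f z) = z) {z : ℂ}
    (hz : z ∈ openTriangle) :
    ∀ᶠ w in 𝓝 z, w ∈ openTriangle ∧ G.belyi (e.symm w) = triBelyi w := by
  filter_upwards [isOpen_openTriangle.mem_nhds hz] with w hw
  obtain ⟨h1, h2⟩ := he ⟨w, openTriangle_subset hw⟩ hw
  refine ⟨hw, ?_⟩
  rw [show e.symm w = G.pt f ⟨w, openTriangle_subset hw⟩ by rw [← e.left_inv h1, h2]]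
  rfl

/-- In the Euclidean coordinate near the interior of a side the Belyi function is holomorphic. -/
theorem differentiableOn_belyi_edgeParam (c : G.Face × Fin 3) : ∃ F : ℂ → ℂ,
    DifferentiableOn ℂ F kite ∧ ∀ w ∈ kite, G.belyi (edgeParam c w) = (F w : OnePoint ℂ) := by
  have hup : ∀ w ∈ kite, 0 ≤ w.im →
      G.belyi (edgeParam c w) = (triBelyiFinite (sectorPoint c.2 w) : OnePoint ℂ) := by
    intro w hw h
    have hm := sectorPoint_mem_triangle c.2 hw h
    rw [edgeParam, if_pos h, toTriangle_of_mem hm, belyi_pt,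
      triBelyi_of_ne hm (center_ne_sectorPoint _ hw)]
  have hdown : ∀ w ∈ kite, w.im ≤ 0 → G.belyi (edgeParam c w) =
      (triBelyiFinite (sectorPoint (G.glue c).2 (1 - w)) : OnePoint ℂ) := by
    intro w hw h
    have hw' := one_sub_mem_kite hw
    have hm := sectorPoint_mem_triangle (G.glue c).2 hw' (by simpa using h)
    rw [edgeParam_of_im_nonpos c hw h, toTriangle_of_mem hm, belyi_pt,
      triBelyi_of_ne hm (center_ne_sectorPoint _ hw')]
  have hF : ∀ w ∈ kite, G.belyi (edgeParam c w) =
      (chartZero (G.belyi (edgeParam c w)) : OnePoint ℂ) := by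
    intro w hw
    rcases le_total 0 w.im with h | h
    · rw [hup w hw h, chartZero_coe]
    · rw [hdown w hw h, chartZero_coe]
  refine ⟨fun w => chartZero (G.belyi (edgeParam c w)), ?_, hF⟩
  -- The halves of the kite come from different sides, possibly of different faces; across the real
  -- axis only continuity is known, and Painlevé's theorem supplies the rest.
  refine differentiableOn_of_continuousOn_of_im_ne_zero isOpen_kite ?_ ?_
  · refine chartZero.continuousOn.comp
      (continuous_belyi.comp_continuousOn (continuousOn_edgeParam c)) fun w hw => ?_
    rw [hF w hw]
    exact coe_mem_chartZero_source _
  · intro w hw h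
    have hsp : ∀ i, Differentiable ℂ (sectorPoint i) := fun i => by unfold sectorPoint; fun_prop
    rcases lt_or_gt_of_ne h with h | h
    · have hw' := one_sub_mem_kite hw
      have h1 : DifferentiableAt ℂ (fun w => triBelyiFinite (sectorPoint (G.glue c).2 (1 - w))) w :=
        DifferentiableAt.comp (g := triBelyiFinite) w (differentiableAt_triBelyiFinite
          (sectorPoint_mem_openTriangle _ hw' (by simpa using h)) (center_ne_sectorPoint _ hw'))
          ((hsp _).comp (differentiable_id.const_sub 1)).differentiableAt
      refine h1.congr_of_eventuallyEq ?_
      filter_upwards [isOpen_kite.mem_nhds hw,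
        (isOpen_lt Complex.continuous_im continuous_const).mem_nhds h] with v hv hv'
      rw [hdown v hv (le_of_lt hv'), chartZero_coe]
    · have h1 : DifferentiableAt ℂ (fun w => triBelyiFinite (sectorPoint c.2 w)) w :=
        DifferentiableAt.comp (g := triBelyiFinite) w (differentiableAt_triBelyiFinite
          (sectorPoint_mem_openTriangle _ hw h) (center_ne_sectorPoint _ hw)) (hsp _).differentiableAt
      refine h1.congr_of_eventuallyEq ?_
      filter_upwards [isOpen_kite.mem_nhds hw,
        (isOpen_lt continuous_const Complex.continuous_im).mem_nhds h] with v hv hv'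
      rw [hup v hv (le_of_lt hv'), chartZero_coe]

end TriangleGluing

/-! ### The structure of the equilateral triangulation and holomorphy of `belyi` -/

namespace Triangulation

open TriangleGluing Equilateral Set RiemannSphere Filter

variable {G : TriangleGluing} {X : Type*} [TopologicalSpace X]

theorem mem_source_transOpenPartialHomeomorph (T : Triangulation G X)
    (e : OpenPartialHomeomorph G.Polyhedron ℂ) {p : G.Polyhedron} :
    T p ∈ (T.symm.transOpenPartialHomeomorph e).source ↔ p ∈ e.source := by
  change T.symm (T p) ∈ e.source ↔ _
  rw [T.symm_apply_apply]

theorem not_eventually_belyi_eq (T : Triangulation G X) (x : X) :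
    ¬ ∀ᶠ y in 𝓝 x, (G.belyi ∘ T.symm) y = (G.belyi ∘ T.symm) x := by
  intro h
  obtain ⟨p, rfl⟩ := T.surjective x
  obtain ⟨f, z, rfl⟩ := exists_pt_eq p
  refine not_eventually_triBelyi_eq z ?_
  have h1 : Continuous fun w => T (G.pt f w) := T.continuous.comp (continuous_pt f)
  filter_upwards [(h1.tendsto z).eventually h] with w hw
  simpa only [Function.comp_apply, T.symm_apply_apply, belyi_pt] using hw

variable [ChartedSpace ℂ X]

/-- If the Belyi function is holomorphic, then functions are holomorphic at the interior points of
the right triangles when they are holomorphic in the Euclidean coordinate. -/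
theorem mdifferentiableAt_of_pt {T : Triangulation G X}
    (hf : MDifferentiable 𝓘(ℂ) 𝓘(ℂ) (G.belyi ∘ T.symm)) {g : G.Face} {z : triangle}
    (hz : triBelyi z ∉ equator) {u : X → ℂ} {H : ℂ → ℂ} (hH : DifferentiableAt ℂ H z)
    (h : ∀ᶠ w : triangle in 𝓝 z, u (T (G.pt g w)) = H w) :
    MDifferentiableAt 𝓘(ℂ) 𝓘(ℂ) u (T (G.pt g z)) := by
  obtain ⟨hzo, hzc⟩ := mem_openTriangle_of_not_mem_equator z.2 hz
  obtain ⟨e, -, he, he'⟩ := exists_faceChart g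
  obtain ⟨h1, h2⟩ := he z hzo
  set x := T (G.pt g z) with hx
  set κ : X → ℂ := fun y => e (T.symm y)
  have hκx : κ x = z := by simp only [κ, hx, T.symm_apply_apply, h2]
  have hκc : Tendsto κ (𝓝 x) (𝓝 (z : ℂ)) := by
    rw [← hκx]
    refine ContinuousAt.comp (x := x) (e.continuousAt ?_) T.symm.continuous.continuousAt
    rwa [hx, T.symm_apply_apply]
  have hpt : ∀ᶠ y in 𝓝 x, ∃ w : triangle, (w : ℂ) = κ y ∧ y = T (G.pt g w) := by
    have h3 : e.source ∈ 𝓝 (T.symm x) := by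
      rw [hx, T.symm_apply_apply]; exact e.open_source.mem_nhds h1
    filter_upwards [T.symm.continuous.continuousAt.preimage_mem_nhds h3] with y hy
    obtain ⟨g', w, hw⟩ := exists_pt_eq (T.symm y)
    have hy' : T.symm y ∈ e.source := hy
    rw [← hw] at hy'
    obtain ⟨rfl, hwo⟩ := he' g' w hy'
    refine ⟨w, ?_, by rw [hw, T.apply_symm_apply]⟩
    simp only [κ, ← hw, (he w hwo).2]
  have han : AnalyticAt ℂ triBelyiFinite z := by
    rw [Complex.analyticAt_iff_eventually_differentiableAt]
    filter_upwards [isOpen_openTriangle.mem_nhds hzo, isOpen_ne.mem_nhds hzc] with w hw hw'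
    exact differentiableAt_triBelyiFinite hw hw'
  obtain ⟨d, hd, hd'⟩ := hasDerivAt_triBelyiFinite hzo hzc
  obtain ⟨L, hL0, hL, hLl, -⟩ := han.exists_local_inverse (by rwa [hd'.deriv])
  have hval : (G.belyi ∘ T.symm) x = (triBelyiFinite z : OnePoint ℂ) := by
    simp only [Function.comp_apply, hx, T.symm_apply_apply, belyi_pt]
    exact triBelyi_of_ne z.2 hzc
  have h4 := ((mdifferentiableAt_iff_chart chartZero_mem_atlas
    (by rw [hval]; exact coe_mem_chartZero_source _)).1 (hf x)).2
  -- The Euclidean coordinate is a local holomorphic inverse of `triBelyiFinite` composed with the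
  -- Belyi function, which is holomorphic on `X` by hypothesis.
  have hκ : MDifferentiableAt 𝓘(ℂ) 𝓘(ℂ) κ x := by
    have h5 : MDifferentiableAt 𝓘(ℂ) 𝓘(ℂ) (L ∘ (chartZero ∘ (G.belyi ∘ T.symm))) x := by
      refine MDifferentiableAt.comp (I' := 𝓘(ℂ)) x ?_ h4
      simp only [Function.comp_apply] at hval ⊢
      rw [hval, chartZero_coe]
      exact hL.differentiableAt.mdifferentiableAt
    refine h5.congr_of_eventuallyEq ?_
    filter_upwards [hpt, hκc.eventually (hLl.and (isOpen_ne.mem_nhds hzc))] with y hy hy'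
    obtain ⟨w, hw, rfl⟩ := hy
    rw [← hw] at hy' ⊢
    simp only [Function.comp_apply, T.symm_apply_apply, belyi_pt]
    rw [triBelyi_of_ne w.2 hy'.2, chartZero_coe, hy'.1]
  rw [← hκx] at hH
  refine (MDifferentiableAt.comp (I' := 𝓘(ℂ)) x hH.mdifferentiableAt hκ).congr_of_eventuallyEq ?_
  rw [nhds_subtype, eventually_comap] at h
  filter_upwards [hpt, hκc.eventually h] with y hy hy'
  obtain ⟨w, hw, rfl⟩ := hy
  rw [Function.comp_apply, ← hw]
  exact hy' w hw

theorem mdifferentiableAt_belyi_of_chart {T : Triangulation G X}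
    {e : OpenPartialHomeomorph G.Polyhedron ℂ}
    (he : T.symm.transOpenPartialHomeomorph e ∈ IsManifold.maximalAtlas 𝓘(ℂ) ω X)
    {p : G.Polyhedron} (hp : p ∈ e.source) {F : ℂ → ℂ} (hF : DifferentiableAt ℂ F (e p))
    (h : ∀ᶠ w in 𝓝 (e p), G.belyi (e.symm w) = (F w : OnePoint ℂ)) :
    MDifferentiableAt 𝓘(ℂ) 𝓘(ℂ) (G.belyi ∘ T.symm) (T p) := by
  rw [mdifferentiableAt_iff_comp_symm he ((mem_source_transOpenPartialHomeomorph T e).2 hp)]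
  have h1 : (T.symm.transOpenPartialHomeomorph e) (T p) = e p := by
    change e (T.symm (T p)) = _
    rw [T.symm_apply_apply]
  rw [h1]
  refine mdifferentiableAt_of_eventually_eq_coe ?_ hF.mdifferentiableAt
  filter_upwards [h] with w hw
  rw [← hw]
  change G.belyi (T.symm (T (e.symm w))) = _
  rw [T.symm_apply_apply]

variable [IsManifold 𝓘(ℂ) ω X]

/-- For the structure of an equilateral triangulation its Belyi function is holomorphic. -/
theorem mdifferentiable_belyi_of_isC1 [T1Space X] {T : Triangulation G X} (hT : T.IsC1) :
    MDifferentiable 𝓘(ℂ) 𝓘(ℂ) (G.belyi ∘ T.symm) := by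
  have := G.finite_face
  -- The exceptional points: the centres, where `belyi` has its poles, and the vertices, where the
  -- charts are not Euclidean. Being finitely many, they are isolated and removable.
  set S : Set X := range (fun f => T (G.pt f ⟨center, center_mem⟩)) ∪
    range (fun c => T (G.vertex c))
  have hS : S.Finite := (finite_range _).union (finite_range _)
  have key : ∀ x, x ∉ S → MDifferentiableAt 𝓘(ℂ) 𝓘(ℂ) (G.belyi ∘ T.symm) x := by
    intro x hx
    obtain ⟨p, rfl⟩ := T.surjective x
    obtain ⟨f, z, rfl⟩ := exists_pt_eq p
    rcases mem_openTriangle_or z with hz | ⟨i, s, hs, hz⟩ | ⟨i, hz⟩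
    · have hc : (z : ℂ) ≠ Equilateral.center := fun hc => hx (Or.inl ⟨f, by
        rw [show z = ⟨Equilateral.center, center_mem⟩ from Subtype.ext hc]⟩)
      obtain ⟨e, hef, he, -⟩ := exists_faceChart f
      obtain ⟨h1, h2⟩ := he z hz
      refine mdifferentiableAt_belyi_of_chart (F := triBelyiFinite) (hT.2 e (Or.inl hef)) h1 ?_ ?_
      · rw [h2]; exact differentiableAt_triBelyiFinite hz hc
      · rw [h2]
        filter_upwards [eventually_pt_of_mem_openTriangle he hz, isOpen_ne.mem_nhds hc]
          with w hw hwc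
        rw [hw.2, triBelyi_of_ne (openTriangle_subset hw.1) hwc]
    · obtain ⟨e, hef, het, hsymm, he⟩ := exists_edgeChart (f, i)
      have hk : sectorCoord i z ∈ kite := by
        rw [hz, sectorCoord_sidePoint]; exact ofReal_mem_kite hs
      obtain ⟨h1, h2⟩ := he z hk
      obtain ⟨F, hF, hF'⟩ := differentiableOn_belyi_edgeParam (f, i)
      have hkn : kite ∈ 𝓝 (e (G.pt f z)) := by rw [h2]; exact isOpen_kite.mem_nhds hk
      refine mdifferentiableAt_belyi_of_chart (F := F) (hT.2 e (Or.inl hef)) h1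
        (hF.differentiableAt hkn) ?_
      filter_upwards [hkn] with w hw
      rw [hsymm, hF' w hw]
    · exact absurd (Or.inr ⟨(f, i), by
        rw [show z = ⟨corner i, corner_mem i⟩ from Subtype.ext hz]; rfl⟩) hx
  intro x
  refine mdifferentiableAt_of_punctured
    (continuous_belyi.comp T.symm.continuous).continuousAt ?_
  have h1 : (S \ {x})ᶜ ∈ 𝓝 x := (hS.subset sdiff_subset).isClosed.isOpen_compl.mem_nhds (by simp)
  rw [eventually_nhdsWithin_iff]
  filter_upwards [h1] with y hy hne
  exact key y fun h => hy ⟨h, hne⟩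

/-- Removability of the preimage of the equator combined with `mdifferentiableAt_of_pt`: a
continuous function only needs to be holomorphic in the Euclidean coordinate inside the faces. This
serves flat charts, conical charts and `cornerPow` alike. -/
theorem mdifferentiableAt_of_continuousOn {T : Triangulation G X}
    (hf : MDifferentiable 𝓘(ℂ) 𝓘(ℂ) (G.belyi ∘ T.symm)) {S : Set G.Polyhedron} (hS : IsOpen S)
    {u : G.Polyhedron → ℂ} (hu : ContinuousOn u S)
    (h : ∀ p ∈ S, ∃ g z, G.pt g z = p ∧ ((z : ℂ) ∈ openTriangle → ∃ H : ℂ → ℂ,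
      DifferentiableAt ℂ H z ∧ ∀ᶠ w : triangle in 𝓝 z, u (G.pt g w) = H w))
    {p : G.Polyhedron} (hp : p ∈ S) : MDifferentiableAt 𝓘(ℂ) 𝓘(ℂ) (u ∘ T.symm) (T p) := by
  refine mdifferentiableAt_of_not_mem_equator hf (not_eventually_belyi_eq T)
    (hS.preimage T.symm.continuous)
    (hu.comp T.symm.continuous.continuousOn (mapsTo_preimage _ _)) ?_
    (show T p ∈ T.symm ⁻¹' S by rwa [mem_preimage, T.symm_apply_apply])
  intro x hx hxE
  obtain ⟨g, z, hz, hH⟩ := h _ hx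
  have hzE : triBelyi z ∉ equator := by
    rwa [Function.comp_apply, ← hz, belyi_pt] at hxE
  obtain ⟨H, hH, hH'⟩ := hH (mem_openTriangle_of_not_mem_equator z.2 hzE).1
  rw [show x = T (G.pt g z) by rw [hz, T.apply_symm_apply]]
  refine mdifferentiableAt_of_pt hf hzE hH ?_
  filter_upwards [hH'] with w hw
  rwa [Function.comp_apply, T.symm_apply_apply]

/-- If the Belyi function is holomorphic, then the conformal atlas of the polyhedron consists of
holomorphic charts. -/
theorem mem_maximalAtlas_of_mem_conformalAtlas {T : Triangulation G X}
    (hf : MDifferentiable 𝓘(ℂ) 𝓘(ℂ) (G.belyi ∘ T.symm))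
    {e : OpenPartialHomeomorph G.Polyhedron ℂ} (he : e ∈ G.conformalAtlas) :
    T.symm.transOpenPartialHomeomorph e ∈ IsManifold.maximalAtlas 𝓘(ℂ) ω X := by
  refine mem_maximalAtlas_of_mdifferentiableAt fun x hx => ?_
  obtain ⟨p, rfl⟩ := T.surjective x
  rw [mem_source_transOpenPartialHomeomorph] at hx
  refine mdifferentiableAt_of_continuousOn hf e.open_source e.continuousOn ?_ hx
  intro p hp
  rcases he with ⟨-, he⟩ | ⟨v, -, he1, he2⟩
  · obtain ⟨g, z, rfl⟩ := exists_pt_eq p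
    refine ⟨g, z, rfl, fun _ => ?_⟩
    obtain ⟨a, b, -, hab⟩ := he g z hp
    exact ⟨fun w => a * w + b, by fun_prop, hab⟩
  · obtain ⟨c, hc, z, hz, rfl⟩ := he1 p hp
    refine ⟨c.1, z, rfl, fun hzo => ?_⟩
    obtain ⟨ρ, -, hρ⟩ := he2 c hc
    refine ⟨fun w => ρ * sectorCoord c.2 w ^ ((6 : ℂ) / (G.numCorners (G.vertex v) : ℂ)), ?_, ?_⟩
    swap
    · have h1 : ∀ᶠ w : triangle in 𝓝 z, dist (w : ℂ) (corner c.2) < 1 / 2 :=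
        (isOpen_lt (by fun_prop) continuous_const).mem_nhds hz
      filter_upwards [h1, (continuous_pt c.1).continuousAt.preimage_mem_nhds
        (e.open_source.mem_nhds hp)] with w hw hw'
      exact hρ w hw hw'
    · have hs : DifferentiableAt ℂ (sectorCoord c.2) z := by unfold sectorCoord; fun_prop
      -- Inside a face the sector coordinate has positive imaginary part, so the principal power is
      -- holomorphic there.
      refine DifferentiableAt.const_mul (hs.cpow_const (Or.inr ?_)) ρ
      rw [sectorCoord_im]
      have := hzo (c.2 + 2)
      have := SchwarzChristoffel.sqrt_three_pos
      positivity

end Triangulation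

/-! ### Sixth powers of sector coordinates near a vertex -/

section

open Filter Set

/-- A zero of finite order of a holomorphic function is a power of a local coordinate. -/
theorem AnalyticAt.exists_pow_eq {g : ℂ → ℂ} {z₀ : ℂ} (hg : AnalyticAt ℂ g z₀) (h0 : g z₀ = 0)
    (hn : ¬ ∀ᶠ z in 𝓝 z₀, g z = 0) : ∃ n : ℕ, n ≠ 0 ∧ ∃ ζ : ℂ → ℂ, AnalyticAt ℂ ζ z₀ ∧ ζ z₀ = 0 ∧
      deriv ζ z₀ ≠ 0 ∧ ∀ᶠ z in 𝓝 z₀, ζ z ^ n = g z := by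
  obtain ⟨n, k, hk, hk0, hgk⟩ := hg.exists_eventuallyEq_pow_smul_nonzero_iff.2 hn
  have hn0 : n ≠ 0 := by
    rintro rfl
    have := hgk.self_of_nhds
    simp [h0] at this
    exact hk0 this.symm
  obtain ⟨a, ha⟩ := IsAlgClosed.exists_pow_nat_eq (k z₀) (Nat.pos_of_ne_zero hn0)
  have ha0 : a ≠ 0 := by rintro rfl; exact hk0 (by rw [← ha, zero_pow hn0])
  -- Here `g = (z - z₀) ^ n * k` with `k z₀ ≠ 0`. The quotient `k z / k z₀` is `1` at `z₀`, so its
  -- principal root is analytic there; `a` is an `n`-th root of `k z₀`.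
  have hq : AnalyticAt ℂ (fun z => a * (k z / k z₀) ^ ((n : ℂ)⁻¹)) z₀ := by
    refine analyticAt_const.mul ((hk.div analyticAt_const hk0).cpow analyticAt_const ?_)
    simp [div_self hk0]
  refine ⟨n, hn0, fun z => (z - z₀) * (a * (k z / k z₀) ^ ((n : ℂ)⁻¹)),
    (analyticAt_id.sub analyticAt_const).mul hq, by simp, ?_, ?_⟩
  · have h1 := ((hasDerivAt_id z₀).sub_const z₀).mul hq.differentiableAt.hasDerivAt
    have h2 : deriv (fun z => (z - z₀) * (a * (k z / k z₀) ^ ((n : ℂ)⁻¹))) z₀ = a := by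
      refine (h1.congr_deriv ?_).deriv
      simp [div_self hk0]
    rw [h2]
    exact ha0
  · filter_upwards [hgk] with z hz
    rw [hz, mul_pow, mul_pow, Complex.cpow_nat_inv_pow _ hn0, ha, smul_eq_mul,
      mul_div_cancel₀ _ hk0]

namespace Equilateral

theorem norm_sectorCoord (i : Fin 3) (z : ℂ) : ‖sectorCoord i z‖ = dist z (corner i) := by
  rw [sectorCoord, norm_div, norm_corner_succ_sub, div_one, dist_eq_norm]

theorem norm_sectorCoord_sq (i : Fin 3) (z : ℂ) : ‖sectorCoord i z‖ ^ 2 =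
    (bary (i + 1) z + bary (i + 2) z / 2) ^ 2 + 3 / 4 * bary (i + 2) z ^ 2 := by
  rw [Complex.sq_norm, Complex.normSq_apply, sectorCoord_re, sectorCoord_im]
  have := SchwarzChristoffel.sqrt_three_mul_self
  linear_combination (1 / 4 * bary (i + 2) z ^ 2) * this

/-- The opposite side is at distance `√3 / 2` from the corner. Radius `1 / 2` also keeps the discs
at different corners disjoint. -/
theorem bary_pos_of_norm_sectorCoord_lt {i : Fin 3} {z : ℂ} (h : ‖sectorCoord i z‖ < 1 / 2) :
    0 < bary i z := by
  have h1 := norm_sectorCoord_sq i z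
  have h2 := bary_sum_add i z
  have h3 : ‖sectorCoord i z‖ ^ 2 < 1 / 4 := by
    have := norm_nonneg (sectorCoord i z)
    nlinarith
  nlinarith [sq_nonneg (bary (i + 1) z), sq_nonneg (bary (i + 2) z),
    sq_nonneg (bary (i + 1) z - bary (i + 2) z)]

theorem eq_of_norm_sectorCoord_lt {i j : Fin 3} {z : ℂ} (hi : ‖sectorCoord i z‖ < 1 / 2)
    (hj : ‖sectorCoord j z‖ < 1 / 2) : i = j := by
  by_contra hij
  rw [norm_sectorCoord] at hi hj
  have h1 : dist (corner i) (corner j) = 1 := by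
    have : j = i + 1 ∨ i = j + 1 := by clear hi hj; revert i j; decide
    rcases this with rfl | rfl
    · rw [dist_comm, dist_eq_norm, norm_corner_succ_sub]
    · rw [dist_eq_norm, norm_corner_succ_sub]
  have h2 := dist_triangle_left (corner i) (corner j) z
  linarith

theorem sectorCoord_add_one_sidePoint (i : Fin 3) (s : ℝ) :
    sectorCoord (i + 1) (sidePoint i s) = (1 - s : ℝ) * -SchwarzChristoffel.omega ^ 2 := by
  have h1 : i + 1 + 1 = i + 2 := by revert i; decide
  have h2 : i + 1 + 2 = i := by revert i; decide
  rw [sectorCoord_eq, h1, h2, bary_sidePoint_two, bary_sidePoint_zero]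
  simp

theorem norm_sectorCoord_sidePoint (i : Fin 3) {s : ℝ} (hs : s ∈ Icc (0 : ℝ) 1) :
    ‖sectorCoord i (sidePoint i s)‖ = s ∧ ‖sectorCoord (i + 1) (sidePoint i s)‖ = 1 - s := by
  rw [sectorCoord_sidePoint, sectorCoord_add_one_sidePoint, norm_mul, norm_neg, norm_pow,
    SchwarzChristoffel.norm_omega, Complex.norm_real, Complex.norm_real, Real.norm_of_nonneg hs.1,
    Real.norm_of_nonneg (by linarith [hs.2])]
  simp

/-- The two sides of a sector differ by the sixth root of unity `-omega ^ 2`. On both of them the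
sixth power is that of the distance from the corner, which is why it matches under the gluing. -/
theorem sectorCoord_add_one_sidePoint_pow_six (i : Fin 3) (s : ℝ) :
    sectorCoord (i + 1) (sidePoint i s) ^ 6 = ((1 - s : ℝ) : ℂ) ^ 6 := by
  have h : (-SchwarzChristoffel.omega ^ 2) ^ 6 = 1 := by
    have : (-SchwarzChristoffel.omega ^ 2) ^ 6 = (SchwarzChristoffel.omega ^ 3) ^ 4 := by ring
    rw [this, SchwarzChristoffel.omega_cube, one_pow]
  rw [sectorCoord_add_one_sidePoint, mul_pow, h, mul_one]

theorem eq_or_eq_of_norm_sectorCoord_sidePoint_lt {i j : Fin 3} {s : ℝ}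
    (h : ‖sectorCoord j (sidePoint i s)‖ < 1 / 2) : j = i ∨ j = i + 1 := by
  have h1 := bary_pos_of_norm_sectorCoord_lt h
  have h2 : j = i ∨ j = i + 1 ∨ j = i + 2 := by clear h h1; revert i j; decide
  rcases h2 with h2 | h2 | rfl
  · exact Or.inl h2
  · exact Or.inr h2
  · rw [bary_sidePoint_two] at h1
    exact absurd h1 (lt_irrefl _)

end Equilateral

namespace TriangleGluing

open Equilateral

variable {G : TriangleGluing}

theorem vertex_glue (c : G.Face × Fin 3) :
    G.vertex ((G.glue c).1, (G.glue c).2 + 1) = G.vertex c ∧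
      G.vertex (G.glue c) = G.vertex (c.1, c.2 + 1) := by
  constructor
  · refine (pt_sidePoint c (s := 0) (by simp) _ _ (corner_eq_sidePoint _) ?_).symm
    rw [sub_zero]; exact corner_add_one_eq_sidePoint _
  · refine (pt_sidePoint c (s := 1) (by simp) _ _ (corner_add_one_eq_sidePoint _) ?_).symm
    rw [sub_self]; exact corner_eq_sidePoint _

/-- The points at distance less than `r` from the corners at `v`. -/
def starSet (v : G.Polyhedron) (r : ℝ) : Set (Σ _ : G.Face, triangle) :=
  {p | ∃ j, G.vertex (p.1, j) = v ∧ ‖sectorCoord j p.2‖ < r}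

theorem starSet_saturated (v : G.Polyhedron) {r : ℝ} (hr : r ≤ 1 / 2)
    (p q : Σ _ : G.Face, triangle) (h : G.Ident p q) (hp : p ∈ starSet v r) : q ∈ starSet v r := by
  obtain ⟨f, z⟩ := p
  obtain ⟨f', z'⟩ := q
  obtain ⟨i, s, hs, hz, rfl, hz'⟩ := h
  obtain ⟨j, hj, hjr⟩ := hp
  have hs' : 1 - s ∈ Icc (0 : ℝ) 1 := ⟨by linarith [hs.2], by linarith [hs.1]⟩
  dsimp only at hz hz' hj hjr
  obtain ⟨h1, h2⟩ := vertex_glue (f, i)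
  rw [hz] at hjr
  rcases eq_or_eq_of_norm_sectorCoord_sidePoint_lt (hjr.trans_le hr) with rfl | rfl
  · refine ⟨(G.glue (f, j)).2 + 1, h1.trans hj, ?_⟩
    rw [hz', (norm_sectorCoord_sidePoint _ hs').2]
    rw [(norm_sectorCoord_sidePoint _ hs).1] at hjr
    linarith
  · refine ⟨(G.glue (f, i)).2, h2.trans hj, ?_⟩
    rw [hz', (norm_sectorCoord_sidePoint _ hs').1]
    rwa [(norm_sectorCoord_sidePoint _ hs).2] at hjr

theorem isOpen_starSet (v : G.Polyhedron) (r : ℝ) : IsOpen (starSet v r) := by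
  have h : starSet v r = ⋃ j, {p : Σ _ : G.Face, triangle | G.vertex (p.1, j) = v ∧
      sectorCoord j p.2 ∈ Metric.ball (0 : ℂ) r} := by
    ext p
    simp [starSet]
  rw [h]
  exact isOpen_iUnion fun j => isOpen_sigma_setOf (p := fun f => G.vertex (f, j) = v)
    Metric.isOpen_ball (continuous_sectorCoord j)

/-- The star of radius `r` at the vertex `v`. -/
def star (v : G.Polyhedron) (r : ℝ) : Set G.Polyhedron := Quot.mk G.Ident '' starSet v r

theorem isOpen_star (v : G.Polyhedron) {r : ℝ} (hr : r ≤ 1 / 2) : IsOpen (star v r) :=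
  isOpen_image_mk (starSet_saturated v hr) (isOpen_starSet v r)

theorem pt_mem_star_iff {v : G.Polyhedron} {r : ℝ} (hr : r ≤ 1 / 2) {f : G.Face} {z : triangle} :
    G.pt f z ∈ star v r ↔ ∃ j, G.vertex (f, j) = v ∧ ‖sectorCoord j z‖ < r :=
  ⟨fun h => mem_of_pt_mem_image (starSet_saturated v hr) h, fun h => ⟨⟨f, z⟩, h, rfl⟩⟩

open Classical in
/-- The function near the vertex `v` which is the sixth power of the Euclidean coordinate in each of
the sectors. -/
noncomputable def cornerPow (v : G.Polyhedron) : G.Polyhedron → ℂ :=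
  Quot.lift (fun p => ∑ j, if G.vertex (p.1, j) = v ∧ ‖sectorCoord j p.2‖ < 1 / 2 then
    sectorCoord j p.2 ^ 6 else 0) (by
    rintro ⟨f, z⟩ ⟨f', z'⟩ ⟨i, s, hs, hz, rfl, hz'⟩
    dsimp only at hz hz' ⊢
    have hs' : 1 - s ∈ Icc (0 : ℝ) 1 := ⟨by linarith [hs.2], by linarith [hs.1]⟩
    -- Only the corners at the ends of side `i` can contribute to the sum on that side, and the
    -- gluing exchanges the two contributions.
    have key : ∀ (f : G.Face) (i : Fin 3) (s : ℝ), s ∈ Icc (0 : ℝ) 1 →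
        (∑ j, if G.vertex (f, j) = v ∧ ‖sectorCoord j (sidePoint i s)‖ < 1 / 2 then
          sectorCoord j (sidePoint i s) ^ 6 else 0) =
        (if G.vertex (f, i) = v ∧ s < 1 / 2 then (s : ℂ) ^ 6 else 0) +
          if G.vertex (f, i + 1) = v ∧ 1 - s < 1 / 2 then ((1 - s : ℝ) : ℂ) ^ 6 else 0 := by
      intro f i s hs
      have h2 : ¬ ‖sectorCoord (i + 2) (sidePoint i s)‖ < 1 / 2 := fun h => by
        rcases eq_or_eq_of_norm_sectorCoord_sidePoint_lt h with h | h
        exacts [(fin_three_facts i).2.2.1 h, (fin_three_facts i).2.2.2.1 h]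
      obtain ⟨h3, -, -, -, -, -, h4, -⟩ := fin_three_facts i
      have h5 := add_third (fun j => if G.vertex (f, j) = v ∧
        ‖sectorCoord j (sidePoint i s)‖ < 1 / 2 then sectorCoord j (sidePoint i s) ^ 6 else 0) h3
      rw [Fin.sum_univ_three, ← h5, h4, if_neg (fun h : _ ∧ ‖sectorCoord (i + 2) _‖ < 1 / 2 => h2 h.2), add_zero,
        (norm_sectorCoord_sidePoint i hs).1, (norm_sectorCoord_sidePoint i hs).2,
        sectorCoord_sidePoint, sectorCoord_add_one_sidePoint_pow_six]
    obtain ⟨h1, h2⟩ := vertex_glue (f, i)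
    rw [hz, hz', key f i s hs, key _ _ _ hs', Prod.mk.eta, h1, h2, sub_sub_cancel, add_comm])

/-- A face may have several corners at `v`, hence the sum; the discs of radius `1 / 2` are disjoint,
so only one summand survives. -/
theorem cornerPow_pt {v : G.Polyhedron} {f : G.Face} {j : Fin 3} (h : G.vertex (f, j) = v)
    {z : triangle} (hz : ‖sectorCoord j z‖ < 1 / 2) :
    cornerPow v (G.pt f z) = sectorCoord j z ^ 6 := by
  classical
  change (∑ k, if G.vertex (f, k) = v ∧ ‖sectorCoord k z‖ < 1 / 2 then
    sectorCoord k (z : ℂ) ^ 6 else 0) = _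
  rw [Finset.sum_eq_single j, if_pos ⟨h, hz⟩]
  · intro k _ hk
    exact if_neg fun h => hk (eq_of_norm_sectorCoord_lt h.2 hz)
  · simp

theorem eventually_cornerPow_pt {v : G.Polyhedron} {f : G.Face} {j : Fin 3}
    (h : G.vertex (f, j) = v) {z : triangle} (hz : ‖sectorCoord j z‖ < 1 / 2) :
    ∀ᶠ w : triangle in 𝓝 z, cornerPow v (G.pt f w) = sectorCoord j w ^ 6 := by
  have h1 : Continuous fun w : triangle => ‖sectorCoord j w‖ :=
    ((continuous_sectorCoord j).comp continuous_subtype_val).norm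
  filter_upwards [(isOpen_lt h1 continuous_const).mem_nhds hz] with w hw
  exact cornerPow_pt h hw

theorem continuousOn_cornerPow (v : G.Polyhedron) : ContinuousOn (cornerPow v) (star v (1 / 2)) := by
  have hq : Topology.IsQuotientMap (Quot.mk G.Ident : (Σ _ : G.Face, triangle) → G.Polyhedron) :=
    isQuotientMap_quot_mk
  refine (hq.continuousOn_isOpen_iff (isOpen_star v le_rfl)).2 ?_
  rintro ⟨f, z⟩ hp
  obtain ⟨j, hj, hjr⟩ := (pt_mem_star_iff le_rfl).1 hp
  refine ContinuousAt.continuousWithinAt ?_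
  rw [← (Topology.IsOpenEmbedding.sigmaMk (σ := fun _ : G.Face => triangle)).continuousAt_iff]
  have h1 : ContinuousAt (fun w : triangle => sectorCoord j w ^ 6) z :=
    ((continuous_sectorCoord j).comp continuous_subtype_val).continuousAt.pow 6
  exact h1.congr (by
    filter_upwards [eventually_cornerPow_pt hj hjr] with w hw
    exact hw.symm)

/-- Each corner at `v` allows some radius, and there are finitely many corners. -/
theorem eventually_star_subset [Finite G.Face] (v : G.Polyhedron) {S : Set G.Polyhedron}
    (hS : IsOpen S) (hv : v ∈ S) : ∃ r > 0, r ≤ 1 / 2 ∧ star v r ⊆ S := by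
  have key : ∀ c : G.Face × Fin 3, ∃ r > 0, G.vertex c = v →
      ∀ z : triangle, ‖sectorCoord c.2 z‖ < r → G.pt c.1 z ∈ S := by
    intro c
    by_cases hc : G.vertex c = v
    · have h1 : G.pt c.1 ⁻¹' S ∈ 𝓝 (⟨corner c.2, corner_mem c.2⟩ : triangle) :=
        (continuous_pt c.1).continuousAt.preimage_mem_nhds (hS.mem_nhds (by
          change G.vertex c ∈ S; rwa [hc]))
      obtain ⟨r, hr, hr'⟩ := Metric.mem_nhds_iff.1 h1
      refine ⟨r, hr, fun _ z hz => hr' ?_⟩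
      rwa [norm_sectorCoord] at hz
    · exact ⟨1, one_pos, fun h => absurd h hc⟩
  choose R hR hR' using key
  obtain ⟨r, hr, hr'⟩ : ∃ r > 0, ∀ c, r ≤ R c := by
    rcases isEmpty_or_nonempty (G.Face × Fin 3) with h | h
    · exact ⟨1, one_pos, fun c => isEmptyElim c⟩
    · obtain ⟨c, hc⟩ := Finite.exists_min R
      exact ⟨R c, hR c, hc⟩
  refine ⟨min r (1 / 2), lt_min hr (by norm_num), min_le_right _ _, ?_⟩
  rintro _ ⟨⟨f, z⟩, ⟨j, hj, hjr⟩, rfl⟩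
  exact hR' (f, j) hj z (hjr.trans_le ((min_le_left _ _).trans (hr' _)))

end TriangleGluing

end

/-! ### Conical charts and the number of sectors -/

section

open Filter Set

theorem Polynomial.card_nthRootsFinset_complex {n : ℕ} (hn : n ≠ 0) {a : ℂ} (ha : a ≠ 0) :
    (Polynomial.nthRootsFinset n a).card = n := by
  have hζ := Complex.isPrimitiveRoot_exp n hn
  rw [Polynomial.nthRootsFinset_def, Multiset.toFinset_card_of_nodup (hζ.nthRoots_nodup ha),
    hζ.card_nthRoots, if_pos (IsAlgClosed.exists_pow_nat_eq a (Nat.pos_of_ne_zero hn))]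

namespace Equilateral

open SchwarzChristoffel

/-- The sixth root of `-1` on the bisector of the sector `0 ≤ arg ≤ π/3`. -/
noncomputable def bisector : ℂ := ⟨√3 / 2, 1 / 2⟩

theorem bisector_pow_six : bisector ^ 6 = -1 := by
  have h3 : bisector ^ 3 = Complex.I := by
    have h := sqrt_three_mul_self
    rw [pow_succ, sq]
    apply Complex.ext
    · simp [bisector]; linear_combination (√3 / 8) * h
    · simp [bisector]; linear_combination (3 / 8) * h
  have : bisector ^ 6 = (bisector ^ 3) ^ 2 := by ring
  rw [this, h3, Complex.I_sq]

theorem norm_bisector : ‖bisector‖ = 1 := by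
  have h : ‖bisector‖ ^ 6 = 1 := by rw [← norm_pow, bisector_pow_six, norm_neg, norm_one]
  exact (pow_eq_one_iff_of_nonneg (norm_nonneg _) (by norm_num)).1 h

theorem omega_mul_bisector : omega * bisector = ⟨-(√3 / 2), 1 / 2⟩ ∧
    omega ^ 2 * bisector = ⟨0, -1⟩ := by
  have h := sqrt_three_mul_self
  have h1 : omega * bisector = ⟨-(√3 / 2), 1 / 2⟩ := by
    apply Complex.ext
    · simp [bisector]; ring
    · simp [bisector]; linear_combination (1 / 4) * h
  refine ⟨h1, ?_⟩
  rw [sq, mul_assoc, h1]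
  apply Complex.ext
  · simp; ring
  · simp; linear_combination (-1 / 4) * h

/-- The six solutions are the rotations of `t * bisector` by multiples of `π/3`, of which only this
one lies in the closed sector. Thus each sector contains at most one solution. -/
theorem eq_mul_bisector_of_pow_six_eq {w : ℂ} (h0 : 0 ≤ w.im) (h1 : w.im ≤ √3 * w.re) {t : ℝ}
    (ht : 0 < t) (h : w ^ 6 = -(t : ℂ) ^ 6) : w = t * bisector := by
  have h3 := sqrt_three_pos
  obtain ⟨e1, e2⟩ := omega_mul_bisector
  set b := (t : ℂ) * bisector with hb
  have hb6 : b ^ 6 = -(t : ℂ) ^ 6 := by rw [hb, mul_pow, bisector_pow_six]; ring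
  have hfac : (w - b) * (w + b) * (w - omega * b) * (w + omega * b) * (w - omega ^ 2 * b) *
      (w + omega ^ 2 * b) = 0 := by
    have : (w - b) * (w + b) * (w - omega * b) * (w + omega * b) * (w - omega ^ 2 * b) *
        (w + omega ^ 2 * b) = w ^ 6 - b ^ 6 := by
      linear_combination (-w ^ 4 * b ^ 2 * (1 - omega + omega ^ 2) +
        w ^ 2 * b ^ 4 * omega ^ 2 * (1 - omega + omega ^ 2) -
        b ^ 6 * (omega - 1) * (omega ^ 3 + 1)) * omega_sq
    rw [this, h, hb6, sub_self]
  have re_eq : ∀ c : ℂ, ((t : ℂ) * c).re = t * c.re := fun c => Complex.re_ofReal_mul t c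
  have im_eq : ∀ c : ℂ, ((t : ℂ) * c).im = t * c.im := fun c => Complex.im_ofReal_mul t c
  have w1 : omega * b = t * (⟨-(√3 / 2), 1 / 2⟩ : ℂ) := by rw [hb, ← e1]; ring
  have w2 : omega ^ 2 * b = t * (⟨0, -1⟩ : ℂ) := by rw [hb, ← e2]; ring
  rw [w1, w2] at hfac
  simp only [mul_eq_zero, sub_eq_zero, add_eq_zero_iff_eq_neg] at hfac
  have hre : 0 ≤ w.re := by
    by_contra hc
    nlinarith
  rcases hfac with ((((hw | hw) | hw) | hw) | hw) | hw
  · exact hw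
  · rw [hw, hb, Complex.neg_im, im_eq] at h0
    simp only [bisector] at h0
    linarith
  · rw [hw, re_eq] at hre
    simp only at hre
    nlinarith
  · rw [hw, Complex.neg_im, im_eq] at h0
    simp only at h0
    linarith
  · rw [hw, im_eq] at h0
    simp only at h0
    linarith
  · rw [hw, Complex.neg_im, Complex.neg_re, im_eq, re_eq] at h1
    simp only at h1
    linarith

theorem sectorCoord_im_le (i : Fin 3) {z : ℂ} (hz : z ∈ triangle) :
    (sectorCoord i z).im ≤ √3 * (sectorCoord i z).re := by
  rw [sectorCoord_im, sectorCoord_re]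
  have := mul_nonneg sqrt_three_pos.le (mem_triangle_iff.1 hz (i + 1))
  nlinarith

theorem sectorPoint_bisector_mem (i : Fin 3) {t : ℝ} (ht : 0 < t) (ht' : t < 1 / 2) :
    sectorPoint i (t * bisector) ∈ openTriangle := by
  obtain ⟨h2, h1⟩ := bary_sectorPoint i (t * bisector)
  have h0 := bary_sum_add i (sectorPoint i (t * bisector))
  have h3 := sqrt_three_pos
  have h4 := sqrt_three_mul_self
  have h5 : 2 / √3 * ((t : ℂ) * bisector).im = t / √3 := by
    rw [Complex.im_ofReal_mul]; simp only [bisector]; ring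
  have h6 : ((t : ℂ) * bisector).re - ((t : ℂ) * bisector).im / √3 = t / √3 := by
    rw [Complex.im_ofReal_mul, Complex.re_ofReal_mul]; simp only [bisector]
    field_simp
    nlinarith
  rw [h5] at h2
  rw [h6] at h1
  have h7 : t / √3 < 1 / 2 := by
    rw [div_lt_iff₀ h3]
    nlinarith
  have h8 : 0 < t / √3 := div_pos ht h3
  change ∀ j, 0 < bary j _
  rw [forall_fin_three_add i]
  exact ⟨by linarith, by linarith, by linarith⟩

end Equilateral

namespace TriangleGluing

open Equilateral

variable {G : TriangleGluing}

theorem eq_of_pt_eq_of_mem_openTriangle {f g : G.Face} {z w : triangle}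
    (hz : (z : ℂ) ∈ openTriangle) (h : G.pt f z = G.pt g w) : f = g ∧ z = w := by
  obtain ⟨e, -, he, he'⟩ := exists_faceChart f
  obtain ⟨h1, h2⟩ := he z hz
  rw [h] at h1 h2
  obtain ⟨rfl, hw⟩ := he' g w h1
  exact ⟨rfl, Subtype.ext (by rw [← h2, (he w hw).2])⟩

/-- A coordinate at the vertex `v` with a power which is the sixth power of the Euclidean coordinate in
the sectors at `v`: the exponent is the number of sectors. -/
theorem eq_numCorners_of_pow_eq [Finite G.Face] {v : G.Polyhedron}
    {e : OpenPartialHomeomorph G.Polyhedron ℂ} {r : ℝ} (hr : 0 < r) (hr' : r ≤ 1 / 2)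
    (hes : e.source = star v r) (he0 : 0 ∈ e.target) {n : ℕ} (hn : n ≠ 0)
    (hpow : ∀ p ∈ e.source, e p ^ n = cornerPow v p) : n = G.numCorners v := by
  obtain ⟨δ, hδ, hδ'⟩ := Metric.isOpen_iff.1 e.open_target 0 he0
  -- Choosing `t ^ 6 < δ ^ n` puts all `n`-th roots of `-t ^ 6` into the ball contained in the
  -- target; `t < r` keeps the points on the bisectors in the star.
  obtain ⟨t, ht0, htr, htδ⟩ : ∃ t : ℝ, 0 < t ∧ t < r ∧ t ^ 6 < δ ^ n := by
    have h1 : Tendsto (fun t : ℝ => t ^ 6) (𝓝[>] 0) (𝓝 0) := by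
      have : ContinuousAt (fun t : ℝ => t ^ 6) 0 := by fun_prop
      simpa [ContinuousAt] using this.tendsto.mono_left nhdsWithin_le_nhds
    have h2 := (h1.eventually (Iio_mem_nhds (pow_pos hδ n))).and (Ioo_mem_nhdsGT hr)
    obtain ⟨t, h3, h4⟩ := h2.exists
    exact ⟨t, h4.1, h4.2, h3⟩
  have hopen : ∀ i : Fin 3, sectorPoint i (t * bisector) ∈ openTriangle := fun i =>
    sectorPoint_bisector_mem i ht0 (htr.trans_le hr')
  let ζ : Fin 3 → triangle := fun i => ⟨_, openTriangle_subset (hopen i)⟩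
  have hζ : ∀ i, sectorCoord i (ζ i) = t * bisector := fun i => sectorCoord_sectorPoint i _
  have hζn : ∀ i, ‖sectorCoord i (ζ i)‖ = t := fun i => by
    rw [hζ, norm_mul, norm_bisector, Complex.norm_real, Real.norm_of_nonneg ht0.le, mul_one]
  have hsrc : ∀ c : G.Face × Fin 3, G.vertex c = v → G.pt c.1 (ζ c.2) ∈ e.source := by
    intro c hc
    rw [hes, pt_mem_star_iff hr']
    exact ⟨c.2, hc, by rwa [hζn]⟩
  have ha : -(t : ℂ) ^ 6 ≠ 0 := by simp [ht0.ne']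
  -- The solutions of `cornerPow v = -t ^ 6` are counted twice: one on the bisector of each sector
  -- at `v`, and `n` of them in the coordinate `e`.
  let Φ : {c : G.Face × Fin 3 // G.vertex c = v} → Polynomial.nthRootsFinset n (-(t : ℂ) ^ 6) :=
    fun c => ⟨e (G.pt c.1.1 (ζ c.1.2)), by
      rw [Polynomial.mem_nthRootsFinset (Nat.pos_of_ne_zero hn), hpow _ (hsrc _ c.2),
        cornerPow_pt c.2 (by rw [hζn]; linarith), hζ, mul_pow, bisector_pow_six]
      ring⟩
  have hΦ : Function.Bijective Φ := by
    constructor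
    · rintro ⟨c, hc⟩ ⟨c', hc'⟩ h
      have h1 := e.injOn (hsrc c hc) (hsrc c' hc') (congrArg Subtype.val h)
      obtain ⟨h2, h3⟩ := eq_of_pt_eq_of_mem_openTriangle (hopen c.2) h1
      have h4 : c.2 = c'.2 := by
        refine eq_of_norm_sectorCoord_lt (z := ζ c.2) ?_ ?_
        · rw [hζn]; linarith
        · rw [h3, hζn]; linarith
      exact Subtype.ext (Prod.ext h2 h4)
    · rintro ⟨y, hy⟩
      rw [Polynomial.mem_nthRootsFinset (Nat.pos_of_ne_zero hn)] at hy
      have hyt : y ∈ e.target := by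
        refine hδ' ?_
        rw [mem_ball_zero_iff]
        refine lt_of_pow_lt_pow_left₀ n hδ.le ?_
        rw [← norm_pow, hy, norm_neg, norm_pow, Complex.norm_real, Real.norm_of_nonneg ht0.le]
        exact htδ
      have hp := e.map_target hyt
      obtain ⟨f, z, hz⟩ := exists_pt_eq (e.symm y)
      have hp' := hp
      rw [← hz, hes, pt_mem_star_iff hr'] at hp'
      obtain ⟨j, hj, hjr⟩ := hp'
      have h1 := hpow _ hp
      rw [e.right_inv hyt, hy, ← hz, cornerPow_pt hj (hjr.trans_le hr')] at h1
      have h2 := eq_mul_bisector_of_pow_six_eq (sectorCoord_im_nonneg j z.2)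
        (sectorCoord_im_le j z.2) ht0 h1.symm
      have h3 : z = ζ j := Subtype.ext (by rw [← sectorPoint_sectorCoord j z, h2])
      refine ⟨⟨(f, j), hj⟩, Subtype.ext ?_⟩
      change e (G.pt f (ζ j)) = y
      rw [← h3, hz, e.right_inv hyt]
  rw [numCorners, Nat.card_congr (Equiv.ofBijective Φ hΦ), Nat.card_eq_fintype_card,
    Fintype.card_coe, Polynomial.card_nthRootsFinset_complex hn ha]

/-- A coordinate at the vertex `v` with a power which is the sixth power of the Euclidean coordinate in
the sectors at `v` is a chart which flattens the cone. -/
theorem isVertexChart_of_pow_eq [Finite G.Face] {v : G.Polyhedron}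
    {e : OpenPartialHomeomorph G.Polyhedron ℂ} {r : ℝ} (hr : 0 < r) (hr' : r ≤ 1 / 2)
    (hes : e.source = star v r) (hv : v ∈ e.source) (hv0 : e v = 0) {n : ℕ} (hn : n ≠ 0)
    (hpow : ∀ p ∈ e.source, e p ^ n = cornerPow v p) : IsVertexChart v e := by
  have hnum := eq_numCorners_of_pow_eq hr hr' hes (hv0 ▸ e.map_source hv) hn hpow
  refine ⟨hv, ?_, ?_⟩
  · intro p hp
    obtain ⟨f, z, rfl⟩ := exists_pt_eq p
    rw [hes, pt_mem_star_iff hr'] at hp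
    obtain ⟨j, hj, hjr⟩ := hp
    exact ⟨(f, j), hj, z, by rw [← norm_sectorCoord]; exact hjr.trans_le hr', rfl⟩
  rintro ⟨f, j⟩ hc
  rw [← hnum]
  have hn' : (n : ℂ) ≠ 0 := Nat.cast_ne_zero.2 hn
  set α : ℂ := 6 / n
  have hα : α ≠ 0 := div_ne_zero (by norm_num) hn'
  have hαn : ∀ w : ℂ, (w ^ α) ^ n = w ^ 6 := by
    intro w
    rw [← Complex.cpow_mul_nat, div_mul_cancel₀ _ hn']
    exact_mod_cast Complex.cpow_natCast w 6
  -- The sector of radius `r` without its apex. It is convex, hence connected, and on it the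
  -- quotient `q` is a continuous `n`-th root of unity, hence a constant `ρ`.
  set D : Set ℂ := {z | z ∈ triangle ∧ dist z (corner j) < r ∧ bary j z < 1}
  have hD : Convex ℝ D := by
    refine (convex_convexHull ℝ _).inter ((convex_ball (corner j) r).inter ?_)
    intro x hx y hy a b ha hb hab
    change bary j _ < 1
    rw [Complex.real_smul, Complex.real_smul, bary_combo j x y hab]
    have hx' : bary j x < 1 := hx
    have hy' : bary j y < 1 := hy
    rcases ha.eq_or_lt with rfl | ha
    · have : b = 1 := by linarith
      subst this; linarith
    · nlinarith
  have hcoord : ∀ z ∈ D, sectorCoord j z ∈ Complex.slitPlane := by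
    intro z hz
    have h0 := mem_triangle_iff.1 hz.1
    have h1 := bary_sum_add j z
    rw [Complex.mem_slitPlane_iff, sectorCoord_re]
    left
    have := h0 (j + 1)
    have := h0 (j + 2)
    have := hz.2.2
    by_contra hc
    linarith
  have hsrc : ∀ z : triangle, dist (z : ℂ) (corner j) < r → G.pt f z ∈ e.source := by
    intro z hz
    rw [hes, pt_mem_star_iff hr']
    exact ⟨j, hc, by rwa [norm_sectorCoord]⟩
  set q : ℂ → ℂ := fun z => e (G.pt f (toTriangle z)) / sectorCoord j z ^ α
  have hne : ∀ z ∈ D, sectorCoord j z ^ α ≠ 0 := fun z hz => by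
    rw [Complex.cpow_ne_zero_iff_of_exponent_ne_zero hα]
    exact Complex.slitPlane_ne_zero (hcoord z hz)
  have hqc : ContinuousOn q D := by
    refine ContinuousOn.div ?_ ?_ hne
    · refine e.continuousOn.comp ((continuous_pt f).comp_continuousOn
        (continuousOn_toTriangle.mono fun z hz => hz.1)) fun z hz => hsrc _ ?_
      rw [toTriangle_of_mem hz.1]; exact hz.2.1
    · exact (continuous_sectorCoord j).continuousOn.cpow_const hcoord
  have hpow' : ∀ z : triangle, dist (z : ℂ) (corner j) < r → e (G.pt f z) ^ n =
      (sectorCoord j z ^ α) ^ n := by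
    intro z hz
    rw [hpow _ (hsrc z hz), cornerPow_pt hc (by rw [norm_sectorCoord]; linarith), hαn]
  have hqn : MapsTo q D (Polynomial.nthRootsFinset n (1 : ℂ)) := by
    intro z hz
    rw [Finset.mem_coe, Polynomial.mem_nthRootsFinset (Nat.pos_of_ne_zero hn)]
    simp only [q]
    rw [div_pow, toTriangle_of_mem hz.1, hpow' ⟨z, hz.1⟩ hz.2.1]
    exact div_self (pow_ne_zero n (hne z hz))
  obtain ⟨ρ, hρ, hqρ⟩ := hD.isPreconnected.eqOn_const_of_mapsTo (Finset.finite_toSet _).isDiscrete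
    hqc hqn ⟨1, by simp [Polynomial.mem_nthRootsFinset (Nat.pos_of_ne_zero hn)]⟩
  rw [Finset.mem_coe, Polynomial.mem_nthRootsFinset (Nat.pos_of_ne_zero hn)] at hρ
  refine ⟨ρ, ?_, ?_⟩
  · have : ‖ρ‖ ^ n = 1 := by rw [← norm_pow, hρ, norm_one]
    exact (pow_eq_one_iff_of_nonneg (norm_nonneg _) hn).1 this
  intro z hz hzs
  rw [hes, pt_mem_star_iff hr'] at hzs
  obtain ⟨k, hk, hkr⟩ := hzs
  obtain rfl : j = k := eq_of_norm_sectorCoord_lt (by rw [norm_sectorCoord]; exact hz)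
    (hkr.trans_le hr')
  have hzr : dist (z : ℂ) (corner j) < r := by rwa [← norm_sectorCoord]
  by_cases h1 : bary j (z : ℂ) < 1
  · have h2 := hqρ ⟨z.2, hzr, h1⟩
    simp only [q, toTriangle_coe, Function.const_apply] at h2
    rwa [div_eq_iff (hne z ⟨z.2, hzr, h1⟩)] at h2
  -- At the apex both sides vanish, because `α ≠ 0`.
  · have h0 := mem_triangle_iff.1 z.2
    have hs := bary_sum_add j (z : ℂ)
    have h2 : sectorCoord j z = 0 := by
      have b1 : bary (j + 1) (z : ℂ) = 0 := by linarith [h0 (j + 1), h0 (j + 2)]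
      have b2 : bary (j + 2) (z : ℂ) = 0 := by linarith [h0 (j + 1), h0 (j + 2)]
      rw [sectorCoord_eq, b1, b2]; simp
    have h3 := hpow' z hzr
    rw [h2, Complex.zero_cpow hα, zero_pow hn] at h3
    rw [h2, Complex.zero_cpow hα, mul_zero]
    exact eq_zero_of_pow_eq_zero h3

end TriangleGluing

namespace Triangulation

open TriangleGluing Equilateral

variable {G : TriangleGluing} {X : Type*} [TopologicalSpace X] [ChartedSpace ℂ X]
  [IsManifold 𝓘(ℂ) ω X]

/-- The function `cornerPow v` is continuous near `v` and holomorphic inside the faces, hence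
holomorphic on `X` near `T v`. It vanishes at `v` without being locally zero, so it is a power of a
local coordinate, and `isVertexChart_of_pow_eq` recognizes that coordinate as conical. -/
theorem exists_isVertexChart [Finite G.Face] {T : Triangulation G X}
    (hf : MDifferentiable 𝓘(ℂ) 𝓘(ℂ) (G.belyi ∘ T.symm)) (c : G.Face × Fin 3) :
    ∃ e, IsVertexChart (G.vertex c) e := by
  set v := G.vertex c
  have hvn : ‖sectorCoord c.2 (corner c.2)‖ = 0 := by rw [norm_sectorCoord, dist_self]
  have hvs : ∀ r, 0 < r → v ∈ star v r := fun r hr =>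
    ⟨⟨c.1, ⟨corner c.2, corner_mem c.2⟩⟩, ⟨c.2, rfl, by rw [hvn]; exact hr⟩, rfl⟩
  have hv0 : cornerPow v v = 0 := by
    have := cornerPow_pt (v := v) (f := c.1) (j := c.2) rfl
      (z := ⟨corner c.2, corner_mem c.2⟩) (by rw [hvn]; norm_num)
    refine this.trans ?_
    rw [norm_eq_zero.1 hvn, zero_pow (by norm_num)]
  have hmd : ∀ p ∈ star v (1 / 2),
      MDifferentiableAt 𝓘(ℂ) 𝓘(ℂ) (cornerPow v ∘ T.symm) (T p) := by
    intro p hp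
    refine mdifferentiableAt_of_continuousOn hf (isOpen_star v le_rfl) (continuousOn_cornerPow v)
      ?_ hp
    intro p hp
    obtain ⟨f, z, rfl⟩ := exists_pt_eq p
    obtain ⟨j, hj, hjr⟩ := (pt_mem_star_iff le_rfl).1 hp
    refine ⟨f, z, rfl, fun _ => ⟨fun w => sectorCoord j w ^ 6, ?_, eventually_cornerPow_pt hj hjr⟩⟩
    have hs : DifferentiableAt ℂ (sectorCoord j) z := by unfold sectorCoord; fun_prop
    exact hs.pow 6
  set x := T v
  set φ := chartAt ℂ x
  have hφ : φ ∈ IsManifold.maximalAtlas 𝓘(ℂ) ω X := IsManifold.chart_mem_maximalAtlas x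
  have hx : x ∈ φ.source := mem_chart_source ℂ x
  set g : ℂ → ℂ := (cornerPow v ∘ T.symm) ∘ φ.symm
  have hstar : ∀ᶠ w in 𝓝 (φ x), T.symm (φ.symm w) ∈ star v (1 / 2) ∧ w ∈ φ.target := by
    have h1 : T.symm ⁻¹' star v (1 / 2) ∈ 𝓝 x :=
      ((isOpen_star v le_rfl).preimage T.symm.continuous).mem_nhds (by
        rw [mem_preimage, T.symm_apply_apply]; exact hvs _ (by norm_num))
    exact ((φ.tendsto_symm hx).eventually h1).and (φ.open_target.mem_nhds (φ.map_source hx))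
  have hg : AnalyticAt ℂ g (φ x) := by
    rw [Complex.analyticAt_iff_eventually_differentiableAt]
    filter_upwards [hstar] with w hw
    have h1 := hmd _ hw.1
    rw [T.apply_symm_apply,
      mdifferentiableAt_iff_differentiableAt_comp_symm hφ (φ.map_target hw.2),
      φ.right_inv hw.2] at h1
    exact h1
  have hg0 : g (φ x) = 0 := by
    simp only [g, Function.comp_apply, φ.left_inv hx]
    rw [T.symm_apply_apply, hv0]
  -- In the star `cornerPow v` vanishes only at `v`. If it vanished near `v`, that vertex would be
  -- isolated, and `belyi` would be locally constant there.
  have hgn : ¬ ∀ᶠ w in 𝓝 (φ x), g w = 0 := by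
    intro h
    refine not_eventually_belyi_eq T x ?_
    filter_upwards [(φ.continuousAt hx).eventually (h.and hstar), φ.open_source.mem_nhds hx]
      with y hy hyφ
    obtain ⟨h1, h2, -⟩ := hy
    simp only [g, Function.comp_apply, φ.left_inv hyφ] at h1 h2
    obtain ⟨f, z, hz⟩ := exists_pt_eq (T.symm y)
    rw [← hz] at h1 h2
    obtain ⟨j, hj, hjr⟩ := (pt_mem_star_iff le_rfl).1 h2
    rw [cornerPow_pt hj hjr] at h1
    have h3 : z = ⟨corner j, corner_mem j⟩ := Subtype.ext (by
      rw [← dist_eq_zero, ← norm_sectorCoord, eq_zero_of_pow_eq_zero h1, norm_zero])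
    have h4 : T.symm y = T.symm x := by
      rw [← hz, h3, T.symm_apply_apply]; exact hj
    rw [Function.comp_apply, Function.comp_apply, h4]
  obtain ⟨n, hn, ζ, hζ, hζ0, hζd, hζg⟩ := hg.exists_pow_eq hg0 hgn
  obtain ⟨ψ, hψ, hψζ, -⟩ := hζ.exists_openPartialHomeomorph hζd
  set e₀ : OpenPartialHomeomorph G.Polyhedron ℂ := T.transOpenPartialHomeomorph (φ.trans ψ)
  have he₀ : ∀ p, e₀ p = ζ (φ (T p)) := fun p => hψζ _
  have hvsrc : v ∈ e₀.source := ⟨hx, hψ⟩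
  have hev : ∀ᶠ p in 𝓝 v, e₀ p ^ n = cornerPow v p := by
    have hc : Tendsto (fun p => φ (T p)) (𝓝 v) (𝓝 (φ x)) :=
      (φ.continuousAt hx).comp T.continuous.continuousAt
    filter_upwards [hc.eventually hζg, e₀.open_source.mem_nhds hvsrc] with p hp hps
    have hl : φ.symm (φ (T p)) = T p := φ.left_inv hps.1
    rw [he₀, hp]
    simp only [g, Function.comp_apply, hl, T.symm_apply_apply]
  obtain ⟨U, hU, hUo, hvU⟩ := _root_.mem_nhds_iff.1 hev
  obtain ⟨r, hr, hr', hrU⟩ := eventually_star_subset v (e₀.open_source.inter hUo) ⟨hvsrc, hvU⟩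
  refine ⟨e₀.restrOpen (star v r) (isOpen_star v hr'), isVertexChart_of_pow_eq hr hr' ?_ ?_ ?_ hn ?_⟩
  · exact inter_eq_right.2 fun p hp => (hrU hp).1
  · exact ⟨hvsrc, hvs r hr⟩
  · change e₀ v = 0
    rw [he₀]; exact hζ0
  · intro p hp
    exact hU (hrU hp.2).2

/-- If the Belyi function is holomorphic, then the structure is that of the equilateral
triangulation. -/
theorem isC1_of_mdifferentiable_belyi {T : Triangulation G X}
    (hf : MDifferentiable 𝓘(ℂ) 𝓘(ℂ) (G.belyi ∘ T.symm)) : T.IsC1 := by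
  have := G.finite_face
  refine ⟨fun x => ?_, fun e he => mem_maximalAtlas_of_mem_conformalAtlas hf he⟩
  obtain ⟨f, z, hz⟩ := exists_pt_eq (T.symm x)
  rw [← hz]
  rcases mem_openTriangle_or z with hz | ⟨i, s, hs, hz⟩ | ⟨i, hz⟩
  · obtain ⟨e, hef, he, -⟩ := exists_faceChart f
    exact ⟨e, Or.inl hef, (he z hz).1⟩
  · obtain ⟨e, hef, -, -, he⟩ := exists_edgeChart (f, i)
    exact ⟨e, Or.inl hef, (he z (by
      rw [hz, sectorCoord_sidePoint]; exact ofReal_mem_kite hs)).1⟩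
  · obtain ⟨e, he⟩ := exists_isVertexChart hf (f, i)
    refine ⟨e, Or.inr ⟨_, he⟩, ?_⟩
    rw [show z = ⟨corner i, corner_mem i⟩ from Subtype.ext hz]
    exact he.1

end Triangulation

end

/-! ### Conclusion -/

namespace Triangulation

open TriangleGluing

variable {G : TriangleGluing} {X : Type*} [TopologicalSpace X] [ChartedSpace ℂ X]
  [IsManifold 𝓘(ℂ) ω X]

/-- If a topological Belyi function is holomorphic, then it is the Belyi function of an equilateral
triangulation with the same cells. -/
theorem exists_sameCells_isC1 {T : Triangulation G X} {β : G.Polyhedron → OnePoint ℂ}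
    (hβ : IsBelyiMap β) (hd : MDifferentiable 𝓘(ℂ) 𝓘(ℂ) (β ∘ T.symm)) :
    ∃ T' : Triangulation G X, T.SameCells T' ∧ T'.IsC1 := by
  obtain ⟨η, h1, h2, h3, h4⟩ := exists_homeomorph_of_isBelyiMap isBelyiMap_belyi hβ
  refine ⟨η.trans T, ⟨fun f => ?_, fun f i => ?_, fun c => ?_⟩, isC1_of_mdifferentiable_belyi ?_⟩
  · change _ = (T ∘ η) '' _
    rw [Set.image_comp, h2]
  · change _ = (T ∘ η) '' _
    rw [Set.image_comp, h3]
  · rw [Homeomorph.trans_apply, h4]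
  -- For `T' = T ∘ η` one has `belyi ∘ T'⁻¹ = β ∘ T⁻¹`, since `β ∘ η = belyi`.
  · convert hd using 1
    funext x
    change G.belyi (η.symm (T.symm x)) = β (T.symm x)
    rw [← h1, η.apply_symm_apply]

/-- The structure of an equilateral triangulation is the pull-back of that of the sphere by its
Belyi function. -/
theorem IsC1.isC2_belyi [T1Space X] {T : Triangulation G X} (hT : T.IsC1) :
    IsC2 (G.belyi ∘ T.symm) :=
  IsC2.of_mdifferentiable (mdifferentiable_belyi_of_isC1 hT)

end Triangulation

theorem mainTheorem4 {X : Type*} [TopologicalSpace X] [T2Space X] [CompactSpace X]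
    [ConnectedSpace X] [ChartedSpace ℂ X] [IsManifold 𝓘(ℂ) ω X] :
    ((∃ (G : TriangleGluing) (T : Triangulation G X) (β : G.Polyhedron → OnePoint ℂ),
        TriangleGluing.IsBelyiMap β ∧ IsC2 (β ∘ T.symm)) ↔
      ∃ (G : TriangleGluing) (T : Triangulation G X), T.IsC1) ∧
    (∀ (G : TriangleGluing) (T : Triangulation G X) (β : G.Polyhedron → OnePoint ℂ),
      TriangleGluing.IsBelyiMap β → IsC2 (β ∘ T.symm) →
        ∃ T' : Triangulation G X, T.SameCells T' ∧ T'.IsC1) ∧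
    (∀ (G : TriangleGluing) (T : Triangulation G X), T.IsC1 →
      ∃ β : G.Polyhedron → OnePoint ℂ, TriangleGluing.IsBelyiMap β ∧
        TriangleGluing.IsConformalOnRightTriangles β ∧ IsC2 (β ∘ T.symm)) := by
  refine ⟨⟨?_, ?_⟩, ?_, ?_⟩
  · rintro ⟨G, T, β, hβ, hC⟩
    obtain ⟨T', -, hT'⟩ := Triangulation.exists_sameCells_isC1 hβ hC.2
    exact ⟨G, T', hT'⟩
  · rintro ⟨G, T, hT⟩
    exact ⟨G, T, G.belyi, TriangleGluing.isBelyiMap_belyi, hT.isC2_belyi⟩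
  · exact fun G T β hβ hC => Triangulation.exists_sameCells_isC1 hβ hC.2
  · exact fun G T hT => ⟨G.belyi, TriangleGluing.isBelyiMap_belyi,
      TriangleGluing.isConformalOnRightTriangles_belyi, hT.isC2_belyi⟩
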